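/- **Theorem (CJupiter satisfies the weak list specification).** Let $n\in\mathbb N$, let $U$ be a set, and let $\alpha$ be a (finite or infinite) execution of the CJupiter protocol with $n$ clients and elements in $U$ in which all inserted elements are unique (no element of $U$ is inserted by two different $\mathrm{do}$ events). Then there is an abstract execution $A=(H,\mathrm{vis})$ such that $\alpha$ complies with $A$ (for each replica $R$, the subsequence of $H$ at $R$ is the subsequence of $\mathrm{do}$ events of $\alpha$ at $R$), $\mathrm{vis}$ is the causally-before relation of $\alpha$ restricted to $\mathrm{do}$ events, and $A$ belongs to the weak list specification of Attiya et al. The notions are as follows. *List operations.* The operations are $\mathrm{Ins}(a,p)$, $\mathrm{Del}(a,p)$ ($a\in U$, $p\in\mathbb N$), $\mathrm{Read}$ and $\mathrm{Nop}$; each returns the resulting list. The list is initially empty. On a list $w$ of length $|w|$, $\mathrm{Ins}(a,p)$ inserts $a$ at position $\min\{p,|w|\}$, and $\mathrm{Del}(a,p)$ deletes the element at position $\min\{p,|w|-1\}$; it is invoked only if that element exists and is $a$. *OT.* Every operation has a priority determined by the client that generated it; a smaller client identifier means a higher priority. $OT(o_1,o_2)$ changes only the position of $o_1$. $OT(\mathrm{Ins}(a_1,p_1),\mathrm{Ins}(a_2,p_2))$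 has position $p_1+1$ if $p_1>p_2$, or if $p_1=p_2$ and $o_1$ has the higher priority, and $p_1$ otherwise; $OT(\mathrm{Ins}(a_1,p_1),\mathrm{Del}(a_2,p_2))$ has position $p_1$ if $p_1\le p_2$ and $p_1-1$ otherwise; $OT(\mathrm{Del}(a_1,p_1),\mathrm{Ins}(a_2,p_2))$ has position $p_1$ if $p_1<p_2$ and $p_1+1$ otherwise; $OT(\mathrm{Del}(a_1,p_1),\mathrm{Del}(a_2,p_2))$ has position $p_1$ if $p_1<p_2$, $p_1-1$ if $p_1>p_2$, and is $\mathrm{Nop}$ if $p_1=p_2$. In all other cases $OT(o_1,o_2)=o_1$. For tuples $op=(o,oid,ctx,sctx)$, with $oid=(cid,seq)$ and sets $ctx,sctx$ of such identifiers, $op\langle op'\rangle=(OT(op.o,op'.o),\,op.oid,\,op.ctx\cup\{op'.oid\},\,op.sctx)$. *State spaces.* Each replica $r$ maintains a directed graph $S$ whose vertices are identified with sets of operation identifiers, and a current vertex $cur$, initially $\emptyset$. Edges are labelled with tuples $op$, and the edges from one vertex are ordered: $op$ is before $op'$ if $op.oid\in op'.sctx$; else after it if $op'.oid\in op.sctx$;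 else before it if $op.oid.cid\ne r$; else after it. The procedure $S.\mathrm{xForm}(op)$ starts with $u=op.ctx$ and $v=u\cup\{op.oid\}$. While $u\neq cur$, it takes the first edge $(op',u')$ from $u$, puts $v'=v\cup\{op'.oid\}$, adds the edges $v\to v'$ labelled $op'\langle op\rangle$ and $u\to v$ labelled $op$, and replaces $(u,v,op)$ by $(u',v',op\langle op'\rangle)$. Finally it adds the edge $u\to v$ labelled $op$, sets $cur=v$ and returns $op$. *Protocol.* There are one server and $n$ clients, and the server generates no operations. When a user invokes $o$ at client $i$, the client applies $o$ and responds with its new list; it forms $op=(o,(i,seq),cur,\emptyset)$ with a fresh sequence number (a position of $o$ beyond the end of the list being replaced by the position at which $o$ acts), adds an edge labelled $op$ from $cur$ to $cur\cup\{op.oid\}$, makes the latter the current vertex, and sends $op$ to the server. When the server receives $op$ from client $i$, it sets $op.sctx$ to the set of identifiers of all operations it has processed before, applies the operation returned by $S.\mathrm{xForm}(op)$, and sends $op$ itself to all other clients. When a client receives $op$ from the server, it applies the operation returned by $S.\mathrm{xForm}(op)$. The channels between the clients and the server are FIFO. *Executions and causality.* An execution is a sequence of events $\mathrm{do}(o,w)$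 (at a client, with response $w$), $\mathrm{send}(m)$, $\mathrm{receive}(m)$, produced by the protocol from the initial state; the messages of a procedure are sent before the replica begins its next procedure. The causally-before relation is the smallest transitive relation such that $e$ is causally before $e'$ if they occur at the same replica and $e$ precedes $e'$, or if $e=\mathrm{send}(m)$ and $e'=\mathrm{receive}(m)$. *Abstract executions.* An abstract execution is a pair $A=(H,\mathrm{vis})$ of a sequence $H$ of $\mathrm{do}$ events and an acyclic transitive relation $\mathrm{vis}\subseteq H\times H$ that contains each pair $(e,e')$ of events at the same replica with $e$ preceding $e'$ in $H$, and all of whose pairs $(e,e')$ have $e$ preceding $e'$ in $H$. Let $\mathrm{elems}(A)$ be the set of elements inserted in $H$, and let $\le_{\mathrm{vis}}$ be the reflexive closure of $\mathrm{vis}$. *Weak list specification.* $A$ belongs to it if and only if there is a relation $\mathrm{lo}\subseteq\mathrm{elems}(A)\times\mathrm{elems}(A)$ such that 1. each event $e=\mathrm{do}(o,w)\in H$ returns a list $w=a_0\ldots a_{m-1}$ with all $a_i\in\mathrm{elems}(A)$ such that (a) for all $a$: $a\in w$ if and only if some $\mathrm{do}(\mathrm{Ins}(a,\_),\_)\le_{\mathrm{vis}}e$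 and no $\mathrm{do}(\mathrm{Del}(a,\_),\_)\le_{\mathrm{vis}}e$; (b) $(a_i,a_j)\in\mathrm{lo}$ for all $i<j$; (c) if $o=\mathrm{Ins}(a,k)$ then $a=a_{\min\{k,m-1\}}$; 2. $\mathrm{lo}$ is irreflexive, and for each event $\mathrm{do}(o,w)\in H$ it is transitive and total on $\{a\mid a\in w\}$ (any two distinct elements are comparable). -/

import Mathlib

namespace CJupiter

/-! ### List operations -/

/-- User operations on a replicated list with elements in `U`. The element `a` of `del a p`
records which element is deleted. -/
inductive ListOp (U : Type*) where
  | ins (a : U) (p : ℕ)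
  | del (a : U) (p : ℕ)
  | read
  | nop

namespace ListOp

variable {U : Type*}

/-- Effect of an operation on the list content. An insertion beyond the end is an insertion at
the end, and a deletion beyond the end deletes the last element. -/
def apply (w : List U) : ListOp U → List U
  | ins a p => w.insertIdx (min p w.length) a
  | del _ p => w.eraseIdx (min p (w.length - 1))
  | read => w
  | nop => w

/-- The operation with the position at which it really acts on the list `w`. -/
def normalize (w : List U) : ListOp U → ListOp U
  | ins a p => ins a (min p w.length)
  | del a p => del a (min p (w.length - 1))
  | read => read
  | nop => nop

/-- An operation may be invoked on the list `w`: the element recorded by a deletion has to be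
the element that is deleted. (So there is no deletion from the empty list.) -/
def Admissible (w : List U) : ListOp U → Prop
  | del a p => w[min p (w.length - 1)]? = some a
  | _ => True

/-- The operational transformation `OT(o₁, o₂)` of `o₁` with `o₂`; here `pr₁` and `pr₂` are the
priorities of the two operations. -/
def ot (pr₁ pr₂ : ℕ) : ListOp U → ListOp U → ListOp U
  | ins a₁ p₁, ins _ p₂ =>
      if p₁ < p₂ then ins a₁ p₁
      else if p₂ < p₁ then ins a₁ (p₁ + 1)
      else if pr₂ < pr₁ then ins a₁ (p₁ + 1)
      else ins a₁ p₁
  | ins a₁ p₁, del _ p₂ => if p₁ ≤ p₂ then ins a₁ p₁ else ins a₁ (p₁ - 1)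
  | del a₁ p₁, ins _ p₂ => if p₁ < p₂ then del a₁ p₁ else del a₁ (p₁ + 1)
  | del a₁ p₁, del _ p₂ =>
      if p₁ < p₂ then del a₁ p₁ else if p₂ < p₁ then del a₁ (p₁ - 1) else nop
  | o, _ => o

/-- The list content obtained by performing a sequence of operations on the initial
(empty) list. -/
def content (σ : List (ListOp U)) : List U :=
  σ.foldl apply []

end ListOp

/-! ### Replicas, operations of the protocol, and `n`-ary ordered state spaces -/

/-- The replicas: one server and `n` clients. -/
inductive Replica (n : ℕ) where
  | server
  | client (i : Fin n)
  deriving DecidableEq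

/-- Operation identifiers: a client identifier and a sequence number. -/
abbrev Oid (n : ℕ) := Fin n × ℕ

/-- The priority of the operations generated by a client: a smaller client identifier means a
higher priority. -/
def priority {n : ℕ} (i : Fin n) : ℕ := n - i

/-- Operations of type `Op`: the signature `o`, the identifier `oid`, the operation context
`ctx`, and the context `sctx` at the server. -/
structure Op (n : ℕ) (U : Type*) where
  o : ListOp U
  oid : Oid n
  ctx : Finset (Oid n)
  sctx : Finset (Oid n)

namespace Op

variable {n : ℕ} {U : Type*}

/-- `op.transform op'` is `op` transformed with `op'`, i.e. `op⟨op'⟩`. -/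
def transform (op op' : Op n U) : Op n U where
  o := ListOp.ot (priority op.oid.1) (priority op'.oid.1) op.o op'.o
  oid := op.oid
  ctx := insert op'.oid op.ctx
  sctx := op.sctx

/-- The comparison of operations at replica `r`: `before r op op'` says that `op` is to the left
of `op'`. -/
def before (r : Replica n) (op op' : Op n U) : Prop :=
  if op.oid ∈ op'.sctx then True
  else if op'.oid ∈ op.sctx then False
  else Replica.client op.oid.1 ≠ r

instance (r : Replica n) (op op' : Op n U) : Decidable (before r op op') := by
  unfold before; infer_instance

end Op

/-- An edge of a state space: its label and the vertex to which it leads. Vertices are identified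
with their sets `oids` of operation identifiers. -/
structure Edge (n : ℕ) (U : Type*) where
  op : Op n U
  target : Finset (Oid n)

/-- The state space maintained by the replica `rid`: `edges u` is the sorted list of the edges
from the vertex with `oids = u`, and `cur` is the most recent vertex. -/
structure CStateSpace (n : ℕ) (U : Type*) where
  rid : Replica n
  edges : Finset (Oid n) → List (Edge n U)
  cur : Finset (Oid n)

namespace CStateSpace

variable {n : ℕ} {U : Type*}

/-- The initial state space, with the single vertex `∅`. -/
def init (r : Replica n) : CStateSpace n U where
  rid := r
  edges := fun _ => []
  cur := ∅

/-- Add an edge from `u` to `v` labelled with `op`, at its place in the order of the edges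
from `u`. -/
def link (S : CStateSpace n U) (u v : Finset (Oid n)) (op : Op n U) : CStateSpace n U :=
  { S with
    edges := Function.update S.edges u
      ((S.edges u).orderedInsert (fun e e' => Op.before S.rid e.op e'.op) ⟨op, v⟩) }

/-- Link `v` to `u` and make `v` the most recent vertex. -/
def finish (S : CStateSpace n U) (u v : Finset (Oid n)) (op : Op n U) : CStateSpace n U :=
  { S.link u v op with cur := v }

/-- The loop `while u ≠ cur` of `xForm`, with a bound on the number of iterations. -/
def xFormLoop : ℕ → CStateSpace n U → Finset (Oid n) → Finset (Oid n) → Op n U →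
    CStateSpace n U × Op n U
  | 0, S, u, v, op => (S.finish u v op, op)
  | k + 1, S, u, v, op =>
    if u = S.cur then (S.finish u v op, op)
    else
      match (S.edges u).head? with
      | none => (S.finish u v op, op)
      | some e =>
        let v' := insert e.op.oid v
        let S' := (S.link v v' (e.op.transform op)).link u v op
        xFormLoop k S' e.target v' (op.transform e.op)

/-- The procedure `xForm`: transform `op` with the operations along the first edges from the
vertex `u` with `u.oids = op.ctx` to the vertex `cur`; returns the new state space and the
transformed operation. An edge adds one identifier to the vertex, so no path to `cur` has more
than `|cur.oids|` edges. -/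
def xForm (S : CStateSpace n U) (op : Op n U) : CStateSpace n U × Op n U :=
  xFormLoop S.cur.card S op.ctx (insert op.oid op.ctx) op

end CStateSpace

/-! ### The protocol -/

/-- The state of a client. `outbox` is the operation that still has to be sent to the server in
the course of the procedure that is being executed. -/
structure ClientState (n : ℕ) (U : Type*) where
  seq : ℕ
  state : List (ListOp U)
  S : CStateSpace n U
  outbox : Option (Op n U)

/-- The state of the server. `outbox i` is the operation that still has to be sent to client `i`
in the course of the procedure that is being executed. -/
structure ServerState (n : ℕ) (U : Type*) where
  soids : Finset (Oid n)
  state : List (ListOp U)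
  S : CStateSpace n U
  outbox : Fin n → Option (Op n U)

section Procedures

variable {n : ℕ} {U : Type*}

/-- Initial state of client `i`. -/
def ClientState.init (i : Fin n) : ClientState n U where
  seq := 0
  state := []
  S := CStateSpace.init (Replica.client i)
  outbox := none

/-- Initial state of the server. -/
def ServerState.init : ServerState n U where
  soids := ∅
  state := []
  S := CStateSpace.init Replica.server
  outbox := fun _ => none

/-- Local processing of the user operation `o` at client `i`. -/
def ClientState.doOp (i : Fin n) (c : ClientState n U) (o : ListOp U) : ClientState n U :=
  let o' := o.normalize (ListOp.content c.state)
  let op : Op n U := ⟨o', (i, c.seq + 1), c.S.cur, ∅⟩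
  { seq := c.seq + 1
    state := c.state ++ [o']
    S := c.S.finish c.S.cur (insert op.oid c.S.cur) op
    outbox := some op }

/-- Remote processing, at a client, of an operation received from the server. -/
def ClientState.receive (c : ClientState n U) (op : Op n U) : ClientState n U :=
  { c with
    state := c.state ++ [(c.S.xForm op).2.o]
    S := (c.S.xForm op).1 }

/-- Processing, at the server, of an operation received from a client. The original operation
(with its `sctx` set) is to be sent to all other clients. -/
def ServerState.receive (s : ServerState n U) (op : Op n U) : ServerState n U :=
  let op₁ : Op n U := { op with sctx := s.soids }
  { soids := insert op.oid s.soids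
    state := s.state ++ [(s.S.xForm op₁).2.o]
    S := (s.S.xForm op₁).1
    outbox := fun j => if j = op.oid.1 then none else some op₁ }

end Procedures

/-! ### Events and executions -/

/-- A `do` event: client `rep` performs the user operation `o`, with response `val`. -/
structure DoEvent (n : ℕ) (U : Type*) where
  rep : Fin n
  o : ListOp U
  val : List U

/-- A message from client `i` to the server, or from the server to client `i`. -/
inductive Message (n : ℕ) (U : Type*) where
  | toServer (i : Fin n) (op : Op n U)
  | toClient (i : Fin n) (op : Op n U)

/-- Events. -/
inductive Event (n : ℕ) (U : Type*) where
  | doe (d : DoEvent n U)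
  | send (m : Message n U)
  | receive (m : Message n U)

section Executions

variable {n : ℕ} {U : Type*}

/-- The replica that sends a message. -/
def Message.sender : Message n U → Replica n
  | toServer i _ => Replica.client i
  | toClient _ _ => Replica.server

/-- The replica to which a message is sent. -/
def Message.recipient : Message n U → Replica n
  | toServer _ _ => Replica.server
  | toClient i _ => Replica.client i

/-- The replica `R(e)` at which an event occurs. -/
def Event.replica : Event n U → Replica n
  | doe d => Replica.client d.rep
  | send m => m.sender
  | receive m => m.recipient

/-- A global configuration: the states of all replicas and the contents of the FIFO channels
between the clients and the server (oldest message first). -/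
structure Config (n : ℕ) (U : Type*) where
  client : Fin n → ClientState n U
  server : ServerState n U
  toServer : Fin n → List (Op n U)
  toClient : Fin n → List (Op n U)

/-- The initial configuration. -/
def Config.init : Config n U where
  client := ClientState.init
  server := ServerState.init
  toServer := fun _ => []
  toClient := fun _ => []

/-- `Step C e C'`: the event `e` can occur in the configuration `C` and leads to `C'`.
The messages of a procedure are sent before its replica starts another procedure;
messages are delivered in the order in which they were sent. -/
inductive Step : Config n U → Event n U → Config n U → Prop
  | doe (C : Config n U) (d : DoEvent n U)
      (idle : (C.client d.rep).outbox = none)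
      (adm : d.o.Admissible (ListOp.content (C.client d.rep).state))
      (val : d.val = ListOp.content ((C.client d.rep).doOp d.rep d.o).state) :
      Step C (Event.doe d)
        { C with client := Function.update C.client d.rep ((C.client d.rep).doOp d.rep d.o) }
  | clientSend (C : Config n U) (i : Fin n) (op : Op n U)
      (out : (C.client i).outbox = some op) :
      Step C (Event.send (Message.toServer i op))
        { C with
          client := Function.update C.client i { C.client i with outbox := none }
          toServer := Function.update C.toServer i (C.toServer i ++ [op]) }
  | serverReceive (C : Config n U) (i : Fin n) (op : Op n U) (q : List (Op n U))
      (idle : ∀ j, C.server.outbox j = none)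
      (queue : C.toServer i = op :: q) :
      Step C (Event.receive (Message.toServer i op))
        { C with
          server := C.server.receive op
          toServer := Function.update C.toServer i q }
  | serverSend (C : Config n U) (i : Fin n) (op : Op n U)
      (out : C.server.outbox i = some op) :
      Step C (Event.send (Message.toClient i op))
        { C with
          server := { C.server with outbox := Function.update C.server.outbox i none }
          toClient := Function.update C.toClient i (C.toClient i ++ [op]) }
  | clientReceive (C : Config n U) (i : Fin n) (op : Op n U) (q : List (Op n U))
      (idle : (C.client i).outbox = none)
      (queue : C.toClient i = op :: q) :
      Step C (Event.receive (Message.toClient i op))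
        { C with
          client := Function.update C.client i ((C.client i).receive op)
          toClient := Function.update C.toClient i q }

/-- `α` is a (finite or infinite) execution of CJupiter. Events of `α` are identified with their
positions, since the same `do` event may occur repeatedly. -/
def IsExecution (α : Stream'.Seq (Event n U)) : Prop :=
  ∃ C : ℕ → Config n U, C 0 = Config.init ∧
    ∀ k e, α.get? k = some e → Step (C k) e (C (k + 1))

/-- All elements inserted in the course of `α` are unique. -/
def UniqueInserts (α : Stream'.Seq (Event n U)) : Prop :=
  ∀ k l d d' a p p', α.get? k = some (Event.doe d) → α.get? l = some (Event.doe d') →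
    d.o = ListOp.ins a p → d'.o = ListOp.ins a p' → k = l

/-- The causally-before relation on (the positions of) the events of `α`. -/
inductive CausallyBefore (α : Stream'.Seq (Event n U)) : ℕ → ℕ → Prop
  | thread {k l : ℕ} {e e' : Event n U} (hk : α.get? k = some e) (hl : α.get? l = some e')
      (hr : e.replica = e'.replica) (lt : k < l) : CausallyBefore α k l
  | message {k l : ℕ} {m : Message n U} (hk : α.get? k = some (Event.send m))
      (hl : α.get? l = some (Event.receive m)) : CausallyBefore α k l
  | trans {k l m : ℕ} (h : CausallyBefore α k l) (h' : CausallyBefore α l m) :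
      CausallyBefore α k m

end Executions

/-! ### Abstract executions and the weak list specification -/

/-- An abstract execution: a (finite or infinite) sequence `H` of `do` events with an acyclic
visibility relation on (the positions of) its events. -/
structure AbstractExecution (n : ℕ) (U : Type*) where
  H : Stream'.Seq (DoEvent n U)
  vis : ℕ → ℕ → Prop
  vis_mem : ∀ i j, vis i j → (∃ d, H.get? i = some d) ∧ ∃ d, H.get? j = some d
  acyclic : ∀ i, ¬ Relation.TransGen vis i i
  vis_of_thread : ∀ i j d d', H.get? i = some d → H.get? j = some d' → i < j →
    d.rep = d'.rep → vis i j
  lt_of_vis : ∀ i j, vis i j → i < j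
  vis_trans : ∀ i j k, vis i j → vis j k → vis i k

namespace AbstractExecution

variable {n : ℕ} {U : Type*}

/-- The set of all elements inserted into the list. -/
def elems (A : AbstractExecution n U) : Set U :=
  {a | ∃ i d p, A.H.get? i = some d ∧ d.o = ListOp.ins a p}

/-- An insertion of `a` equals the event at position `j` or is visible to it. -/
def InsVisible (A : AbstractExecution n U) (a : U) (j : ℕ) : Prop :=
  ∃ i d p, A.H.get? i = some d ∧ d.o = ListOp.ins a p ∧ (i = j ∨ A.vis i j)

/-- A deletion of `a` equals the event at position `j` or is visible to it. -/
def DelVisible (A : AbstractExecution n U) (a : U) (j : ℕ) : Prop :=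
  ∃ i d p, A.H.get? i = some d ∧ d.o = ListOp.del a p ∧ (i = j ∨ A.vis i j)

/-- Membership in the weak list specification. -/
def WeakListSpec (A : AbstractExecution n U) : Prop :=
  ∃ lo : U → U → Prop,
    (∀ a b, lo a b → a ∈ A.elems ∧ b ∈ A.elems) ∧
    (∀ j d, A.H.get? j = some d →
      (∀ a ∈ d.val, a ∈ A.elems) ∧
      (∀ a, a ∈ d.val ↔ A.InsVisible a j ∧ ¬ A.DelVisible a j) ∧
      (∀ i i' (hi : i < d.val.length) (hi' : i' < d.val.length), i < i' →
        lo d.val[i] d.val[i']) ∧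
      (∀ a k, d.o = ListOp.ins a k → d.val[min k (d.val.length - 1)]? = some a)) ∧
    (∀ a, ¬ lo a a) ∧
    (∀ j d, A.H.get? j = some d →
      (∀ a ∈ d.val, ∀ b ∈ d.val, ∀ c ∈ d.val, lo a b → lo b c → lo a c) ∧
      (∀ a ∈ d.val, ∀ b ∈ d.val, a ≠ b → lo a b ∨ lo b a))

/-- The execution `α` complies with `A`, i.e. `α` and `A` have the same subsequence of `do`
events at every replica: `f` matches the events of `A` with the `do` events of `α`, and preserves
the order of the events at each replica. -/
structure CompliesVia (α : Stream'.Seq (Event n U)) (A : AbstractExecution n U) (f : ℕ → ℕ) :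
    Prop where
  map : ∀ i d, A.H.get? i = some d → α.get? (f i) = some (Event.doe d)
  surj : ∀ k d, α.get? k = some (Event.doe d) → ∃ i, A.H.get? i = some d ∧ f i = k
  mono : ∀ i j d d', A.H.get? i = some d → A.H.get? j = some d' → d.rep = d'.rep → i < j →
    f i < f j

end AbstractExecution

end CJupiter

/-!
The reason why CJupiter satisfies the weak list specification is that all its state spaces are parts
of one structure that depends only on a few global data of the execution (`CJupiter.History`): the
order in which the server processes the operations, the operations as generated by the clients, and
the number of operations of the server known to a client when it generates an operation. The
relevant vertices are the sets `History.vertex m j s`, which consist of the first `m` operations at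
the server and the first `s` operations of client `j`. Each edge between such vertices has a
canonical label, which is defined by recursion on `m` (`History.localLabel`, `History.remoteLabel`).
By the transformation property CP1 (`ListOp.apply_ot_comm`), these labels lead to a well-defined
list at each vertex, and this list consists of the elements that are inserted, but not deleted, by
the operations in the vertex (`History.WellFormed.correct`).

Two lists at vertices of this structure never order two common elements differently
(`History.WellFormed.compatible`). The intersection of two vertices is a vertex again, and a common
element of their lists occurs in the list at the intersection, because it is inserted only once. As
an operation does not change the relative order of the elements that survive it, both lists order
the two elements in the same way as the list at the intersection does.

The structure describes what the protocol does because the order of the edges makes the first edge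
from each vertex that of the first missing operation, in the order of the server, followed by the
own operations of the client (`History.IsSpace`). This property is preserved by `xForm`, which
follows the first edges and computes the canonical labels (`History.Receives.isSpace`,
`History.Receives.xForm_snd`). Together with a description of the contents of the channels it forms
an invariant of the protocol (`Inv`, `IsRun.inv`), by which each response is the list at some
vertex, and all these vertices belong to the same history.

The vertex of a client after a `do` event contains exactly the operations whose `do` events are
equal to or causally before it (`IsRun.mem_knowledge_iff`). So every response consists of the
elements prescribed by the visibility relation. For the list order, one takes the relation "`a` and
`b` occur in this order in some response". It is irreflexive, as the responses have no repetitions;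
and on a given response it is the order of this response, by compatibility, hence transitive and
total (`IsRun.weakListSpec`).
-/

namespace CJupiter

/-! ### Operational transformation on lists -/

namespace ListOp

variable {U : Type*}

/-- The operation refers to a position of the list `w` at which it acts literally, that is, without
truncation of the position, and a deletion names the element that it removes. -/
def Valid (w : List U) : ListOp U → Prop
  | ins _ p => p ≤ w.length
  | del a p => w[p]? = some a
  | _ => True

theorem apply_ins {w : List U} {a : U} {p : ℕ} (h : (ins a p).Valid w) :
    (ins a p).apply w = w.insertIdx p a := by
  simp only [Valid] at h
  simp [apply, h]

theorem apply_del {w : List U} {a : U} {p : ℕ} (h : (del a p).Valid w) :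
    (del a p).apply w = w.eraseIdx p := by
  obtain ⟨hp, -⟩ := List.getElem?_eq_some_iff.1 h
  have : min p (w.length - 1) = p := by omega
  simp [apply, this]

/-- A transformed operation acts literally on the list to which it is applied, whatever the
priorities. -/
theorem valid_ot {w : List U} {o₁ o₂ : ListOp U} (pr₁ pr₂ : ℕ) (h₁ : o₁.Valid w)
    (h₂ : o₂.Valid w) : (ot pr₁ pr₂ o₁ o₂).Valid (o₂.apply w) := by
  cases o₂ with
  | read => cases o₁ <;> exact h₁
  | nop => cases o₁ <;> exact h₁
  | ins b q =>
    rw [apply_ins h₂]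
    simp only [Valid] at h₂
    cases o₁ with
    | read => trivial
    | nop => trivial
    | ins a p =>
      simp only [Valid] at h₁
      simp only [ot]
      split_ifs <;> simp only [Valid, List.length_insertIdx] <;> grind
    | del a p =>
      simp only [Valid] at h₁
      obtain ⟨hp, -⟩ := List.getElem?_eq_some_iff.1 h₁
      simp only [ot]
      split_ifs with h <;> simp only [Valid, List.getElem?_insertIdx] <;> grind
  | del b q =>
    rw [apply_del h₂]
    simp only [Valid] at h₂
    obtain ⟨hq, -⟩ := List.getElem?_eq_some_iff.1 h₂
    cases o₁ with
    | read => trivial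
    | nop => trivial
    | ins a p =>
      simp only [Valid] at h₁
      simp only [ot]
      split_ifs <;> simp only [Valid, List.length_eraseIdx] <;> grind
    | del a p =>
      simp only [Valid] at h₁
      obtain ⟨hp, -⟩ := List.getElem?_eq_some_iff.1 h₁
      simp only [ot]
      split_ifs with h <;> simp only [Valid, List.getElem?_eraseIdx] <;> grind

/-- The transformation property CP1: the two ways around the square of two concurrent operations
give the same list. -/
theorem apply_ot_comm {w : List U} {o₁ o₂ : ListOp U} {pr₁ pr₂ : ℕ} (hpr : pr₁ ≠ pr₂)
    (h₁ : o₁.Valid w) (h₂ : o₂.Valid w) :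
    (ot pr₁ pr₂ o₁ o₂).apply (o₂.apply w) = (ot pr₂ pr₁ o₂ o₁).apply (o₁.apply w) := by
  have v₁ := valid_ot pr₁ pr₂ h₁ h₂
  have v₂ := valid_ot pr₂ pr₁ h₂ h₁
  cases o₁ <;> cases o₂ <;> try rfl
  · rename_i a p b q
    rw [apply_ins h₁] at v₂ ⊢
    rw [apply_ins h₂] at v₁ ⊢
    simp only [Valid] at h₁ h₂
    simp only [ot] at v₁ v₂ ⊢
    split_ifs at * <;> first | omega | skip
    all_goals
      rw [apply_ins v₁, apply_ins v₂]
      ext1 k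
      simp only [List.getElem?_insertIdx, List.length_insertIdx]
      grind
  · rename_i a p b q
    rw [apply_ins h₁] at v₂ ⊢
    rw [apply_del h₂] at v₁ ⊢
    simp only [Valid] at h₁ h₂
    obtain ⟨hq, -⟩ := List.getElem?_eq_some_iff.1 h₂
    simp only [ot] at v₁ v₂ ⊢
    split_ifs at * <;> first | omega | skip
    all_goals
      rw [apply_ins v₁, apply_del v₂]
      ext1 k
      simp only [List.getElem?_insertIdx, List.getElem?_eraseIdx, List.length_eraseIdx]
      grind
  · rename_i a p b q
    rw [apply_del h₁] at v₂ ⊢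
    rw [apply_ins h₂] at v₁ ⊢
    simp only [Valid] at h₁ h₂
    obtain ⟨hq, -⟩ := List.getElem?_eq_some_iff.1 h₁
    simp only [ot] at v₁ v₂ ⊢
    split_ifs at * <;> first | omega | skip
    all_goals
      rw [apply_del v₁, apply_ins v₂]
      ext1 k
      simp only [List.getElem?_insertIdx, List.getElem?_eraseIdx, List.length_eraseIdx]
      grind
  · rename_i a p b q
    rw [apply_del h₁] at v₂ ⊢
    rw [apply_del h₂] at v₁ ⊢
    simp only [Valid] at h₁ h₂
    obtain ⟨hp, -⟩ := List.getElem?_eq_some_iff.1 h₁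
    obtain ⟨hq, -⟩ := List.getElem?_eq_some_iff.1 h₂
    rcases lt_trichotomy p q with h | rfl | h
    · have h' : ¬ q < p := by omega
      simp only [ot, if_pos h, if_neg h'] at v₁ v₂ ⊢
      rw [apply_del v₁, apply_del v₂]
      ext1 k
      simp only [List.getElem?_eraseIdx]
      grind
    · simp [ot, apply]
    · have h' : ¬ p < q := by omega
      simp only [ot, if_pos h, if_neg h'] at v₁ v₂ ⊢
      rw [apply_del v₁, apply_del v₂]
      ext1 k
      simp only [List.getElem?_eraseIdx]
      grind

theorem valid_normalize {w : List U} {o : ListOp U} (h : o.Admissible w) :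
    (o.normalize w).Valid w := by
  cases o with
  | ins a p => simp [normalize, Valid]
  | del a p => exact h
  | read => trivial
  | nop => trivial

theorem content_append_singleton (σ : List (ListOp U)) (o : ListOp U) :
    content (σ ++ [o]) = o.apply (content σ) := by
  simp [content]

/-- `l` may be the result of transforming `o`: it has the same kind and element, except that a
deletion of `a` may have become `nop`, provided that `a` is among the elements `D` that have been
deleted by other operations. -/
def Descends (D : U → Prop) : ListOp U → ListOp U → Prop
  | ins a _, ins b _ => a = b
  | del a _, del b _ => a = b
  | del a _, nop => D a
  | read, read => True
  | nop, nop => True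
  | _, _ => False

theorem Descends.refl (D : U → Prop) (o : ListOp U) : Descends D o o := by
  cases o <;> simp [Descends]

theorem Descends.mono {D D' : U → Prop} {o l : ListOp U} (hD : ∀ a, D a → D' a)
    (h : Descends D o l) : Descends D' o l := by
  cases o <;> cases l <;> simp_all [Descends]

/-- The kind and the element of an operation survive transformation. The only exception is that a
deletion becomes `nop` when it is transformed with a deletion at the same position; then both delete
the same element, which therefore belongs to `D'`. -/
theorem Descends.ot {D D' : U → Prop} {w : List U} {o₁ l₁ o₂ l₂ : ListOp U} (pr₁ pr₂ : ℕ)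
    (hD : ∀ a, D a → D' a) (hdel : ∀ a p, o₂ = del a p → D' a)
    (h₁ : Descends D o₁ l₁) (h₂ : Descends D o₂ l₂) (v₁ : l₁.Valid w) (v₂ : l₂.Valid w) :
    Descends D' o₁ (ListOp.ot pr₁ pr₂ l₁ l₂) := by
  have h₁ := h₁.mono hD
  cases l₂ with
  | read => cases l₁ <;> exact h₁
  | nop => cases l₁ <;> exact h₁
  | ins b q =>
    cases l₁ <;> simp only [ListOp.ot] <;> (try split_ifs) <;>
      cases o₁ <;> simp_all [Descends]
  | del b q =>
    cases l₁ with
    | read => exact h₁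
    | nop => exact h₁
    | ins a p =>
      simp only [ListOp.ot]
      split_ifs <;> cases o₁ <;> simp_all [Descends]
    | del a p =>
      simp only [ListOp.ot]
      split_ifs with h h'
      · exact h₁
      · cases o₁ <;> simp_all [Descends]
      · obtain rfl : p = q := by omega
        simp only [Valid] at v₁ v₂
        obtain rfl : a = b := by simpa [v₁] using v₂
        cases o₁ <;> simp_all only [Descends]
        cases o₂ <;> simp_all

end ListOp

/-- The list `w` has no repetitions and consists of the elements that are inserted and not
deleted, where only inserted elements are deleted. -/
structure Explains {U : Type*} (I D : U → Prop) (w : List U) : Prop where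
  nodup : w.Nodup
  mem_iff : ∀ a, a ∈ w ↔ I a ∧ ¬ D a
  inserted : ∀ a, D a → I a

section Explains

variable {U : Type*} {I D I' D' : U → Prop} {w : List U} {o l : ListOp U}

/-- The effect of applying `l`, which descends from a new operation `o`. If a deletion has become
`nop`, its element has already been deleted, so nothing has to change. -/
theorem Explains.apply (h : Explains I D w) (hv : l.Valid w) (hd : ListOp.Descends D o l)
    (hI : ∀ a, I' a ↔ I a ∨ ∃ p, o = ListOp.ins a p)
    (hD : ∀ a, D' a ↔ D a ∨ ∃ p, o = ListOp.del a p)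
    (hnew : ∀ a p, o = ListOp.ins a p → ¬ I a) : Explains I' D' (l.apply w) := by
  cases l with
  | read =>
    have : ∀ a p, o ≠ ListOp.ins a p ∧ o ≠ ListOp.del a p := by
      intro a p; cases o <;> simp_all [ListOp.Descends]
    obtain rfl : I' = I := by ext a; simp [hI, this]
    obtain rfl : D' = D := by ext a; simp [hD, this]
    exact h
  | nop =>
    have h1 : ∀ a p, o ≠ ListOp.ins a p := by
      intro a p; cases o <;> simp_all [ListOp.Descends]
    have h2 : ∀ a p, o = ListOp.del a p → D a := by
      rintro a p rfl
      exact hd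
    obtain rfl : I' = I := by ext a; simp [hI, h1]
    obtain rfl : D' = D := by
      ext a
      rw [hD]
      exact ⟨fun hh => hh.elim id fun ⟨p, hp⟩ => h2 a p hp, Or.inl⟩
    exact h
  | ins a p =>
    obtain ⟨q, rfl⟩ : ∃ q, o = ListOp.ins a q := by
      cases o <;> simp_all [ListOp.Descends]
    have hna : ¬ I a := hnew a q rfl
    have haw : a ∉ w := fun ha => hna ((h.mem_iff a).1 ha).1
    have hDD : ∀ b, D' b ↔ D b := by simp [hD]
    have hII : ∀ b, I' b ↔ I b ∨ b = a := by
      intro b; rw [hI]; simp [eq_comm]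
    rw [ListOp.apply_ins hv]
    have hp : p ≤ w.length := hv
    refine ⟨?_, ?_, ?_⟩
    · exact (List.perm_insertIdx a w hp).nodup_iff.2 (List.nodup_cons.2 ⟨haw, h.nodup⟩)
    · intro b
      rw [List.mem_insertIdx hp, h.mem_iff, hII, hDD]
      constructor
      · rintro (rfl | h')
        · exact ⟨Or.inr rfl, fun hh => hna (h.inserted _ hh)⟩
        · exact ⟨Or.inl h'.1, h'.2⟩
      · rintro ⟨h1 | h1, h2⟩
        · exact Or.inr ⟨h1, h2⟩
        · exact Or.inl h1
    · intro b hb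
      exact (hII b).2 (Or.inl (h.inserted b ((hDD b).1 hb)))
  | del a p =>
    obtain ⟨q, rfl⟩ : ∃ q, o = ListOp.del a q := by
      cases o <;> simp_all [ListOp.Descends]
    have hII : ∀ b, I' b ↔ I b := by simp [hI]
    have hDD : ∀ b, D' b ↔ D b ∨ b = a := by
      intro b; rw [hD]; simp [eq_comm]
    rw [ListOp.apply_del hv]
    obtain ⟨hp, hpa⟩ := List.getElem?_eq_some_iff.1 hv
    have haw : a ∈ w := hpa ▸ List.getElem_mem hp
    refine ⟨h.nodup.eraseIdx p, ?_, ?_⟩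
    · intro b
      have : b ∈ w.eraseIdx p ↔ b ≠ a ∧ b ∈ w := by
        classical
        rw [← hpa, ← List.Nodup.erase_getElem h.nodup, h.nodup.mem_erase_iff]
      rw [this, h.mem_iff, hII, hDD]
      tauto
    · intro b hb
      rcases (hDD b).1 hb with hb | rfl
      · exact (hII b).2 (h.inserted b hb)
      · exact (hII b).2 ((h.mem_iff b).1 haw).1

theorem pair_sublist_or {a b : U} (ha : a ∈ w) (hb : b ∈ w) (hab : a ≠ b) :
    [a, b].Sublist w ∨ [b, a].Sublist w := by
  induction w with
  | nil => simp at ha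
  | cons c w ih =>
    rcases List.mem_cons.1 ha with rfl | ha'
    · have hb' : b ∈ w := (List.mem_cons.1 hb).resolve_left hab.symm
      exact Or.inl ((List.singleton_sublist.2 hb').cons_cons a)
    · rcases List.mem_cons.1 hb with rfl | hb'
      · exact Or.inr ((List.singleton_sublist.2 ha').cons_cons b)
      · exact (ih ha' hb').imp (List.Sublist.cons c) (List.Sublist.cons c)

theorem not_pair_sublist_swap {a b : U} (hn : w.Nodup) (h : [a, b].Sublist w) :
    ¬ [b, a].Sublist w := by
  induction w with
  | nil => simp at h
  | cons c w ih =>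
    obtain ⟨hc, hn⟩ := List.nodup_cons.1 hn
    intro h'
    have mem : ∀ {x y : U}, [x, y].Sublist w → y ∈ w := fun h => h.subset (by simp)
    cases h with
    | cons _ h =>
      cases h' with
      | cons _ h' => exact ih hn h h'
      | cons_cons _ h' => exact hc (mem h)
    | cons_cons _ h =>
      cases h' with
      | cons _ h' => exact hc (mem h')
      | cons_cons _ h' => exact hc (List.singleton_sublist.1 h)

theorem pair_sublist_of_lt {i j : ℕ} (hi : i < w.length) (hj : j < w.length) (hij : i < j) :
    [w[i], w[j]].Sublist w := by
  have h₁ : w[i] ∈ w.take j := List.mem_take_iff_getElem.2 ⟨i, by omega, rfl⟩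
  have h₂ : w[j] ∈ w.drop j := by
    rw [List.drop_eq_getElem_cons hj]
    exact List.mem_cons_self
  have := (List.singleton_sublist.2 h₁).append (List.singleton_sublist.2 h₂)
  rwa [List.take_append_drop] at this

theorem pair_sublist_trans {a b c : U} (hn : w.Nodup) (h : [a, b].Sublist w)
    (h' : [b, c].Sublist w) : [a, c].Sublist w := by
  have hac : a ≠ c := by
    rintro rfl
    exact not_pair_sublist_swap hn h h'
  refine (pair_sublist_or (h.subset (by simp)) (h'.subset (by simp)) hac).resolve_right ?_
  induction w with
  | nil => simp at h
  | cons e w ih =>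
    obtain ⟨he, hn⟩ := List.nodup_cons.1 hn
    have mem : ∀ {x y : U}, [x, y].Sublist w → x ∈ w ∧ y ∈ w :=
      fun h => ⟨h.subset (by simp), h.subset (by simp)⟩
    intro hca
    cases h with
    | cons _ h =>
      cases h' with
      | cons _ h' =>
        cases hca with
        | cons _ hca => exact ih hn h h' hca
        | cons_cons _ hca => exact he (mem h').2
      | cons_cons _ h' => exact he (mem h).2
    | cons_cons _ h =>
      cases hca with
      | cons _ hca => exact he (mem hca).2
      | cons_cons _ hca => exact hac rfl

/-- An operation does not change the relative order of the elements that survive it. -/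
theorem ListOp.pair_sublist_apply {a b : U} (hn : w.Nodup) (hv : l.Valid w)
    (h : [a, b].Sublist w) (ha : a ∈ l.apply w) (hb : b ∈ l.apply w) :
    [a, b].Sublist (l.apply w) := by
  cases l with
  | read => exact h
  | nop => exact h
  | ins c p =>
    rw [ListOp.apply_ins hv]
    exact h.trans (List.sublist_insertIdx ..)
  | del c p =>
    rw [ListOp.apply_del hv] at *
    have hs := List.eraseIdx_sublist w p
    have hab : a ≠ b := by
      have := h.nodup hn
      simpa using this
    exact (pair_sublist_or ha hb hab).resolve_right
      fun h' => not_pair_sublist_swap hn h (h'.trans hs)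

end Explains

end CJupiter

namespace CJupiter

/-! ### Histories and the canonical labels of the edges -/

section VertexOf

variable {n : ℕ}

/-- The vertex that contains the first `x j` operations of every client `j`. -/
def vertexOf (x : Fin n → ℕ) : Finset (Oid n) :=
  Finset.univ.biUnion fun j => (Finset.Icc 1 (x j)).image (Prod.mk j)

theorem mem_vertexOf {x : Fin n → ℕ} {q : Oid n} : q ∈ vertexOf x ↔ 1 ≤ q.2 ∧ q.2 ≤ x q.1 := by
  obtain ⟨j, s⟩ := q
  simp [vertexOf]

theorem vertexOf_mono {x y : Fin n → ℕ} (h : ∀ j, x j ≤ y j) : vertexOf x ⊆ vertexOf y := by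
  intro q hq
  rw [mem_vertexOf] at hq ⊢
  exact ⟨hq.1, hq.2.trans (h _)⟩

theorem insert_vertexOf {x y : Fin n → ℕ} {j : Fin n} (hj : y j = x j + 1)
    (h : ∀ i, i ≠ j → y i = x i) : insert (j, x j + 1) (vertexOf x) = vertexOf y := by
  ext ⟨i, s⟩
  simp only [Finset.mem_insert, mem_vertexOf, Prod.mk.injEq]
  by_cases hi : i = j
  · subst hi
    simp only [true_and]
    omega
  · simp [hi, h i hi]

end VertexOf

/-- The data of an execution that determine the labels of all edges in all state spaces. They are
total functions; only the values at operations that occur in the execution matter. -/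
structure History (n : ℕ) (U : Type*) where
  /-- the operation that the server processes after `m` others -/
  ser : ℕ → Oid n
  /-- the list operation as generated by its client, with its effective position -/
  org : Oid n → ListOp U
  /-- a number `m` such that the first `m` operations processed by the server, together with
  earlier operations of the same client, form the context in which the operation is generated -/
  base : Oid n → ℕ

namespace History

variable {n : ℕ} {U : Type*} (h : History n U)

/-- The number of operations of client `j` among the first `m` operations at the server. -/
def own : ℕ → Fin n → ℕ
  | 0, _ => 0
  | m + 1, j => own m j + if (h.ser m).1 = j then 1 else 0

/-- The set of the first `m` operations processed by the server. -/
def served (m : ℕ) : Finset (Oid n) := vertexOf (h.own m)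

/-- The vertex that consists of the first `m` operations at the server and the first `s`
operations of client `j`. Since the server processes the operations of `j` in their order, it does
not depend on `s` as long as `s ≤ h.own m j`. -/
def vertex (m : ℕ) (j : Fin n) (s : ℕ) : Finset (Oid n) :=
  vertexOf (Function.update (h.own m) j (max (h.own m j) s))

/-- Transforms `o` successively with `l a, …, l (s - 1)`; the result is `o` if `s ≤ a`. Here `pr` is
the priority of `o`, and `pr'` is that of all `l t`. -/
def transformFrom (pr pr' : ℕ) (o : ListOp U) (l : ℕ → ListOp U) (a : ℕ) : ℕ → ListOp U
  | 0 => o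
  | s + 1 => if s < a then o else ListOp.ot pr pr' (transformFrom pr pr' o l a s) (l s)

/-- The label of the operation number `s + 1` of client `j` at the vertex `h.vertex m j s`, for
`h.own m j ≤ s`. Up to `m = h.base (j, s + 1)` it is the operation as generated. The operation
number `m + 1` at the server is either an operation of `j`, which belongs to the vertex already, or
an operation of another client `i`; then the label is transformed with that of the latter operation
at the same vertex, i.e. with `h.remoteLabel m j s`, which is unfolded here for the sake of the
recursion. -/
def localLabel : ℕ → Fin n → ℕ → ListOp U
  | 0 => fun j s => h.org (j, s + 1)
  | m + 1 =>
    let i := (h.ser m).1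
    fun j s =>
      if m < h.base (j, s + 1) then h.org (j, s + 1)
      else if i = j then localLabel m j s
      else ListOp.ot (priority j) (priority i) (localLabel m j s)
        (transformFrom (priority i) (priority j) (localLabel m i (h.own m i)) (localLabel m j)
          (h.own m j) s)

/-- The label of the operation number `m + 1` at the server at the vertex `h.served m`. -/
def serverLabel (m : ℕ) : ListOp U := h.localLabel m (h.ser m).1 (h.own m (h.ser m).1)

/-- The label of the operation number `m + 1` at the server at the vertex `h.vertex m j s`. -/
def remoteLabel (m : ℕ) (j : Fin n) (s : ℕ) : ListOp U :=
  transformFrom (priority (h.ser m).1) (priority j) (h.serverLabel m) (h.localLabel m j)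
    (h.own m j) s

/-- The list at the server after `m` operations. -/
def serverList : ℕ → List U
  | 0 => []
  | m + 1 => (h.serverLabel m).apply (serverList m)

/-- The list at the vertex `h.vertex m j s`, which results from the list at `h.served m` by the
operations of client `j` that the server has not yet processed. -/
def list (m : ℕ) (j : Fin n) : ℕ → List U
  | 0 => h.serverList m
  | s + 1 => if s < h.own m j then h.serverList m else (h.localLabel m j s).apply (list m j s)

variable {h} {m m' s s' : ℕ} {i j : Fin n}

theorem own_succ_self : h.own (m + 1) (h.ser m).1 = h.own m (h.ser m).1 + 1 := by simp [own]

theorem own_succ_of_ne (hj : (h.ser m).1 ≠ j) : h.own (m + 1) j = h.own m j := by simp [own, hj]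

theorem own_mono (hm : m ≤ m') (j : Fin n) : h.own m j ≤ h.own m' j := by
  induction hm with
  | refl => rfl
  | step _ ih => exact ih.trans (Nat.le_add_right _ _)

theorem vertex_of_le (hs : s ≤ h.own m j) : h.vertex m j s = h.served m := by
  rw [vertex, max_eq_left hs, Function.update_eq_self, served]

theorem vertex_succ (hs : h.own m j ≤ s) :
    h.vertex m j (s + 1) = insert (j, s + 1) (h.vertex m j s) := by
  have e := insert_vertexOf (x := Function.update (h.own m) j (max (h.own m j) s))
    (y := Function.update (h.own m) j (max (h.own m j) (s + 1))) (j := j)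
    (by simp only [Function.update_self]; omega)
    (fun i hi => by simp [hi])
  rw [vertex, vertex, ← e, Function.update_self, max_eq_right hs]

theorem notMem_vertex (hs : h.own m j ≤ s) : (j, s + 1) ∉ h.vertex m j s := by
  simp [vertex, mem_vertexOf]
  omega

theorem served_subset_vertex : h.served m ⊆ h.vertex m j s := by
  refine vertexOf_mono fun i => ?_
  by_cases hi : i = j
  · subst hi; simp
  · simp [hi]

theorem vertex_mono (hs : s ≤ s') : h.vertex m j s ⊆ h.vertex m j s' := by
  refine vertexOf_mono fun i => ?_
  by_cases hi : i = j
  · subst hi; simp; omega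
  · simp [hi]

theorem list_of_le (hs : s ≤ h.own m j) : h.list m j s = h.serverList m := by
  cases s with
  | zero => rfl
  | succ s => rw [list, if_pos (Nat.lt_of_succ_le hs)]

theorem list_succ (hs : h.own m j ≤ s) :
    h.list m j (s + 1) = (h.localLabel m j s).apply (h.list m j s) := by
  rw [list, if_neg (by omega)]

theorem remoteLabel_of_le (hs : s ≤ h.own m j) : h.remoteLabel m j s = h.serverLabel m := by
  cases s with
  | zero => rfl
  | succ s => rw [remoteLabel, transformFrom, if_pos (Nat.lt_of_succ_le hs)]

theorem remoteLabel_succ (hs : h.own m j ≤ s) : h.remoteLabel m j (s + 1) =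
    ListOp.ot (priority (h.ser m).1) (priority j) (h.remoteLabel m j s) (h.localLabel m j s) := by
  rw [remoteLabel, transformFrom, if_neg (by omega)]
  rfl

theorem localLabel_of_le_base (hm : m ≤ h.base (j, s + 1)) :
    h.localLabel m j s = h.org (j, s + 1) := by
  cases m with
  | zero => rfl
  | succ m => simp only [localLabel]; rw [if_pos (Nat.lt_of_succ_le hm)]

theorem localLabel_succ_of_eq (hb : h.base (j, s + 1) ≤ m) (hj : (h.ser m).1 = j) :
    h.localLabel (m + 1) j s = h.localLabel m j s := by
  simp only [localLabel]
  rw [if_neg (by omega), if_pos hj]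

theorem localLabel_succ_of_ne (hb : h.base (j, s + 1) ≤ m) (hj : (h.ser m).1 ≠ j) :
    h.localLabel (m + 1) j s =
      ListOp.ot (priority j) (priority (h.ser m).1) (h.localLabel m j s) (h.remoteLabel m j s) := by
  simp only [localLabel]
  rw [if_neg (by omega), if_neg hj]
  rfl

/-- The history is that of an execution in which `M` operations have been processed by the server
and `T j` operations have been generated by each client `j`. -/
structure WellFormed (h : History n U) (M : ℕ) (T : Fin n → ℕ) : Prop where
  ser_snd : ∀ m, m < M → (h.ser m).2 = h.own m (h.ser m).1 + 1
  own_le : ∀ j, h.own M j ≤ T j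
  base_mono : ∀ j s, s + 1 < T j → h.base (j, s + 1) ≤ h.base (j, s + 2)
  own_base : ∀ j s, s < T j → h.own (h.base (j, s + 1)) j ≤ s
  base_ser : ∀ m, m < M → h.base (h.ser m) ≤ m
  valid : ∀ j s, s < T j → (h.org (j, s + 1)).Valid (h.list (h.base (j, s + 1)) j s)
  unique : ∀ q q' a p p', q ∈ vertexOf T → q' ∈ vertexOf T → h.org q = ListOp.ins a p →
    h.org q' = ListOp.ins a p' → q = q'

/-- The set `h.vertex m j s` is a vertex of the state spaces: every operation of client `j` in it
has been generated in a context contained in it. -/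
structure IsVertex (h : History n U) (T : Fin n → ℕ) (m : ℕ) (j : Fin n) (s : ℕ) : Prop where
  own_le : h.own m j ≤ s
  le : s ≤ T j
  base_le : h.own m j < s → h.base (j, s) ≤ m

/-- The element `a` is inserted by an operation in `X`. -/
def Inserted (h : History n U) (X : Finset (Oid n)) (a : U) : Prop :=
  ∃ q ∈ X, ∃ p, h.org q = ListOp.ins a p

/-- The element `a` is deleted by an operation in `X`. -/
def Deleted (h : History n U) (X : Finset (Oid n)) (a : U) : Prop :=
  ∃ q ∈ X, ∃ p, h.org q = ListOp.del a p

theorem inserted_insert {X : Finset (Oid n)} {q : Oid n} {a : U} :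
    h.Inserted (insert q X) a ↔ h.Inserted X a ∨ ∃ p, h.org q = ListOp.ins a p := by
  simp [Inserted, or_comm]

theorem deleted_insert {X : Finset (Oid n)} {q : Oid n} {a : U} :
    h.Deleted (insert q X) a ↔ h.Deleted X a ∨ ∃ p, h.org q = ListOp.del a p := by
  simp [Deleted, or_comm]

/-- The list `w` consists of the elements that are inserted and not deleted in `X`. -/
abbrev ExplainsAt (h : History n U) (X : Finset (Oid n)) (w : List U) : Prop :=
  Explains (h.Inserted X) (h.Deleted X) w

/-- The list operation `l` can be the label of an edge with operation identifier `q` from the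
vertex `X` with list `w`. -/
structure IsLabel (h : History n U) (X : Finset (Oid n)) (w : List U) (q : Oid n)
    (l : ListOp U) : Prop where
  valid : l.Valid w
  descends : ListOp.Descends (h.Deleted X) (h.org q) l

theorem priority_ne (hij : i ≠ j) : priority i ≠ priority j := by
  unfold priority
  have := i.isLt
  have := j.isLt
  intro e
  exact hij (Fin.ext (by omega))

theorem IsLabel.ot {X : Finset (Oid n)} {w : List U} {q q' : Oid n} {l l' : ListOp U} (pr pr' : ℕ)
    (hl : h.IsLabel X w q l) (hl' : h.IsLabel X w q' l') :
    h.IsLabel (insert q' X) (l'.apply w) q (ListOp.ot pr pr' l l') where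
  valid := ListOp.valid_ot _ _ hl.valid hl'.valid
  descends := ListOp.Descends.ot pr pr' (fun _ ha => deleted_insert.2 (Or.inl ha))
    (fun _ p hp => deleted_insert.2 (Or.inr ⟨p, hp⟩)) hl.descends hl'.descends hl.valid hl'.valid

namespace WellFormed

variable {M : ℕ} {T : Fin n → ℕ}

theorem ser_eq (wf : h.WellFormed M T) (hm : m < M) :
    h.ser m = ((h.ser m).1, h.own m (h.ser m).1 + 1) :=
  Prod.ext rfl (wf.ser_snd m hm)

theorem served_succ (wf : h.WellFormed M T) (hm : m < M) :
    h.served (m + 1) = insert (h.ser m) (h.served m) := by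
  rw [wf.ser_eq hm]
  exact (insert_vertexOf own_succ_self fun i hi => own_succ_of_ne hi.symm).symm

theorem ser_notMem_served (wf : h.WellFormed M T) (hm : m < M) : h.ser m ∉ h.served m := by
  rw [served, mem_vertexOf, wf.ser_snd m hm]
  omega

theorem ser_mem_served (wf : h.WellFormed M T) (hm : m < m') (hm' : m' ≤ M) :
    h.ser m ∈ h.served m' := by
  have : h.ser m ∈ h.served (m + 1) := by
    rw [wf.served_succ (by omega)]
    exact Finset.mem_insert_self _ _
  exact vertexOf_mono (own_mono hm) this

theorem card_served (wf : h.WellFormed M T) (hm : m ≤ M) : (h.served m).card = m := by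
  induction m with
  | zero =>
    rw [Finset.card_eq_zero, Finset.eq_empty_iff_forall_notMem]
    intro q
    rw [served, mem_vertexOf]
    simp only [own]
    omega
  | succ m ih =>
    rw [wf.served_succ hm, Finset.card_insert_of_notMem (wf.ser_notMem_served hm), ih (by omega)]

theorem ser_notMem_vertex (wf : h.WellFormed M T) (hm : m < M) (hj : (h.ser m).1 ≠ j) :
    h.ser m ∉ h.vertex m j s := by
  rw [vertex, mem_vertexOf, Function.update_of_ne hj, wf.ser_snd m hm]
  omega

theorem vertex_succ_of_ne (wf : h.WellFormed M T) (hm : m < M) (hj : (h.ser m).1 ≠ j) :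
    h.vertex (m + 1) j s = insert (h.ser m) (h.vertex m j s) := by
  have e := insert_vertexOf (x := Function.update (h.own m) j (max (h.own m j) s))
    (y := Function.update (h.own (m + 1)) j (max (h.own (m + 1) j) s)) (j := (h.ser m).1)
    (by simp [hj, own_succ_self]) (by
      intro i hi
      by_cases hij : i = j
      · subst hij; simp [own_succ_of_ne hi.symm]
      · simp [hij, own_succ_of_ne hi.symm])
  rw [Function.update_of_ne hj, ← wf.ser_eq hm] at e
  rw [vertex, vertex, e]

theorem vertex_succ_of_eq (hj : (h.ser m).1 = j) (hs : h.own m j < s) :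
    h.vertex (m + 1) j s = h.vertex m j s := by
  subst hj
  unfold vertex
  congr 1
  ext i
  by_cases hi : i = (h.ser m).1
  · subst hi
    simp only [Function.update_self, own_succ_self]
    omega
  · simp [hi, own_succ_of_ne (Ne.symm hi)]

theorem vertex_subset (wf : h.WellFormed M T) (hm : m ≤ M) (hs : s ≤ T j) :
    h.vertex m j s ⊆ vertexOf T := by
  refine vertexOf_mono fun i => ?_
  have h1 := (own_mono (h := h) hm i).trans (wf.own_le i)
  by_cases hi : i = j
  · subst hi; simp [h1, hs]
  · simp [hi, h1]

theorem base_mono_of_le (wf : h.WellFormed M T) (hs : s ≤ s') (hs' : s' < T j) :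
    h.base (j, s + 1) ≤ h.base (j, s' + 1) := by
  induction hs with
  | refl => rfl
  | @step k hk ih => exact (ih (by omega)).trans (wf.base_mono j _ hs')

theorem isVertex_of_le (wf : h.WellFormed M T) (hv : h.IsVertex T m j s) (h₁ : h.own m j ≤ s')
    (h₂ : s' ≤ s) : h.IsVertex T m j s' := by
  refine ⟨h₁, h₂.trans hv.le, fun h₃ => ?_⟩
  obtain ⟨s, rfl⟩ : ∃ t, s = t + 1 := ⟨s - 1, by omega⟩
  obtain ⟨s', rfl⟩ : ∃ t, s' = t + 1 := ⟨s' - 1, by omega⟩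
  exact (wf.base_mono_of_le (by omega) hv.le).trans (hv.base_le (by omega))

/-- Going along an edge preserves the description of the list by the operations in the vertex; the
uniqueness of insertions enters here. -/
theorem explainsAt_insert (wf : h.WellFormed M T) {X : Finset (Oid n)} {w : List U} {q : Oid n}
    {l : ListOp U} (he : h.ExplainsAt X w) (hl : h.IsLabel X w q l) (hq : q ∉ X)
    (hX : insert q X ⊆ vertexOf T) : h.ExplainsAt (insert q X) (l.apply w) := by
  refine he.apply hl.valid hl.descends (fun _ => inserted_insert) (fun _ => deleted_insert) ?_
  rintro a p hp ⟨q', hq', p', hp'⟩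
  have := wf.unique q q' a p p' (hX (Finset.mem_insert_self _ _))
    (hX (Finset.mem_insert_of_mem hq')) hp hp'
  exact hq (this ▸ hq')

/-- At the vertices `h.vertex m j s`, the list at the server consists of the right elements, and
the labels of the operations of the clients fit the lists. -/
structure Correct (h : History n U) (T : Fin n → ℕ) (m : ℕ) : Prop where
  explains : h.ExplainsAt (h.served m) (h.serverList m)
  isLabel : ∀ j s, h.own m j ≤ s → s < T j → h.base (j, s + 1) ≤ m →
    h.IsLabel (h.vertex m j s) (h.list m j s) (j, s + 1) (h.localLabel m j s)

theorem Correct.isLabel_serverLabel (wf : h.WellFormed M T) (hm : m < M) (hc : Correct h T m) :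
    h.IsLabel (h.served m) (h.serverList m) (h.ser m) (h.serverLabel m) := by
  have h1 : h.own m (h.ser m).1 < T (h.ser m).1 := by
    have h2 := (own_mono (h := h) hm (h.ser m).1).trans (wf.own_le _)
    rwa [own_succ_self] at h2
  have h2 : h.base ((h.ser m).1, h.own m (h.ser m).1 + 1) ≤ m := by
    rw [← wf.ser_eq hm]
    exact wf.base_ser m hm
  have h3 := hc.isLabel _ _ le_rfl h1 h2
  rwa [vertex_of_le le_rfl, list_of_le le_rfl, ← wf.ser_eq hm] at h3

theorem Correct.explains_vertex (wf : h.WellFormed M T) (hm : m ≤ M) (hc : Correct h T m)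
    (hv : h.IsVertex T m j s) : h.ExplainsAt (h.vertex m j s) (h.list m j s) := by
  obtain ⟨d, rfl⟩ := Nat.exists_eq_add_of_le hv.own_le
  induction d with
  | zero =>
    rw [vertex_of_le (by simp), list_of_le (by simp)]
    exact hc.explains
  | succ d ih =>
    rw [← Nat.add_assoc, vertex_succ (by simp), list_succ (by simp)]
    have hb := hv.base_le (by omega)
    refine wf.explainsAt_insert (ih (wf.isVertex_of_le hv (by omega) (by omega)))
      (hc.isLabel _ _ (by omega) hv.le hb) (notMem_vertex (by omega)) ?_
    rw [← vertex_succ (by omega)]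
    exact wf.vertex_subset hm hv.le

/-- The labels of the operations processed by the server lead from the list at each vertex
`h.vertex m j s` to the list at `h.vertex (m + 1) j s`. This is the iteration of CP1 along the
operations of client `j` that the server has not yet processed. -/
theorem Correct.remote (wf : h.WellFormed M T) (hm : m < M) (hc : Correct h T m)
    (hv : h.IsVertex T m j s) (hj : (h.ser m).1 ≠ j ∨ s = h.own m j) :
    h.IsLabel (h.vertex m j s) (h.list m j s) (h.ser m) (h.remoteLabel m j s) ∧
      (h.remoteLabel m j s).apply (h.list m j s) = h.list (m + 1) j s := by
  obtain ⟨d, rfl⟩ := Nat.exists_eq_add_of_le hv.own_le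
  induction d with
  | zero =>
    have hle : h.own m j ≤ h.own (m + 1) j := own_mono (by omega) _
    rw [Nat.add_zero, vertex_of_le le_rfl, list_of_le le_rfl, remoteLabel_of_le le_rfl,
      list_of_le hle]
    exact ⟨hc.isLabel_serverLabel wf hm, rfl⟩
  | succ d ih =>
    have hj : (h.ser m).1 ≠ j := hj.resolve_right (by omega)
    obtain ⟨h1, h2⟩ := ih (wf.isVertex_of_le hv (by omega) (by omega)) (Or.inl hj)
    have hb : h.base (j, h.own m j + d + 1) ≤ m := hv.base_le (by omega)
    have h3 := hc.isLabel j (h.own m j + d) (by omega) hv.le hb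
    rw [← Nat.add_assoc, vertex_succ (by omega), list_succ (by omega), remoteLabel_succ (by omega),
      list_succ (by rw [own_succ_of_ne hj]; omega), localLabel_succ_of_ne hb hj, ← h2]
    exact ⟨h1.ot _ _ h3, ListOp.apply_ot_comm (priority_ne hj) h1.valid h3.valid⟩

/-- If the server processes an operation of client `j` that belongs to `h.vertex m j s`, then
`h.vertex (m + 1) j s` is the same vertex, and its list does not change either. -/
theorem list_succ_of_eq (wf : h.WellFormed M T) (hj : (h.ser m).1 = j)
    (hv : h.IsVertex T m j s) (hs : h.own m j < s) :
    h.list (m + 1) j s = h.list m j s := by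
  have ho : h.own (m + 1) j = h.own m j + 1 := by subst hj; exact own_succ_self
  obtain ⟨d, rfl⟩ := Nat.exists_eq_add_of_lt hs
  induction d with
  | zero =>
    rw [list_of_le (by omega), list_succ (by omega), list_of_le (by omega)]
    subst hj
    rfl
  | succ d ih =>
    have hb : h.base (j, h.own m j + d + 1 + 1) ≤ m := hv.base_le (by omega)
    rw [← Nat.add_assoc, list_succ (by omega),
      ih (wf.isVertex_of_le hv (by omega) (by omega)) (by omega), localLabel_succ_of_eq hb hj,
      ← list_succ (by omega)]

theorem correct (wf : h.WellFormed M T) (hm : m ≤ M) : Correct h T m := by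
  induction m with
  | zero =>
    constructor
    · have : ∀ q, q ∉ h.served 0 := by
        intro q
        rw [served, mem_vertexOf]
        simp only [own]
        omega
      constructor
      · simp [serverList]
      · intro a
        simp [serverList, Inserted, this]
      · rintro a ⟨q, hq, -⟩
        exact absurd hq (this q)
    · intro j s hs hT hb
      have hv := wf.valid j s hT
      rw [Nat.le_zero.1 hb] at hv
      exact ⟨hv, ListOp.Descends.refl _ _⟩
  | succ m ih =>
    have hc := ih (by omega)
    constructor
    · have hl := hc.isLabel_serverLabel wf hm
      rw [wf.served_succ hm]
      refine wf.explainsAt_insert hc.explains hl (wf.ser_notMem_served hm) ?_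
      rw [← wf.served_succ hm]
      exact vertexOf_mono fun i => (own_mono hm i).trans (wf.own_le i)
    · intro j s hs hT hb
      rcases Nat.lt_or_ge m (h.base (j, s + 1)) with hb' | hb'
      · have hb : h.base (j, s + 1) = m + 1 := by omega
        have hv := wf.valid j s hT
        rw [hb] at hv
        rw [localLabel_of_le_base hb.ge]
        exact ⟨hv, ListOp.Descends.refl _ _⟩
      · have hle : h.own m j ≤ h.own (m + 1) j := own_mono (by omega) _
        have hv : h.IsVertex T m j (s + 1) := ⟨by omega, hT, fun _ => hb'⟩
        have hv' := wf.isVertex_of_le hv (hle.trans hs) (Nat.le_succ s)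
        have hl := hc.isLabel j s (hle.trans hs) hT hb'
        by_cases hj : (h.ser m).1 = j
        · have ho : h.own (m + 1) j = h.own m j + 1 := by subst hj; exact own_succ_self
          rw [vertex_succ_of_eq hj (by omega), wf.list_succ_of_eq hj hv' (by omega),
            localLabel_succ_of_eq hb' hj]
          exact hl
        · obtain ⟨h1, h2⟩ := hc.remote wf hm hv' (Or.inl hj)
          rw [wf.vertex_succ_of_ne hm hj, localLabel_succ_of_ne hb' hj, ← h2]
          exact hl.ot _ _ h1

end WellFormed

end History

end CJupiter

namespace CJupiter

namespace History

/-! ### Pairwise compatibility of the lists at all vertices -/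

variable {n : ℕ} {U : Type*} {h : History n U} {m m' s s' M : ℕ} {i j : Fin n} {T : Fin n → ℕ}

theorem Inserted.mono {X Y : Finset (Oid n)} {a : U} (hXY : X ⊆ Y) (ha : h.Inserted X a) :
    h.Inserted Y a := by
  obtain ⟨q, hq, p, hp⟩ := ha
  exact ⟨q, hXY hq, p, hp⟩

theorem Deleted.mono {X Y : Finset (Oid n)} {a : U} (hXY : X ⊆ Y) (ha : h.Deleted X a) :
    h.Deleted Y a := by
  obtain ⟨q, hq, p, hp⟩ := ha
  exact ⟨q, hXY hq, p, hp⟩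

/-- An element does not come back after its deletion. -/
theorem ExplainsAt.mem_between {X Y Z : Finset (Oid n)} {u v w : List U} {a : U}
    (hu : h.ExplainsAt X u) (hv : h.ExplainsAt Y v) (hw : h.ExplainsAt Z w) (hXY : X ⊆ Y)
    (hYZ : Y ⊆ Z) (hau : a ∈ u) (haw : a ∈ w) : a ∈ v :=
  (hv.mem_iff a).2 ⟨((hu.mem_iff a).1 hau).1.mono hXY,
    fun hd => ((hw.mem_iff a).1 haw).2 (hd.mono hYZ)⟩

theorem list_max : h.list m j (max (h.own m j) s) = h.list m j s := by
  rcases le_total (h.own m j) s with hs | hs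
  · rw [max_eq_right hs]
  · rw [max_eq_left hs, list_of_le le_rfl, list_of_le hs]

theorem vertex_max : h.vertex m j (max (h.own m j) s) = h.vertex m j s := by
  unfold vertex
  congr 2
  omega

theorem vertex_subset_vertex (hm : m ≤ m') (hs : s ≤ s') : h.vertex m j s ⊆ h.vertex m' j s' := by
  refine vertexOf_mono fun i => ?_
  have := own_mono (h := h) hm i
  by_cases hi : i = j
  · subst hi; simp; omega
  · simp [hi, this]

theorem IsVertex.max_of_le (hv : h.IsVertex T m j s) (hm : m ≤ m') (hT : h.own m' j ≤ T j) :
    h.IsVertex T m' j (max (h.own m' j) s) := by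
  have := own_mono (h := h) hm j
  refine ⟨le_max_left _ _, max_le hT hv.le, fun h1 => ?_⟩
  have h2 : max (h.own m' j) s = s := by omega
  rw [h2] at h1 ⊢
  exact (hv.base_le (by omega)).trans hm

namespace WellFormed

theorem own_le_of_le (wf : h.WellFormed M T) (hm : m ≤ M) : h.own m j ≤ T j :=
  (own_mono hm j).trans (wf.own_le j)

theorem explains_vertex (wf : h.WellFormed M T) (hm : m ≤ M) (hv : h.IsVertex T m j s) :
    h.ExplainsAt (h.vertex m j s) (h.list m j s) :=
  (wf.correct hm).explains_vertex wf hm hv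

/-- The order of two elements is preserved from a vertex to the vertices that contain more
operations of the same client, and the same operations of the server. -/
theorem pair_sublist_local {a b : U} (wf : h.WellFormed M T) (hm : m ≤ M)
    (hv : h.IsVertex T m j s') (h₁ : h.own m j ≤ s) (h₂ : s ≤ s')
    (hab : [a, b].Sublist (h.list m j s)) (ha : a ∈ h.list m j s') (hb : b ∈ h.list m j s') :
    [a, b].Sublist (h.list m j s') := by
  induction h₂ with
  | refl => exact hab
  | @step k hk ih =>
    have hk : s ≤ k := hk
    have hs := wf.isVertex_of_le hv h₁ (by omega)
    have hk' := wf.isVertex_of_le hv (h₁.trans hk) (Nat.le_succ k)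
    have mem : ∀ {c}, c ∈ h.list m j s → c ∈ h.list m j (k + 1) → c ∈ h.list m j k := fun h1 h2 =>
      ExplainsAt.mem_between (wf.explains_vertex hm hs) (wf.explains_vertex hm hk')
        (wf.explains_vertex hm hv) (vertex_mono hk) (vertex_mono (Nat.le_succ k)) h1 h2
    have hl := (wf.correct hm).isLabel j k hk'.own_le hv.le
      (hv.base_le (Nat.lt_succ_of_le hk'.own_le))
    have := ih hk' (mem (hab.subset (by simp)) ha) (mem (hab.subset (by simp)) hb)
    rw [Nat.succ_eq_add_one, list_succ hk'.own_le] at ha hb ⊢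
    exact ListOp.pair_sublist_apply (wf.explains_vertex hm hk').nodup hl.valid this ha hb

/-- The order of two elements is preserved when the server processes more operations. -/
theorem pair_sublist_remote {a b : U} (wf : h.WellFormed M T) (hm' : m' ≤ M) (hm : m ≤ m')
    (hv : h.IsVertex T m j s) (hab : [a, b].Sublist (h.list m j s)) (ha : a ∈ h.list m' j s)
    (hb : b ∈ h.list m' j s) : [a, b].Sublist (h.list m' j s) := by
  induction hm with
  | refl => exact hab
  | @step k hk ih =>
    have hk : m ≤ k := hk
    have hs := wf.explains_vertex (by omega) hv
    have hk' := hv.max_of_le hk (wf.own_le_of_le (M := M) (by omega))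
    have hk'' := hv.max_of_le (m' := k + 1) (by omega) (wf.own_le_of_le (M := M) hm')
    have e₁ := wf.explains_vertex (by omega) hk'
    have e₂ := wf.explains_vertex (by omega) hk''
    rw [list_max, vertex_max] at e₁ e₂
    have mem : ∀ {c}, c ∈ h.list m j s → c ∈ h.list (k + 1) j s → c ∈ h.list k j s := fun h1 h2 =>
      ExplainsAt.mem_between hs e₁ e₂ (vertex_subset_vertex hk le_rfl)
        (vertex_subset_vertex (Nat.le_succ k) le_rfl) h1 h2
    have hab' := ih (by omega) (mem (hab.subset (by simp)) ha) (mem (hab.subset (by simp)) hb)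
    by_cases hj : (h.ser k).1 ≠ j ∨ s ≤ h.own k j
    · obtain ⟨h1, h2⟩ := (wf.correct (m := k) (by omega)).remote wf hm' hk'
        (hj.imp_right fun hle => max_eq_left hle)
      have hle : h.own k j ≤ h.own (k + 1) j := own_mono (by omega) _
      have h3 : h.list (k + 1) j (max (h.own k j) s) = h.list (k + 1) j s := by
        rw [← list_max, ← list_max (s := s)]
        congr 1
        omega
      rw [h3, list_max] at h2
      rw [list_max] at h1
      rw [← h2] at ha hb ⊢
      exact ListOp.pair_sublist_apply e₁.nodup h1.valid hab' ha hb
    · push Not at hj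
      rw [max_eq_right hj.2.le] at hk'
      rw [wf.list_succ_of_eq hj.1 hk' hj.2]
      exact hab'

/-- Two elements that occur at two vertices have been inserted in, and are not deleted in, the
intersection of the two vertices. This is a vertex again, so the two elements occur in its list, in
some order, which is preserved along the paths to the two vertices. -/
theorem compatible_of_le {a b : U} (wf : h.WellFormed M T) (hm : m ≤ m') (hm' : m' ≤ M)
    (hv : h.IsVertex T m i s) (hv' : h.IsVertex T m' j s') (hne : a ≠ b)
    (ha : a ∈ h.list m i s) (hb : b ∈ h.list m i s)
    (ha' : a ∈ h.list m' j s') (hb' : b ∈ h.list m' j s') :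
    ([a, b].Sublist (h.list m i s) ∧ [a, b].Sublist (h.list m' j s')) ∨
      ([b, a].Sublist (h.list m i s) ∧ [b, a].Sublist (h.list m' j s')) := by
  have hown : ∀ k, h.own m k ≤ h.own m' k := own_mono hm
  -- the intersection of the two vertices is the vertex `h.vertex m i t`
  obtain ⟨t, ht₁, ht₂, hsub, hsub', hcase⟩ : ∃ t, h.own m i ≤ t ∧ t ≤ s ∧
      h.vertex m i s ∩ h.vertex m' j s' ⊆ h.vertex m i t ∧ h.vertex m' i t ⊆ h.vertex m' j s' ∧
      ((i = j ∧ t ≤ s') ∨ t ≤ h.own m' i) := by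
    by_cases hij : i = j
    · subst hij
      refine ⟨min s s', le_min hv.own_le ((hown i).trans hv'.own_le), min_le_left _ _, ?_,
        vertex_mono (min_le_right _ _), Or.inl ⟨rfl, min_le_right _ _⟩⟩
      intro q
      simp only [vertex, Finset.mem_inter, mem_vertexOf]
      have := hv'.own_le
      have := hown i
      by_cases hq : q.1 = i
      · simp [hq]; omega
      · simp [hq]; omega
    · have := hv.own_le
      have := hown i
      refine ⟨min s (h.own m' i), le_min hv.own_le (hown i), min_le_left _ _, ?_, ?_,
        Or.inr (min_le_right _ _)⟩
      · intro q
        simp only [vertex, Finset.mem_inter, mem_vertexOf]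
        by_cases hq : q.1 = i
        · simp [hq, hij]; omega
        · simp [hq]; omega
      · rw [vertex_of_le (min_le_right _ _)]
        exact served_subset_vertex
  have hv₀ := wf.isVertex_of_le hv ht₁ ht₂
  have e₀ := wf.explains_vertex (hm.trans hm') hv₀
  have e₁ := wf.explains_vertex (hm.trans hm') hv
  have e₂ := wf.explains_vertex hm' hv'
  have hvt := hv₀.max_of_le hm (wf.own_le_of_le (M := M) hm')
  have e₃ := wf.explains_vertex hm' hvt
  rw [list_max, vertex_max] at e₃
  have mem : ∀ {c}, c ∈ h.list m i s → c ∈ h.list m' j s' → c ∈ h.list m i t := by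
    intro c hc hc'
    obtain ⟨⟨q, hq, p, hp⟩, hd⟩ := (e₁.mem_iff c).1 hc
    obtain ⟨⟨q', hq', p', hp'⟩, -⟩ := (e₂.mem_iff c).1 hc'
    obtain rfl := wf.unique q q' c p p' (wf.vertex_subset (hm.trans hm') hv.le hq)
      (wf.vertex_subset hm' hv'.le hq') hp hp'
    exact (e₀.mem_iff c).2 ⟨⟨q, hsub (Finset.mem_inter.2 ⟨hq, hq'⟩), p, hp⟩,
      fun hd' => hd (hd'.mono (vertex_mono ht₂))⟩
  have mem₃ : ∀ {c}, c ∈ h.list m i t → c ∈ h.list m' j s' → c ∈ h.list m' i t := fun h1 h2 =>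
    ExplainsAt.mem_between e₀ e₃ e₂ (vertex_subset_vertex hm le_rfl) hsub' h1 h2
  have key : ∀ {c d}, [c, d].Sublist (h.list m i t) → c ∈ h.list m i s → d ∈ h.list m i s →
      c ∈ h.list m' j s' → d ∈ h.list m' j s' →
      [c, d].Sublist (h.list m i s) ∧ [c, d].Sublist (h.list m' j s') := by
    intro c d hcd hc hd hc' hd'
    refine ⟨wf.pair_sublist_local (hm.trans hm') hv ht₁ ht₂ hcd hc hd, ?_⟩
    have h1 := wf.pair_sublist_remote hm' hm hv₀ hcd (mem₃ (mem hc hc') hc') (mem₃ (mem hd hd') hd')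
    rcases hcase with ⟨rfl, hts⟩ | hle
    · rw [← list_max] at h1
      exact wf.pair_sublist_local hm' hv' (le_max_left _ _) (max_le hv'.own_le hts) h1 hc' hd'
    · rw [list_of_le hle, ← list_of_le (j := j) le_rfl] at h1
      exact wf.pair_sublist_local hm' hv' le_rfl hv'.own_le h1 hc' hd'
  rcases pair_sublist_or (mem ha ha') (mem hb hb') hne with hab | hba
  · exact Or.inl (key hab ha hb ha' hb')
  · exact Or.inr (key hba hb ha hb' ha')

/-- Two elements that occur together in the lists at two vertices occur in the same order. -/
theorem compatible {a b : U} (wf : h.WellFormed M T) (hm : m ≤ M) (hm' : m' ≤ M)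
    (hv : h.IsVertex T m i s) (hv' : h.IsVertex T m' j s')
    (hab : [a, b].Sublist (h.list m i s)) (ha' : a ∈ h.list m' j s') (hb' : b ∈ h.list m' j s') :
    [a, b].Sublist (h.list m' j s') := by
  have hn := (wf.explains_vertex hm hv).nodup
  have ha : a ∈ h.list m i s := hab.subset (by simp)
  have hb : b ∈ h.list m i s := hab.subset (by simp)
  have hne : a ≠ b := by
    have := hab.nodup hn
    simpa using this
  rcases le_total m m' with hle | hle
  · rcases wf.compatible_of_le hle hm' hv hv' hne ha hb ha' hb' with h1 | h1
    · exact h1.2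
    · exact absurd h1.1 (not_pair_sublist_swap hn hab)
  · rcases wf.compatible_of_le hle hm hv' hv hne ha' hb' ha hb with h1 | h1
    · exact h1.1
    · exact absurd h1.2 (not_pair_sublist_swap hn hab)

end WellFormed

end History

end CJupiter

namespace CJupiter

/-! ### The procedure `xForm` -/

theorem Op.before_congr {n : ℕ} {U : Type*} {r : Replica n} {a b c : Op n U}
    (ho : a.oid = b.oid) (hs : a.sctx = b.sctx) : Op.before r a c ↔ Op.before r b c := by
  unfold Op.before
  rw [ho, hs]

namespace CStateSpace

variable {n : ℕ} {U : Type*}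

/-- The order of the edges from a vertex. -/
def edgeBefore (r : Replica n) (e e' : Edge n U) : Prop := Op.before r e.op e'.op

instance (r : Replica n) : DecidableRel (edgeBefore (U := U) r) := by
  unfold edgeBefore; infer_instance

theorem link_edges_self (S : CStateSpace n U) (u v : Finset (Oid n)) (op : Op n U) :
    (S.link u v op).edges u = (S.edges u).orderedInsert (edgeBefore S.rid) ⟨op, v⟩ := by
  simp only [link, Function.update_self]
  rfl

theorem link_edges_of_ne (S : CStateSpace n U) {u v w : Finset (Oid n)} (op : Op n U)
    (hw : w ≠ u) : (S.link u v op).edges w = S.edges w := by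
  simp [link, hw]

theorem head?_orderedInsert {α : Type*} (r : α → α → Prop) [DecidableRel r] (a : α) (l : List α) :
    (l.orderedInsert r a).head? = some a ∧ (∀ b, l.head? = some b → r a b) ∨
      ∃ b, l.head? = some b ∧ ¬ r a b ∧ (l.orderedInsert r a).head? = some b := by
  cases l with
  | nil => simp
  | cons b l =>
    by_cases hab : r a b <;> simp [hab]

theorem orderedInsert_ne_nil {α : Type*} (r : α → α → Prop) [DecidableRel r] (a : α)
    (l : List α) : l.orderedInsert r a ≠ [] :=
  List.ne_nil_of_length_pos (by rw [List.orderedInsert_length]; omega)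

/-- Following the first edges from any vertex that has an edge leads to `S.cur`, within the
subsets of `S.cur`. -/
structure IsTidy (S : CStateSpace n U) : Prop where
  target_eq : ∀ u e, (S.edges u).head? = some e → e.target = insert e.op.oid u
  notMem : ∀ u e, (S.edges u).head? = some e → e.op.oid ∉ u
  subset : ∀ u e, (S.edges u).head? = some e → e.target ⊆ S.cur
  next : ∀ u e, (S.edges u).head? = some e → e.target = S.cur ∨ S.edges e.target ≠ []

/-- The loop of `xForm`, started at the vertex `u` with the operation `op`, visits the vertex `u'`
when it has transformed the operation to `op'`. -/
inductive OnPath (S : CStateSpace n U) : Finset (Oid n) → Op n U → Finset (Oid n) → Op n U → Prop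
  | refl (u : Finset (Oid n)) (op : Op n U) : OnPath S u op u op
  | head {u u' : Finset (Oid n)} {op op' : Op n U} {e : Edge n U} (hu : u ≠ S.cur)
      (he : (S.edges u).head? = some e) (h : OnPath S e.target (op.transform e.op) u' op') :
      OnPath S u op u' op'

variable {S S₀ : CStateSpace n U} {u u' w : Finset (Oid n)} {op op' : Op n U} {e : Edge n U}

theorem OnPath.tail (h : OnPath S u op u' op') (hu : u' ≠ S.cur)
    (he : (S.edges u').head? = some e) : OnPath S u op e.target (op'.transform e.op) := by
  induction h with
  | refl u op => exact OnPath.head hu he (OnPath.refl _ _)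
  | head hu' he' _ ih => exact OnPath.head hu' he' (ih hu he)

theorem OnPath.oid_eq (h : OnPath S u op u' op') : op'.oid = op.oid := by
  induction h with
  | refl u op => rfl
  | head _ _ _ ih => exact ih

theorem OnPath.sctx_eq (h : OnPath S u op u' op') : op'.sctx = op.sctx := by
  induction h with
  | refl u op => rfl
  | head _ _ _ ih => exact ih

theorem exists_head? {α : Type*} {l : List α} (hl : l ≠ []) : ∃ a, l.head? = some a :=
  ⟨l.head hl, List.head?_eq_some_head hl⟩

theorem IsTidy.onPath_ne_nil (hS : S.IsTidy) (h : OnPath S u op u' op')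
    (hu : u = S.cur ∨ S.edges u ≠ []) : u' = S.cur ∨ S.edges u' ≠ [] := by
  induction h with
  | refl u op => exact hu
  | head _ he _ ih => exact ih (hS.next _ _ he)

theorem IsTidy.subset_cur (hS : S.IsTidy) (hu : u = S.cur ∨ S.edges u ≠ []) : u ⊆ S.cur := by
  rcases hu with rfl | hu
  · exact Finset.Subset.refl _
  · obtain ⟨e, he⟩ := exists_head? hu
    have := hS.subset u e he
    rw [hS.target_eq u e he] at this
    exact (Finset.subset_insert _ _).trans this

theorem IsTidy.edges_cur (hS : S.IsTidy) : S.edges S.cur = [] := by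
  by_contra hu
  obtain ⟨e, he⟩ := exists_head? hu
  have := hS.subset _ e he
  rw [hS.target_eq _ e he] at this
  exact hS.notMem _ e he (this (Finset.mem_insert_self _ _))

/-- What the loop of `xForm` does when it is started with the state space `S` at the vertex `u`
with the operation `op`: it adds edges at the vertices on its path and at the vertices obtained
from these by adding `op.oid`. The path is described in terms of a state space `S₀` that agrees
with `S` at all supersets of `u`; `S₀` is the state space in which the execution of `xForm`
began. -/
structure LoopSpec (S₀ S : CStateSpace n U) (u : Finset (Oid n)) (op : Op n U)
    (r : CStateSpace n U × Op n U) : Prop where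
  cur : r.1.cur = insert op.oid S₀.cur
  rid : r.1.rid = S₀.rid
  frame : ∀ w, ¬ u ⊆ w → r.1.edges w = S.edges w
  reach : OnPath S₀ u op S₀.cur r.2
  path : ∀ u' op', OnPath S₀ u op u' op' → (u' = S₀.cur → op' = r.2) ∧
    r.1.edges u' = (S₀.edges u').orderedInsert (edgeBefore S₀.rid) ⟨op', insert op.oid u'⟩
  side : ∀ u' op' e, OnPath S₀ u op u' op' → u' ≠ S₀.cur → (S₀.edges u').head? = some e →
    r.1.edges (insert op.oid u') = [⟨e.op.transform op', insert op.oid e.target⟩]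
  other : ∀ w, u ⊆ w → r.1.edges w = S₀.edges w ∨ (∃ op', OnPath S₀ u op w op') ∨
    ∃ u' op', OnPath S₀ u op u' op' ∧ u' ≠ S₀.cur ∧ w = insert op.oid u'

theorem loopSpec_finish (hrid : S.rid = S₀.rid)
    (hagree : ∀ w, S₀.cur ⊆ w → S.edges w = S₀.edges w) :
    LoopSpec S₀ S S₀.cur op (S.finish S₀.cur (insert op.oid S₀.cur) op, op) := by
  have only : ∀ {u' op'}, OnPath S₀ S₀.cur op u' op' → u' = S₀.cur ∧ op' = op := by
    intro u' op' h
    cases h with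
    | refl => exact ⟨rfl, rfl⟩
    | head hu => exact absurd rfl hu
  refine ⟨rfl, hrid, ?_, OnPath.refl _ _, ?_, ?_, ?_⟩
  · intro w hw
    exact link_edges_of_ne S op (by rintro rfl; exact hw (Finset.Subset.refl _))
  · intro u' op' h
    obtain ⟨rfl, rfl⟩ := only h
    refine ⟨fun _ => rfl, ?_⟩
    have := link_edges_self S S₀.cur (insert op'.oid S₀.cur) op'
    rw [hrid, hagree _ (Finset.Subset.refl _)] at this
    exact this
  · intro u' op' e h hu
    exact absurd (only h).1 hu
  · intro w hw
    by_cases h : w = S₀.cur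
    · subst h
      exact Or.inr (Or.inl ⟨op, OnPath.refl _ _⟩)
    · exact Or.inl ((link_edges_of_ne S op h).trans (hagree w hw))

/-- The bound on the number of iterations suffices, since the vertices on the path are subsets of
`S₀.cur` whose cardinality grows by one in each iteration. -/
theorem IsTidy.xFormLoop (h₀ : S₀.IsTidy) (k : ℕ) : ∀ (S : CStateSpace n U) (u : Finset (Oid n))
    (op : Op n U), S.cur = S₀.cur → S.rid = S₀.rid → (∀ w, u ⊆ w → S.edges w = S₀.edges w) →
    (u = S₀.cur ∨ S₀.edges u ≠ []) → op.oid ∉ S₀.cur → S₀.cur.card ≤ u.card + k →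
    LoopSpec S₀ S u op (CStateSpace.xFormLoop k S u (insert op.oid u) op) := by
  induction k with
  | zero =>
    intro S u op hcur hrid hagree hu hop hk
    obtain rfl : u = S₀.cur := Finset.eq_of_subset_of_card_le (h₀.subset_cur hu) hk
    exact loopSpec_finish hrid hagree
  | succ k ih =>
    intro S u op hcur hrid hagree hu hop hk
    rw [CStateSpace.xFormLoop]
    by_cases huc : u = S.cur
    · rw [if_pos huc]
      obtain rfl : u = S₀.cur := huc.trans hcur
      exact loopSpec_finish hrid hagree
    rw [if_neg huc]
    have huc₀ : u ≠ S₀.cur := hcur ▸ huc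
    obtain ⟨e, he⟩ := exists_head? (hu.resolve_left huc₀)
    have he' : (S.edges u).head? = some e := by rw [hagree u (Finset.Subset.refl _)]; exact he
    simp only [he']
    have htarget := h₀.target_eq u e he
    have hnot := h₀.notMem u e he
    have hsub := h₀.subset u e he
    have hue : u ⊆ e.target := htarget ▸ Finset.subset_insert _ _
    have hemem : e.op.oid ∈ e.target := htarget ▸ Finset.mem_insert_self _ _
    have hopu : op.oid ∉ u := fun hh => hop (hsub (hue hh))
    have hne : e.op.oid ≠ op.oid := fun hh => hop (hh ▸ hsub hemem)
    have hv' : insert e.op.oid (insert op.oid u) = insert op.oid e.target := by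
      rw [htarget, Finset.insert_comm]
    rw [hv']
    set v := insert op.oid u with hv
    set S' := (S.link v (insert op.oid e.target) (e.op.transform op)).link u v op with hS'
    have huv : u ≠ v := fun hh => hopu (hh ▸ Finset.mem_insert_self _ _)
    have h1 : ∀ w, w ≠ u → w ≠ v → S'.edges w = S.edges w := fun w hwu hwv => by
      rw [hS', link_edges_of_ne _ _ hwu, link_edges_of_ne _ _ hwv]
    have hnu : ¬ e.target ⊆ u := fun hh => hnot (hh hemem)
    have hnv : ¬ e.target ⊆ v := fun hh =>
      (Finset.mem_insert.1 (hh hemem)).elim hne hnot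
    have hcard : e.target.card = u.card + 1 := by
      rw [htarget, Finset.card_insert_of_notMem hnot]
    have spec : LoopSpec S₀ S' e.target (op.transform e.op)
        (CStateSpace.xFormLoop k S' e.target (insert op.oid e.target) (op.transform e.op)) :=
      ih S' e.target (op.transform e.op) hcur hrid
      (fun w hw => by
          rw [h1 w (by rintro rfl; exact hnu hw) (by rintro rfl; exact hnv hw)]
          exact hagree w (hue.trans hw))
        (h₀.next u e he) hop (by omega)
    have hSu : S'.edges u = (S₀.edges u).orderedInsert (edgeBefore S₀.rid) ⟨op, v⟩ := by
      rw [hS', link_edges_self, link_edges_of_ne _ _ huv, hagree u (Finset.Subset.refl _)]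
      simp only [link, hrid]
    have hv₀ : S₀.edges v = [] := by
      by_contra hh
      exact hop (h₀.subset_cur (Or.inr hh) (Finset.mem_insert_self _ _))
    have hSv : S'.edges v = [⟨e.op.transform op, insert op.oid e.target⟩] := by
      rw [hS', link_edges_of_ne _ _ huv.symm, link_edges_self, hagree v (Finset.subset_insert _ _),
        hv₀]
      rfl
    refine ⟨spec.cur, spec.rid, ?_, OnPath.head huc₀ he spec.reach, ?_, ?_, ?_⟩
    · intro w hw
      rw [spec.frame w (fun hh => hw (hue.trans hh))]
      refine h1 w ?_ ?_
      · rintro rfl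
        exact hw (Finset.Subset.refl _)
      · rintro rfl
        exact hw (Finset.subset_insert _ _)
    · intro u' op' h
      cases h with
      | refl => exact ⟨fun hh => absurd hh huc₀, (spec.frame u hnu).trans hSu⟩
      | head _ he₂ h =>
        obtain rfl : e = _ := Option.some.inj (he.symm.trans he₂)
        exact spec.path u' op' h
    · intro u' op' e' h hu' he''
      cases h with
      | refl =>
        obtain rfl : e = e' := Option.some.inj (he.symm.trans he'')
        exact (spec.frame _ hnv).trans hSv
      | head _ he₂ h =>
        obtain rfl : e = _ := Option.some.inj (he.symm.trans he₂)
        exact spec.side u' op' e' h hu' he''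
    · intro w hw
      by_cases hwe : e.target ⊆ w
      · rcases spec.other w hwe with h | ⟨op', h⟩ | ⟨u', op', h, hu', rfl⟩
        · exact Or.inl h
        · exact Or.inr (Or.inl ⟨op', OnPath.head huc₀ he h⟩)
        · exact Or.inr (Or.inr ⟨u', op', OnPath.head huc₀ he h, hu', rfl⟩)
      · by_cases hwu : w = u
        · subst hwu
          exact Or.inr (Or.inl ⟨op, OnPath.refl _ _⟩)
        by_cases hwv : w = v
        · exact Or.inr (Or.inr ⟨u, op, OnPath.refl _ _, huc₀, hwv⟩)
        · refine Or.inl ?_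
          rw [spec.frame w hwe, h1 w hwu hwv, hagree w hw]

/-- An operation can be integrated: it is new and its context is a vertex of the state space. A set
of operations is a vertex if it is the current vertex or there is an edge from it. -/
structure CanXForm (S : CStateSpace n U) (op : Op n U) : Prop where
  tidy : S.IsTidy
  new : op.oid ∉ S.cur
  ctx : op.ctx = S.cur ∨ S.edges op.ctx ≠ []

theorem CanXForm.loopSpec (h : CanXForm S op) : LoopSpec S S op.ctx op (S.xForm op) :=
  h.tidy.xFormLoop _ S op.ctx op rfl rfl (fun _ _ => rfl) h.ctx h.new (Nat.le_add_left _ _)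

/-- The edges from a vertex after `xForm`: either they have not changed, or the vertex is on the
path of the loop, or it is opposite to a vertex of the path. -/
theorem CanXForm.cases (h : CanXForm S op) (w : Finset (Oid n)) :
    (S.xForm op).1.edges w = S.edges w ∨ (∃ op', OnPath S op.ctx op w op') ∨
      ∃ u' op', OnPath S op.ctx op u' op' ∧ u' ≠ S.cur ∧ w = insert op.oid u' := by
  by_cases hw : op.ctx ⊆ w
  · exact h.loopSpec.other w hw
  · exact Or.inl (h.loopSpec.frame w hw)

theorem CanXForm.onPath_subset (h : CanXForm S op) (hp : OnPath S op.ctx op u' op') :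
    u' ⊆ S.cur :=
  h.tidy.subset_cur (h.tidy.onPath_ne_nil hp h.ctx)

theorem CanXForm.edges_ne_nil (h : CanXForm S op) (hw : S.edges w ≠ []) :
    (S.xForm op).1.edges w ≠ [] := by
  rcases h.cases w with h1 | ⟨op', h1⟩ | ⟨u', op', h1, hu', rfl⟩
  · rwa [h1]
  · rw [(h.loopSpec.path _ _ h1).2]
    exact orderedInsert_ne_nil _ _ _
  · obtain ⟨e, he⟩ := exists_head? ((h.tidy.onPath_ne_nil h1 h.ctx).resolve_left hu')
    rw [h.loopSpec.side _ _ _ h1 hu' he]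
    simp

theorem CanXForm.isTidy (h : CanXForm S op) : (S.xForm op).1.IsTidy := by
  have spec := h.loopSpec
  have key : ∀ w e, ((S.xForm op).1.edges w).head? = some e →
      e.target = insert e.op.oid w ∧ e.op.oid ∉ w ∧ e.target ⊆ (S.xForm op).1.cur ∧
        (e.target = (S.xForm op).1.cur ∨ (S.xForm op).1.edges e.target ≠ []) := by
    intro w e he
    have hcur : S.cur ⊆ (S.xForm op).1.cur := by
      rw [spec.cur]
      exact Finset.subset_insert _ _
    have hreach : (S.xForm op).1.edges S.cur ≠ [] := by
      rw [(spec.path _ _ spec.reach).2]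
      exact orderedInsert_ne_nil _ _ _
    have old : (S.edges w).head? = some e → e.target = insert e.op.oid w ∧ e.op.oid ∉ w ∧
        e.target ⊆ (S.xForm op).1.cur ∧
        (e.target = (S.xForm op).1.cur ∨ (S.xForm op).1.edges e.target ≠ []) := by
      intro he
      refine ⟨h.tidy.target_eq w e he, h.tidy.notMem w e he, (h.tidy.subset w e he).trans hcur,
        Or.inr ?_⟩
      rcases h.tidy.next w e he with h1 | h1
      · rwa [h1]
      · exact h.edges_ne_nil h1
    rcases h.cases w with h1 | ⟨op', h1⟩ | ⟨u', op', h1, hu', rfl⟩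
    · exact old (h1 ▸ he)
    · rw [(spec.path _ _ h1).2] at he
      rcases head?_orderedInsert (edgeBefore S.rid) ⟨op', insert op.oid w⟩ (S.edges w) with
        ⟨h2, -⟩ | ⟨b, h2, -, h3⟩
      · rw [h2] at he
        obtain rfl := Option.some.inj he
        have hsub := h.onPath_subset h1
        refine ⟨by rw [h1.oid_eq], fun hh => h.new (hsub (h1.oid_eq ▸ hh)), ?_, ?_⟩
        · rw [spec.cur]
          exact Finset.insert_subset_insert _ hsub
        · by_cases hw : w = S.cur
          · rw [spec.cur, hw]
            exact Or.inl rfl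
          · obtain ⟨e', he'⟩ := exists_head? ((h.tidy.onPath_ne_nil h1 h.ctx).resolve_left hw)
            right
            rw [spec.side _ _ _ h1 hw he']
            simp
      · rw [h3] at he
        obtain rfl := Option.some.inj he
        exact old h2
    · obtain ⟨e', he'⟩ := exists_head? ((h.tidy.onPath_ne_nil h1 h.ctx).resolve_left hu')
      rw [spec.side _ _ _ h1 hu' he'] at he
      obtain rfl := Option.some.inj he
      have ht := h.tidy.target_eq _ _ he'
      have hs := h.tidy.subset _ _ he'
      refine ⟨?_, ?_, ?_, ?_⟩
      · change insert op.oid e'.target = insert e'.op.oid (insert op.oid u')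
        rw [ht, Finset.insert_comm]
      · intro hh
        rcases Finset.mem_insert.1 hh with h2 | h2
        · exact h.new (h2 ▸ hs (ht ▸ Finset.mem_insert_self _ _))
        · exact h.tidy.notMem _ _ he' h2
      · rw [spec.cur]
        exact Finset.insert_subset_insert _ hs
      · by_cases hc : e'.target = S.cur
        · rw [spec.cur, ← hc]
          exact Or.inl rfl
        · obtain ⟨e'', he''⟩ := exists_head? ((h.tidy.next _ _ he').resolve_left hc)
          right
          rw [spec.side _ _ _ (h1.tail hu' he') hc he'']
          simp
  exact ⟨fun w e he => (key w e he).1, fun w e he => (key w e he).2.1,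
    fun w e he => (key w e he).2.2.1, fun w e he => (key w e he).2.2.2⟩

/-- The first edge from an old vertex is retained unless the new operation comes before it. -/
theorem CanXForm.head?_of_not_before (h : CanXForm S op) (hw : op.oid ∉ w)
    (he : (S.edges w).head? = some e) (hb : ¬ Op.before S.rid op e.op) :
    ((S.xForm op).1.edges w).head? = some e := by
  rcases h.cases w with h1 | ⟨op', h1⟩ | ⟨u', op', h1, hu', rfl⟩
  · rwa [h1]
  · rw [(h.loopSpec.path _ _ h1).2]
    rcases head?_orderedInsert (edgeBefore S.rid) ⟨op', insert op.oid w⟩ (S.edges w) with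
      ⟨-, h2⟩ | ⟨b, h2, -, h3⟩
    · exact absurd ((Op.before_congr h1.oid_eq h1.sctx_eq).1 (h2 e he)) hb
    · rw [h3, ← h2, he]
  · exact absurd (Finset.mem_insert_self _ _) hw

/-- The edge of the new operation becomes the first one where it comes before the previous first
edge. -/
theorem CanXForm.head?_of_before (h : CanXForm S op) (hp : OnPath S op.ctx op w op')
    (hb : ∀ e, (S.edges w).head? = some e → Op.before S.rid op e.op) :
    ((S.xForm op).1.edges w).head? = some ⟨op', insert op.oid w⟩ := by
  rw [(h.loopSpec.path _ _ hp).2]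
  rcases head?_orderedInsert (edgeBefore S.rid) ⟨op', insert op.oid w⟩ (S.edges w) with
    ⟨h1, -⟩ | ⟨b, h2, h3, -⟩
  · exact h1
  · exact absurd ((Op.before_congr hp.oid_eq hp.sctx_eq).2 (hb b h2)) h3

theorem IsTidy.finish (h : S.IsTidy) (hop : op.oid ∉ S.cur) :
    (S.finish S.cur (insert op.oid S.cur) op).IsTidy ∧
    (S.finish S.cur (insert op.oid S.cur) op).edges S.cur = [⟨op, insert op.oid S.cur⟩] ∧
    ∀ w, w ≠ S.cur → (S.finish S.cur (insert op.oid S.cur) op).edges w = S.edges w := by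
  have h1 : (S.finish S.cur (insert op.oid S.cur) op).edges S.cur =
      [⟨op, insert op.oid S.cur⟩] := by
    have := link_edges_self S S.cur (insert op.oid S.cur) op
    rw [h.edges_cur] at this
    exact this
  have h2 : ∀ w, w ≠ S.cur →
      (S.finish S.cur (insert op.oid S.cur) op).edges w = S.edges w := fun w hw =>
    link_edges_of_ne S op hw
  have hcur : (S.finish S.cur (insert op.oid S.cur) op).cur = insert op.oid S.cur := rfl
  refine ⟨?_, h1, h2⟩
  set S' := S.finish S.cur (insert op.oid S.cur) op
  have key : ∀ w e, (S'.edges w).head? = some e →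
      e.target = insert e.op.oid w ∧ e.op.oid ∉ w ∧ e.target ⊆ S'.cur ∧
        (e.target = S'.cur ∨ S'.edges e.target ≠ []) := by
    intro w e he
    by_cases hw : w = S.cur
    · subst hw
      rw [h1] at he
      obtain rfl := Option.some.inj he
      exact ⟨rfl, hop, Finset.Subset.refl _, Or.inl rfl⟩
    · rw [h2 w hw] at he
      refine ⟨h.target_eq w e he, h.notMem w e he,
        (h.subset w e he).trans (Finset.subset_insert _ _), Or.inr ?_⟩
      by_cases hc : e.target = S.cur
      · rw [hc, h1]
        simp
      · rw [h2 _ hc]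
        exact (h.next w e he).resolve_left hc
  exact ⟨fun w e he => (key w e he).1, fun w e he => (key w e he).2.1,
    fun w e he => (key w e he).2.2.1, fun w e he => (key w e he).2.2.2⟩

theorem isTidy_init (r : Replica n) : (CStateSpace.init r : CStateSpace n U).IsTidy :=
  ⟨fun _ _ h => (by simp [init] at h), fun _ _ h => (by simp [init] at h),
    fun _ _ h => (by simp [init] at h), fun _ _ h => (by simp [init] at h)⟩

end CStateSpace

end CJupiter

namespace CJupiter

theorem Op.transform_o {n : ℕ} {U : Type*} {op op' : Op n U} {q q' : Oid n} {l l' : ListOp U}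
    (hq : op.oid = q) (hq' : op'.oid = q') (hl : op.o = l) (hl' : op'.o = l') :
    (op.transform op').o = ListOp.ot (priority q.1) (priority q'.1) l l' := by
  subst hq hq' hl hl'
  rfl

namespace History

/-! ### State spaces with canonical labels -/

open CStateSpace

variable {n : ℕ} {U : Type*} {h : History n U} {M m s T : ℕ} {i j : Fin n} {Tg : Fin n → ℕ}
  {S : CStateSpace n U} {op : Op n U}

/-- The first edge from `w` belongs to the operation `q` and is labelled with the list operation
`l`; in its label, `sctx` is a subset of `X`. -/
def HasHead (S : CStateSpace n U) (w : Finset (Oid n)) (q : Oid n) (l : ListOp U)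
    (X : Finset (Oid n)) : Prop :=
  ∃ e, (S.edges w).head? = some e ∧ e.op.oid = q ∧ e.op.o = l ∧ e.op.sctx ⊆ X

/-- The numbers of operations of the clients at the vertex `h.vertex M i T` for `h.own M i ≤ T`. -/
def bound (h : History n U) (M : ℕ) (i : Fin n) (T : ℕ) : Fin n → ℕ :=
  Function.update (h.own M) i T

/-- The state space `S` of a replica that has processed the first `M` operations of the server and
the first `T` operations of client `i` (where `i` is the replica itself in the case of a client;
for the server, `T = h.own M i`): from each vertex, the first edge belongs to the first missing
operation, in the order of the server followed by the order at client `i`, and it carries the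
canonical label. -/
structure IsSpace (h : History n U) (S : CStateSpace n U) (M : ℕ) (i : Fin n) (T : ℕ) : Prop where
  tidy : S.IsTidy
  own_le : h.own M i ≤ T
  cur : S.cur = h.vertex M i T
  /-- pending operations occur at their own client only -/
  rid : h.own M i < T → S.rid = Replica.client i
  base_le : ∀ s, s < T → h.base (i, s + 1) ≤ M
  served : ∀ m j s, m < M → h.IsVertex (h.bound M i T) m j s → h.ser m ∉ h.vertex m j s →
    HasHead S (h.vertex m j s) (h.ser m) (h.remoteLabel m j s) (h.served m)
  pending : ∀ s, h.own M i ≤ s → s < T →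
    HasHead S (h.vertex M i s) (i, s + 1) (h.localLabel M i s) ∅

/-- The operation number `m + 1` at the server, in the form in which the server sends it to the
clients. -/
def serverOp (h : History n U) (m : ℕ) : Op n U where
  o := h.org (h.ser m)
  oid := h.ser m
  ctx := h.vertex (h.base (h.ser m)) (h.ser m).1 ((h.ser m).2 - 1)
  sctx := h.served m

/-- The operation `q` as generated by its client. -/
def clientOp (h : History n U) (q : Oid n) : Op n U where
  o := h.org q
  oid := q
  ctx := h.vertex (h.base q) q.1 (q.2 - 1)
  sctx := ∅

theorem HasHead.ne_nil {w X : Finset (Oid n)} {q : Oid n} {l : ListOp U} (hh : HasHead S w q l X) :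
    S.edges w ≠ [] := by
  obtain ⟨e, he, -⟩ := hh
  intro h0
  simp [h0] at he

theorem bound_of_ne (hj : j ≠ i) : h.bound M i T j = h.own M j := by
  simp [bound, hj]

theorem bound_self : h.bound M i T i = T := by
  simp [bound]

theorem own_le_bound (hT : h.own M i ≤ T) : h.own M j ≤ h.bound M i T j := by
  by_cases hj : j = i
  · subst hj
    rwa [bound_self]
  · rw [bound_of_ne hj]

theorem mem_vertex_self (hs : h.own m j ≤ s) {t : ℕ} (ht : 1 ≤ t) :
    (j, t) ∈ h.vertex m j s ↔ t ≤ s := by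
  simp [vertex, mem_vertexOf, ht, hs]

theorem WellFormed.ser_mem_vertex_iff (wf : h.WellFormed M Tg) (hm : m < M) (hs : h.own m j ≤ s) :
    h.ser m ∈ h.vertex m j s ↔ (h.ser m).1 = j ∧ h.own m j < s := by
  by_cases hj : (h.ser m).1 = j
  · have := wf.ser_eq hm
    rw [hj] at this
    rw [this, mem_vertex_self hs (by omega)]
    simp
  · simp [wf.ser_notMem_vertex hm hj, hj]

/-- Every vertex of the history within the range of the state space is a vertex of the latter. -/
theorem IsSpace.vertex_mem (hS : h.IsSpace S M i T) (wf : h.WellFormed M Tg) (hm : m ≤ M)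
    (hv : h.IsVertex (h.bound M i T) m j s) :
    h.vertex m j s = S.cur ∨ S.edges (h.vertex m j s) ≠ [] := by
  obtain ⟨d, rfl⟩ := Nat.exists_eq_add_of_le hm
  induction d generalizing m with
  | zero =>
    have main : ∀ t, h.own m i ≤ t → t ≤ T →
        h.vertex m i t = S.cur ∨ S.edges (h.vertex m i t) ≠ [] := by
      intro t h1 h2
      rcases h2.eq_or_lt with rfl | h2
      · exact Or.inl hS.cur.symm
      · exact Or.inr (hS.pending t h1 h2).ne_nil
    by_cases hj : j = i
    · subst hj
      have := hv.le
      rw [bound_self] at this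
      exact main s hv.own_le this
    · have := hv.le
      rw [bound_of_ne hj] at this
      rw [vertex_of_le (m := m) this, ← vertex_of_le (j := i) le_rfl]
      exact main _ le_rfl hS.own_le
  | succ d ih =>
    by_cases hmem : h.ser m ∈ h.vertex m j s
    · obtain ⟨hj, hs⟩ := (wf.ser_mem_vertex_iff (by omega) hv.own_le).1 hmem
      rw [← WellFormed.vertex_succ_of_eq hj hs]
      have ho : h.own (m + 1) j = h.own m j + 1 := by subst hj; exact own_succ_self
      have hM : m + (d + 1) = m + 1 + d := by omega
      rw [hM] at hS wf hv
      exact ih hS wf (by omega) ⟨by omega, hv.le, fun _ => (hv.base_le hs).trans (Nat.le_succ m)⟩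
    · exact Or.inr (hS.served m j s (by omega) hv hmem).ne_nil

theorem HasHead.ne_cur {w X : Finset (Oid n)} {q : Oid n} {l : ListOp U} (hh : HasHead S w q l X)
    (hS : S.IsTidy) : w ≠ S.cur := by
  rintro rfl
  exact hh.ne_nil hS.edges_cur

theorem WellFormed.of_le (wf : h.WellFormed M Tg) (hm : m ≤ M) : h.WellFormed m Tg where
  ser_snd k hk := wf.ser_snd k (by omega)
  own_le _ := wf.own_le_of_le hm
  base_mono := wf.base_mono
  own_base := wf.own_base
  base_ser k hk := wf.base_ser k (by omega)
  valid := wf.valid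
  unique := wf.unique

/-- Reinterpretation of the state space of a client after the server has processed an operation of
this client, of which the client is not informed. -/
theorem IsSpace.succ_of_own (hS : h.IsSpace S M i T) (wf : h.WellFormed (M + 1) Tg)
    (hi : (h.ser M).1 = i) (hT : h.own M i < T) : h.IsSpace S (M + 1) i T := by
  have ho : h.own (M + 1) i = h.own M i + 1 := by subst hi; exact own_succ_self
  have hne : ∀ j, j ≠ i → h.own (M + 1) j = h.own M j := fun j hj =>
    own_succ_of_ne (by rw [hi]; exact hj.symm)
  have hb : h.bound (M + 1) i T = h.bound M i T := by
    ext j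
    by_cases hj : j = i
    · subst hj; rw [bound_self, bound_self]
    · rw [bound_of_ne hj, bound_of_ne hj, hne j hj]
  refine ⟨hS.tidy, by omega, ?_, fun _ => hS.rid hT, fun s hs => (hS.base_le s hs).trans
    (Nat.le_succ M), ?_, ?_⟩
  · rw [WellFormed.vertex_succ_of_eq hi hT, hS.cur]
  · intro m j s hm hv hmem
    rw [hb] at hv
    rcases Nat.lt_succ_iff_lt_or_eq.1 hm with hm | rfl
    · exact hS.served m j s hm hv hmem
    · have hs : s = h.own m j := by
        have h1 := hv.own_le
        have h2 := hv.le
        by_cases hj : j = i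
        · subst hj
          have h3 := mt (wf.ser_mem_vertex_iff (by omega) h1).2 hmem
          have := fun h4 => h3 ⟨hi, h4⟩
          omega
        · rw [bound_of_ne hj] at h2
          omega
      subst hs
      have hp := hS.pending (h.own m i) le_rfl hT
      rw [vertex_of_le le_rfl] at hp ⊢
      rw [remoteLabel_of_le le_rfl, serverLabel]
      have hser := wf.ser_eq (m := m) (by omega)
      rw [hi] at hser ⊢
      rw [hser]
      obtain ⟨e, h1, h2, h3, h4⟩ := hp
      exact ⟨e, h1, h2, h3, h4.trans (Finset.empty_subset _)⟩
  · intro s hs hsT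
    rw [WellFormed.vertex_succ_of_eq hi (by omega), localLabel_succ_of_eq (hS.base_le s hsT) hi]
    exact hS.pending s (by omega) hsT

/-- A client is not informed of its own operations, so its state space can be regarded as one that
includes all of them up to the next operation of another client. -/
theorem IsSpace.of_own {K : ℕ} (hS : h.IsSpace S K i T) (hK : K ≤ M) (wf : h.WellFormed M Tg)
    (hi : ∀ m, K ≤ m → m < M → (h.ser m).1 = i) (hT : h.own M i ≤ T) : h.IsSpace S M i T := by
  obtain ⟨d, rfl⟩ := Nat.exists_eq_add_of_le hK
  clear hK
  induction d with
  | zero => exact hS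
  | succ d ih =>
    have h1 : h.own (K + d + 1) i = h.own (K + d) i + 1 := by
      have h2 := own_succ_self (h := h) (m := K + d)
      rwa [hi (K + d) (by omega) (by omega)] at h2
    have hT : h.own (K + d + 1) i ≤ T := hT
    exact (ih (wf.of_le (by omega)) (fun m h3 h4 => hi m h3 (by omega)) (by omega)).succ_of_own wf
      (hi _ (by omega) (by omega)) (by omega)

/-- A client generates an operation. -/
theorem IsSpace.finish (hS : h.IsSpace S M i T) (hrid : S.rid = Replica.client i)
    (hbase : h.base (i, T + 1) = M) (hop : op = h.clientOp (i, T + 1)) :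
    h.IsSpace (S.finish S.cur (insert op.oid S.cur) op) M i (T + 1) := by
  subst hop
  have hnew : (i, T + 1) ∉ S.cur := by
    rw [hS.cur]
    exact notMem_vertex hS.own_le
  obtain ⟨h1, h2, h3⟩ := hS.tidy.finish (op := h.clientOp (i, T + 1)) hnew
  refine ⟨h1, hS.own_le.trans (Nat.le_succ T), ?_, fun _ => hrid, ?_, ?_, ?_⟩
  · rw [vertex_succ hS.own_le, ← hS.cur]
    rfl
  · intro s hs
    rcases Nat.lt_succ_iff_lt_or_eq.1 hs with hs | rfl
    · exact hS.base_le s hs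
    · exact hbase.le
  · intro m j s hm hv hmem
    have hv' : h.IsVertex (h.bound M i T) m j s := by
      refine ⟨hv.own_le, ?_, hv.base_le⟩
      have h4 := hv.le
      by_cases hj : j = i
      · subst hj
        rw [bound_self] at h4 ⊢
        by_contra h5
        obtain rfl : s = T + 1 := by omega
        have h6 := own_mono (h := h) hm.le j
        have h7 := hv.base_le (by have := hS.own_le; omega)
        omega
      · rwa [bound_of_ne hj] at h4 ⊢
    have hh := hS.served m j s hm hv' hmem
    obtain ⟨e, he, hr⟩ := hh
    exact ⟨e, by rw [h3 _ (HasHead.ne_cur ⟨e, he, hr⟩ hS.tidy)]; exact he, hr⟩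
  · intro s hs hsT
    rcases Nat.lt_succ_iff_lt_or_eq.1 hsT with hsT | rfl
    · have hh := hS.pending s hs hsT
      obtain ⟨e, he, hr⟩ := hh
      exact ⟨e, by rw [h3 _ (HasHead.ne_cur ⟨e, he, hr⟩ hS.tidy)]; exact he, hr⟩
    · rw [← hS.cur]
      refine ⟨_, by rw [h2]; rfl, rfl, ?_, Finset.Subset.refl _⟩
      rw [localLabel_of_le_base hbase.ge]
      rfl

/-- The replica with state space `S` is about to process the operation number `M + 1` of the
server: it is the server or it is a client other than the one that generated the operation. -/
structure Receives (h : History n U) (S : CStateSpace n U) (M : ℕ) (i : Fin n) (T : ℕ)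
    (Tg : Fin n → ℕ) : Prop where
  space : h.IsSpace S M i T
  wf : h.WellFormed (M + 1) Tg
  other : (h.ser M).1 ≠ i ∨ T = h.own M i

namespace Receives

/-- The context of the operation is a vertex of the state space. -/
theorem canXForm (hr : h.Receives S M i T Tg) : CanXForm S (h.serverOp M) := by
  obtain ⟨hS, wf, hi⟩ := hr
  refine ⟨hS.tidy, ?_, ?_⟩
  · rw [hS.cur]
    rcases hi with hi | rfl
    · exact wf.ser_notMem_vertex (Nat.lt_succ_self M) hi
    · rw [vertex_of_le le_rfl]
      exact wf.ser_notMem_served (Nat.lt_succ_self M)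
  · have hlt : h.own M (h.ser M).1 < Tg (h.ser M).1 := by
      have := wf.own_le (h.ser M).1
      rwa [own_succ_self] at this
    have hser := wf.ser_eq (Nat.lt_succ_self M)
    have hb := wf.base_ser M (Nat.lt_succ_self M)
    have ho := wf.own_base _ _ hlt
    rw [← hser] at ho
    refine hS.vertex_mem (wf.of_le (Nat.le_succ M)) hb ?_
    rw [wf.ser_snd M (Nat.lt_succ_self M), Nat.add_sub_cancel]
    refine ⟨ho, own_le_bound hS.own_le, fun h1 => ?_⟩
    obtain ⟨t, ht⟩ : ∃ t, h.own M (h.ser M).1 = t + 1 := ⟨h.own M (h.ser M).1 - 1, by omega⟩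
    have := wf.base_mono (h.ser M).1 t (by omega)
    rw [hser, ht]
    exact this

/-- The vertices through which `xForm` passes while it follows operations processed by the server.
-/
theorem isVertex_path (hr : h.Receives S M i T Tg) (hm : h.base (h.ser M) ≤ m) (hM : m ≤ M) :
    h.IsVertex (h.bound M i T) m (h.ser M).1 (h.own M (h.ser M).1) := by
  obtain ⟨hS, wf, hi⟩ := hr
  refine ⟨own_mono hM _, own_le_bound hS.own_le, fun h1 => ?_⟩
  have hlt : h.own M (h.ser M).1 < Tg (h.ser M).1 := by
    have := wf.own_le (h.ser M).1
    rwa [own_succ_self] at this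
  obtain ⟨t, ht⟩ : ∃ t, h.own M (h.ser M).1 = t + 1 := ⟨h.own M (h.ser M).1 - 1, by omega⟩
  have := wf.base_mono (h.ser M).1 t (by omega)
  rw [ht]
  rw [wf.ser_eq (Nat.lt_succ_self M), ht] at hm
  exact this.trans hm

/-- The loop of `xForm` follows the operations of the server that are not in the context of the new
operation, and transforms the latter to its canonical labels. -/
theorem onPath_served (hr : h.Receives S M i T Tg) (hm : h.base (h.ser M) ≤ m) (hM : m ≤ M) :
    ∃ op', OnPath S (h.serverOp M).ctx (h.serverOp M)
      (h.vertex m (h.ser M).1 (h.own M (h.ser M).1)) op' ∧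
      op'.o = h.localLabel m (h.ser M).1 (h.own M (h.ser M).1) := by
  have wf := hr.wf
  have hser := wf.ser_eq (Nat.lt_succ_self M)
  induction hm with
  | refl =>
    refine ⟨h.serverOp M, ?_, ?_⟩
    · have : (h.serverOp M).ctx =
          h.vertex (h.base (h.ser M)) (h.ser M).1 (h.own M (h.ser M).1) := by
        unfold serverOp
        simp only
        rw [wf.ser_snd M (Nat.lt_succ_self M), Nat.add_sub_cancel]
      rw [this]
      exact OnPath.refl _ _
    · rw [localLabel_of_le_base (by rw [← hser]), ← hser]
      rfl
  | @step m hm ih =>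
    have hm : h.base (h.ser M) ≤ m := hm
    obtain ⟨op', h1, h2⟩ := ih (by omega)
    have hv := hr.isVertex_path hm (by omega)
    have hb : h.base ((h.ser M).1, h.own M (h.ser M).1 + 1) ≤ m := by rwa [← hser]
    by_cases hj : (h.ser m).1 = (h.ser M).1
    · have h3 : h.own m (h.ser M).1 < h.own M (h.ser M).1 := by
        have h4 := own_mono (h := h) hM (h.ser M).1
        have h5 := own_succ_self (h := h) (m := m)
        rw [hj] at h5
        simp only [Nat.succ_eq_add_one] at h4
        omega
      refine ⟨op', ?_, ?_⟩
      · rwa [Nat.succ_eq_add_one, WellFormed.vertex_succ_of_eq hj h3]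
      · rw [h2, Nat.succ_eq_add_one, localLabel_succ_of_eq hb hj]
    · have hh := hr.space.served m _ _ (by omega) hv
        (wf.ser_notMem_vertex (by omega) hj)
      have hc := hh.ne_cur hr.space.tidy
      obtain ⟨e, he, h3, h4, -⟩ := hh
      refine ⟨op'.transform e.op, ?_, ?_⟩
      · rw [Nat.succ_eq_add_one, wf.vertex_succ_of_ne (by omega) hj, ← h3,
          ← hr.space.tidy.target_eq _ _ he]
        exact h1.tail hc he
      · rw [Nat.succ_eq_add_one, localLabel_succ_of_ne hb hj]
        exact Op.transform_o h1.oid_eq h3 h2 h4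

/-- After the operations of the server, the loop of `xForm` follows the operations of the client
itself that the server had not yet processed. -/
theorem onPath_pending (hr : h.Receives S M i T Tg) (hs : h.own M i ≤ s) (hT : s ≤ T) :
    ∃ op', OnPath S (h.serverOp M).ctx (h.serverOp M) (h.vertex M i s) op' ∧
      op'.o = h.remoteLabel M i s := by
  induction hs with
  | refl =>
    obtain ⟨op', h1, h2⟩ := hr.onPath_served (hr.wf.base_ser M (Nat.lt_succ_self M)) le_rfl
    rw [vertex_of_le le_rfl] at h1
    rw [vertex_of_le le_rfl, remoteLabel_of_le le_rfl]
    exact ⟨op', h1, h2⟩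
  | @step s hs ih =>
    have hs : h.own M i ≤ s := hs
    obtain ⟨op', h1, h2⟩ := ih (by omega)
    have hh := hr.space.pending s hs hT
    have hc := hh.ne_cur hr.space.tidy
    obtain ⟨e, he, h3, h4, -⟩ := hh
    refine ⟨op'.transform e.op, ?_, ?_⟩
    · rw [Nat.succ_eq_add_one, vertex_succ hs, ← h3, ← hr.space.tidy.target_eq _ _ he]
      exact h1.tail hc he
    · rw [Nat.succ_eq_add_one, remoteLabel_succ hs]
      exact Op.transform_o h1.oid_eq h3 h2 h4

/-- The list operation that is applied has the canonical label. -/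
theorem xForm_snd (hr : h.Receives S M i T Tg) :
    (S.xForm (h.serverOp M)).2.o = h.remoteLabel M i T := by
  obtain ⟨op', h1, h2⟩ := hr.onPath_pending hr.space.own_le le_rfl
  rw [← h2, (hr.canXForm.loopSpec.path _ _ h1).1 hr.space.cur.symm]

/-- The first edges that belong to earlier operations of the server. At the old vertices they stay
in front, since their operations are in the `sctx` of the new operation. -/
theorem isSpace_served (hr : h.Receives S M i T Tg) (hm : m < M)
    (hv : h.IsVertex (h.bound (M + 1) i (max T (h.own (M + 1) i))) m j s)
    (hmem : h.ser m ∉ h.vertex m j s) :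
    HasHead (S.xForm (h.serverOp M)).1 (h.vertex m j s) (h.ser m) (h.remoteLabel m j s)
      (h.served m) := by
  have wf := hr.wf
  have hc := hr.canXForm
  have hser := wf.ser_eq (Nat.lt_succ_self M)
  have hT := hr.space.own_le
  have ho : h.own (M + 1) (h.ser M).1 = h.own M (h.ser M).1 + 1 := own_succ_self
  have hle := own_mono (h := h) hm.le j
  by_cases hM : h.ser M ∈ h.vertex m j s
  · -- the vertex is new: it lies on the side of the path opposite to `S`
    obtain rfl : (h.ser M).1 = j := by
      by_contra hj
      rw [vertex, mem_vertexOf, Function.update_of_ne hj, hser] at hM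
      have := own_mono (h := h) hm.le (h.ser M).1
      simp only at hM
      omega
    have hs : s = h.own M (h.ser M).1 + 1 := by
      rw [hser, mem_vertex_self hv.own_le (by omega)] at hM
      have h1 := hv.le
      by_cases hi : (h.ser M).1 = i
      · subst hi
        rw [bound_self] at h1
        have := hr.other.resolve_left (fun hh => hh rfl)
        omega
      · rw [bound_of_ne hi] at h1
        omega
    subst hs
    have hb := hv.base_le (by omega)
    rw [← hser] at hb
    have hv' := hr.isVertex_path hb hm.le
    have hmem' : h.ser m ∉ h.vertex m (h.ser M).1 (h.own M (h.ser M).1) := fun hh =>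
      hmem (vertex_mono (Nat.le_succ _) hh)
    have hh := hr.space.served m _ _ hm hv' hmem'
    have hcur := hh.ne_cur hr.space.tidy
    obtain ⟨e, he, h3, h4, h5⟩ := hh
    obtain ⟨op', h1, h2⟩ := hr.onPath_served hb hm.le
    have hside := hc.loopSpec.side _ _ _ h1 hcur he
    have hvs : insert (h.serverOp M).oid (h.vertex m (h.ser M).1 (h.own M (h.ser M).1)) =
        h.vertex m (h.ser M).1 (h.own M (h.ser M).1 + 1) := by
      rw [vertex_succ hle, ← hser]
      rfl
    rw [hvs] at hside
    refine ⟨⟨e.op.transform op', _⟩, by rw [hside]; rfl, h3, ?_, h5⟩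
    rw [remoteLabel_succ hle]
    exact Op.transform_o h3 h1.oid_eq h4 h2
  · have hv' : h.IsVertex (h.bound M i T) m j s := by
      refine ⟨hv.own_le, ?_, hv.base_le⟩
      have h1 := hv.le
      by_cases hj : (h.ser M).1 = j
      · subst hj
        have h2 : s ≤ h.own M (h.ser M).1 := by
          rw [hser, mem_vertex_self hv.own_le (by omega)] at hM
          omega
        exact h2.trans (own_le_bound hT)
      · have h2 : h.own (M + 1) j = h.own M j := own_succ_of_ne hj
        by_cases hi : j = i
        · subst hi
          rw [bound_self] at h1 ⊢
          omega
        · rw [bound_of_ne hi] at h1 ⊢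
          omega
    obtain ⟨e, he, h3, h4, h5⟩ := hr.space.served m j s hm hv' hmem
    refine ⟨e, hc.head?_of_not_before hM he ?_, h3, h4, h5⟩
    have h6 : (h.serverOp M).oid ∉ e.op.sctx := fun hh =>
      wf.ser_notMem_served (Nat.lt_succ_self M) (vertexOf_mono (own_mono hm.le) (h5 hh))
    have h7 : e.op.oid ∈ (h.serverOp M).sctx := by
      rw [h3]
      exact wf.ser_mem_served hm (Nat.le_succ M)
    simp [Op.before, h6, h7]

/-- The edges of the new operation come first at all vertices where no earlier operation of the
server is missing, that is, before the edges of the pending operations, which have an empty `sctx`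
and belong to the replica itself. -/
theorem isSpace_last (hr : h.Receives S M i T Tg)
    (hv : h.IsVertex (h.bound (M + 1) i (max T (h.own (M + 1) i))) M j s)
    (hmem : h.ser M ∉ h.vertex M j s) :
    HasHead (S.xForm (h.serverOp M)).1 (h.vertex M j s) (h.ser M) (h.remoteLabel M j s)
      (h.served M) := by
  have wf := hr.wf
  have hc := hr.canXForm
  have hT := hr.space.own_le
  have main : ∀ t, h.own M i ≤ t → t ≤ T → HasHead (S.xForm (h.serverOp M)).1 (h.vertex M i t)
      (h.ser M) (h.remoteLabel M i t) (h.served M) := by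
    intro t h1 h2
    obtain ⟨op', h3, h4⟩ := hr.onPath_pending h1 h2
    refine ⟨_, hc.head?_of_before h3 ?_, h3.oid_eq, h4, ?_⟩
    · intro e he
      rcases h2.eq_or_lt with rfl | h2
      · rw [← hr.space.cur, hr.space.tidy.edges_cur] at he
        simp at he
      · obtain ⟨e', he', h5, -, h6⟩ := hr.space.pending t h1 h2
        obtain rfl : e = e' := Option.some.inj (he.symm.trans he')
        have h7 : e.op.oid ∉ (h.serverOp M).sctx := by
          rw [h5]
          change _ ∉ vertexOf _
          rw [mem_vertexOf]
          simp only
          omega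
        have h8 : (h.serverOp M).oid ∉ e.op.sctx := fun hh => by simpa using h6 hh
        have h9 : (h.ser M).1 ≠ i := hr.other.resolve_right (by omega)
        rw [Op.before, if_neg h8, if_neg h7, hr.space.rid (by omega)]
        intro hh
        exact h9 (Replica.client.inj hh)
    · simp only [h3.sctx_eq]
      exact Finset.Subset.refl _
  have hmem' := mt (wf.ser_mem_vertex_iff (Nat.lt_succ_self M) hv.own_le).2 hmem
  have h1 := hv.le
  have h0 := hv.own_le
  have hs : (h.ser M).1 = j → s = h.own M j := fun hh => by
    by_contra h2
    exact hmem' ⟨hh, by omega⟩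
  by_cases hj : (h.ser M).1 = j
  · rw [hs hj, vertex_of_le le_rfl, remoteLabel_of_le le_rfl]
    have := main _ le_rfl hT
    rwa [vertex_of_le le_rfl, remoteLabel_of_le le_rfl] at this
  · have h2 : h.own (M + 1) j = h.own M j := own_succ_of_ne hj
    by_cases hi : j = i
    · subst hi
      rw [bound_self] at h1
      exact main s h0 (by omega)
    · rw [bound_of_ne hi, h2] at h1
      rw [vertex_of_le h1, remoteLabel_of_le h1]
      have := main _ le_rfl hT
      rwa [vertex_of_le le_rfl, remoteLabel_of_le le_rfl] at this

theorem isSpace (hr : h.Receives S M i T Tg) :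
    h.IsSpace (S.xForm (h.serverOp M)).1 (M + 1) i (max T (h.own (M + 1) i)) := by
  have wf := hr.wf
  have hc := hr.canXForm
  have hT := hr.space.own_le
  have hcase : ((h.ser M).1 ≠ i ∧ max T (h.own (M + 1) i) = T ∧ h.own (M + 1) i = h.own M i) ∨
      ((h.ser M).1 = i ∧ T = h.own M i ∧ max T (h.own (M + 1) i) = h.own (M + 1) i ∧
        h.own (M + 1) i = h.own M i + 1) := by
    by_cases hi : (h.ser M).1 = i
    · have h1 := hr.other.resolve_left (fun hh => hh hi)
      have h2 := own_succ_self (h := h) (m := M)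
      rw [hi] at h2
      exact Or.inr ⟨hi, h1, by omega, h2⟩
    · have h2 : h.own (M + 1) i = h.own M i := own_succ_of_ne hi
      exact Or.inl ⟨hi, by omega, h2⟩
  refine ⟨hc.isTidy, le_max_right _ _, ?_, ?_, ?_, ?_, ?_⟩
  · rw [hc.loopSpec.cur, hr.space.cur]
    rcases hcase with ⟨hi, h1, -⟩ | ⟨-, rfl, h1, -⟩
    · rw [h1, wf.vertex_succ_of_ne (Nat.lt_succ_self M) hi]
      rfl
    · rw [h1, vertex_of_le le_rfl, vertex_of_le le_rfl, wf.served_succ (Nat.lt_succ_self M)]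
      rfl
  · intro h0
    rw [hc.loopSpec.rid]
    exact hr.space.rid (by omega)
  · intro t ht
    rcases hcase with ⟨-, h1, -⟩ | ⟨rfl, h1, h2, h3⟩
    · exact (hr.space.base_le t (by omega)).trans (Nat.le_succ M)
    · rcases Nat.lt_or_ge t T with h4 | h4
      · exact (hr.space.base_le t h4).trans (Nat.le_succ M)
      · obtain rfl : t = h.own M (h.ser M).1 := by omega
        rw [← wf.ser_eq (Nat.lt_succ_self M)]
        exact (wf.base_ser M (Nat.lt_succ_self M)).trans (Nat.le_succ M)
  · intro m j s hm hv hmem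
    rcases Nat.lt_succ_iff_lt_or_eq.1 hm with hm | rfl
    · exact hr.isSpace_served hm hv hmem
    · exact hr.isSpace_last hv hmem
  · intro t h0 ht
    rcases hcase with ⟨hi, h1, h2⟩ | ⟨rfl, h1, h2, h3⟩
    · rw [h1] at ht
      rw [h2] at h0
      have hh := hr.space.pending t h0 ht
      have hcur := hh.ne_cur hr.space.tidy
      obtain ⟨e, he, h3, h4, h5⟩ := hh
      obtain ⟨op', h6, h7⟩ := hr.onPath_pending h0 ht.le
      have hside := hc.loopSpec.side _ _ _ h6 hcur he
      rw [wf.vertex_succ_of_ne (Nat.lt_succ_self M) hi]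
      change (S.xForm (h.serverOp M)).1.edges (insert (h.ser M) _) = _ at hside
      refine ⟨⟨e.op.transform op', _⟩, by rw [hside]; rfl, h3, ?_, h5⟩
      rw [localLabel_succ_of_ne (hr.space.base_le t ht) hi]
      exact Op.transform_o h3 h6.oid_eq h4 h7
    · omega

end Receives

end History

end CJupiter

namespace CJupiter

/-! ### The invariant of the protocol -/

open CStateSpace

variable {n : ℕ} {U : Type*} {h : History n U} {M t κ : ℕ} {i : Fin n} {Tg : Fin n → ℕ}

/-- The state of client `i` and of its channels, when the server has processed `M` operations,
and the client has generated `t` operations and received the operation number `κ` of the server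
last. The channels are considered together with the operations that are about to be sent. -/
structure LinkInv (h : History n U) (M : ℕ) (i : Fin n) (t κ : ℕ) (c : ClientState n U)
    (toServer toClient : List (Op n U)) (outbox : Option (Op n U)) : Prop where
  seq : c.seq = t
  rid : c.S.rid = Replica.client i
  space : h.IsSpace c.S κ i t
  content : ListOp.content c.state = h.list κ i t
  known_le : κ ≤ M
  toServer : toServer ++ c.outbox.toList =
    (List.range' (h.own M i) (t - h.own M i)).map fun s => h.clientOp (i, s + 1)
  /-- an operation is sent before the client processes another message -/
  outbox_base : c.outbox ≠ none → h.base (i, t) = κ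
  toClient : toClient ++ outbox.toList =
    ((List.range' κ (M - κ)).filter fun m => (h.ser m).1 ≠ i).map h.serverOp

/-- The invariant of the protocol, in a configuration in which the server has processed `M`
operations, and each client `i` has generated `Tg i` operations and received the operation number
`K i` of the server last. -/
structure Inv (h : History n U) (M : ℕ) (Tg K : Fin n → ℕ) (C : Config n U) : Prop where
  wf : h.WellFormed M Tg
  soids : C.server.soids = h.served M
  server : ∀ i, h.IsSpace C.server.S M i (h.own M i)
  outbox : ∀ i op, C.server.outbox i = some op → ∃ m, M = m + 1 ∧ op = h.serverOp m
  link : ∀ i, LinkInv h M i (Tg i) (K i) (C.client i) (C.toServer i) (C.toClient i)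
    (C.server.outbox i)

theorem LinkInv.doOp {c : ClientState n U} {tS tC : List (Op n U)} {ob : Option (Op n U)}
    {o : ListOp U} (hl : LinkInv h M i t κ c tS tC ob) (idle : c.outbox = none)
    (hle : h.own M i ≤ t) (horg : h.org (i, t + 1) = o.normalize (ListOp.content c.state))
    (hbase : h.base (i, t + 1) = κ) :
    LinkInv h M i (t + 1) κ (c.doOp i o) tS tC ob := by
  have hop : (⟨o.normalize (ListOp.content c.state), (i, c.seq + 1), c.S.cur, ∅⟩ : Op n U) =
      h.clientOp (i, t + 1) := by
    rw [History.clientOp, horg, hl.seq, hbase, hl.space.cur]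
    rfl
  refine ⟨by rw [ClientState.doOp, hl.seq], hl.rid, ?_, ?_, hl.known_le, ?_, fun _ => hbase,
    hl.toClient⟩
  · exact hl.space.finish hl.rid hbase hop
  · change ListOp.content (c.state ++ [_]) = _
    rw [ListOp.content_append_singleton, h.list_succ hl.space.own_le,
      h.localLabel_of_le_base hbase.ge, horg, hl.content]
  · have h1 := hl.toServer
    rw [idle, Option.toList_none, List.append_nil] at h1
    have h2 : t + 1 - h.own M i = t - h.own M i + 1 := by omega
    have h3 : h.own M i + 1 * (t - h.own M i) = t := by omega
    rw [h2, List.range'_concat, List.map_append, ← h1, h3]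
    change tS ++ [_] = _
    rw [hop]
    rfl

/-- The server processes an operation of client `i`. The channel is FIFO, so this is the first one
that has not yet been processed. -/
theorem LinkInv.receive_left {c : ClientState n U} {tS tC : List (Op n U)} {op : Op n U}
    (hl : LinkInv h M i t κ c (op :: tS) tC none) (hser : h.ser M = op.oid) :
    op = h.clientOp (i, h.own M i + 1) ∧ h.own M i < t ∧
      LinkInv h (M + 1) i t κ c tS tC none := by
  have h1 := hl.toServer
  have h2 : h.own M i < t := by
    by_contra h3
    rw [Nat.sub_eq_zero_of_le (by omega)] at h1
    simp at h1
  obtain ⟨d, hd⟩ : ∃ d, t - h.own M i = d + 1 := ⟨t - h.own M i - 1, by omega⟩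
  rw [hd, List.range'_succ, List.map_cons, List.cons_append] at h1
  obtain ⟨h3, h4⟩ := List.cons.inj h1
  have hi : (h.ser M).1 = i := by rw [hser, h3]; rfl
  have ho : h.own (M + 1) i = h.own M i + 1 := by subst hi; exact h.own_succ_self
  refine ⟨h3, h2, hl.seq, hl.rid, hl.space, hl.content, hl.known_le.trans (Nat.le_succ M), ?_,
    hl.outbox_base, ?_⟩
  · have h5 : t - h.own (M + 1) i = d := by omega
    rw [h5, ho, h4]
  · have h5 := hl.toClient
    have hk := hl.known_le
    have h6 : M + 1 - κ = M - κ + 1 := by omega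
    have h7 : κ + 1 * (M - κ) = M := by omega
    rw [h5, h6, List.range'_concat, List.filter_append, h7]
    simp [hi]

/-- The server processes an operation of a client other than `i`. -/
theorem LinkInv.receive_right {c : ClientState n U} {tS tC : List (Op n U)}
    (hl : LinkInv h M i t κ c tS tC none) (hser : (h.ser M).1 ≠ i) :
    LinkInv h (M + 1) i t κ c tS tC (some (h.serverOp M)) := by
  refine ⟨hl.seq, hl.rid, hl.space, hl.content, hl.known_le.trans (Nat.le_succ M), ?_,
    hl.outbox_base, ?_⟩
  · rw [h.own_succ_of_ne hser]
    exact hl.toServer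
  · have h1 := hl.toClient
    rw [Option.toList_none, List.append_nil] at h1
    have hk := hl.known_le
    have h2 : M + 1 - κ = M - κ + 1 := by omega
    have h3 : κ + 1 * (M - κ) = M := by omega
    rw [h2, List.range'_concat, List.filter_append, List.map_append, ← h1, h3]
    simp [hser]

theorem filter_range'_eq_cons {p : ℕ → Bool} {a d m : ℕ} {l : List ℕ}
    (hl : (List.range' a d).filter p = m :: l) :
    a ≤ m ∧ m < a + d ∧ p m ∧ (∀ k, a ≤ k → k < m → ¬ p k) ∧
      l = (List.range' (m + 1) (a + d - (m + 1))).filter p := by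
  induction d generalizing a with
  | zero => simp at hl
  | succ d ih =>
    rw [List.range'_succ, List.filter_cons] at hl
    by_cases hp : p a
    · rw [if_pos hp] at hl
      obtain ⟨rfl, rfl⟩ := List.cons.inj hl
      refine ⟨le_rfl, by omega, hp, fun k _ _ => by omega, ?_⟩
      congr 2
      omega
    · rw [if_neg hp] at hl
      obtain ⟨h1, h2, h3, h4, h5⟩ := ih hl
      refine ⟨by omega, by omega, h3, fun k hk hkm => ?_, ?_⟩
      · rcases hk.eq_or_lt with rfl | hk
        · exact hp
        · exact h4 k hk hkm
      · rw [h5]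
        congr 2
        omega

/-- The list of a client does not change when the server processes operations of this client. -/
theorem History.WellFormed.list_of_own {K : ℕ} (wf : h.WellFormed M Tg) (hK : K ≤ M)
    (hi : ∀ m, K ≤ m → m < M → (h.ser m).1 = i) (hv : h.IsVertex Tg K i t)
    (ht : h.own M i ≤ t) : h.list M i t = h.list K i t := by
  obtain ⟨d, rfl⟩ := Nat.exists_eq_add_of_le hK
  clear hK
  induction d with
  | zero => rfl
  | succ d ih =>
    have h1 : h.own (K + d + 1) i = h.own (K + d) i + 1 := by
      have h2 := own_succ_self (h := h) (m := K + d)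
      rwa [hi (K + d) (by omega) (by omega)] at h2
    have ht : h.own (K + d + 1) i ≤ t := ht
    have h2 := own_mono (h := h) (Nat.le_add_right K d) i
    rw [← ih (wf.of_le (by omega)) (fun m h3 h4 => hi m h3 (by omega)) (by omega)]
    exact (wf.of_le (M := K + (d + 1)) le_rfl).list_succ_of_eq (m := K + d)
      (hi _ (by omega) (by omega))
      ⟨by omega, hv.le, fun h3 => (hv.base_le (by omega)).trans (by omega)⟩ (by omega)

/-- Client `i` processes a message of the server. The operations at the server between the last one
it has received and this one are its own, so its state space is also one for the state of the server
just before this operation. -/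
theorem LinkInv.clientReceive {c : ClientState n U} {tS tC : List (Op n U)} {op : Op n U}
    {ob : Option (Op n U)} (hl : LinkInv h M i (Tg i) κ c tS (op :: tC) ob)
    (idle : c.outbox = none) (wf : h.WellFormed M Tg) :
    ∃ m, κ ≤ m ∧ m < M ∧ op = h.serverOp m ∧ (h.ser m).1 ≠ i ∧
      (c.receive op).S.cur = insert op.oid c.S.cur ∧
      LinkInv h M i (Tg i) (m + 1) (c.receive op) tS tC ob := by
  have h1 := hl.toClient
  rw [List.cons_append] at h1
  obtain ⟨m, l, h2, h3, h4⟩ := List.map_eq_cons_iff.1 h1.symm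
  obtain ⟨h5, h6, h7, h8, h9⟩ := filter_range'_eq_cons h2
  have hκ := hl.known_le
  have hmM : m < M := by omega
  have hm : (h.ser m).1 ≠ i := by simpa using h7
  have hown : h.own m i ≤ Tg i := wf.own_le_of_le hmM.le
  have hi : ∀ k, κ ≤ k → k < m → (h.ser k).1 = i := fun k hk hkm => by
    simpa using h8 k hk hkm
  have hS := hl.space.of_own h5 (wf.of_le hmM.le) hi hown
  have hr : h.Receives c.S m i (Tg i) Tg := ⟨hS, wf.of_le hmM, Or.inl hm⟩
  have hown' : h.own (m + 1) i = h.own m i := h.own_succ_of_ne hm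
  have hS' := hr.isSpace
  rw [hown', max_eq_left hown] at hS'
  subst h3
  have hvκ : h.IsVertex Tg κ i (Tg i) := by
    refine ⟨hl.space.own_le, le_rfl, fun h10 => ?_⟩
    have := hl.space.base_le (Tg i - 1) (by omega)
    rwa [Nat.sub_add_cancel (by omega)] at this
  have hv : h.IsVertex Tg m i (Tg i) := by
    refine ⟨hown, le_rfl, fun h10 => ?_⟩
    have := hS.base_le (Tg i - 1) (by omega)
    rwa [Nat.sub_add_cancel (by omega)] at this
  refine ⟨m, h5, hmM, rfl, hm, hr.canXForm.loopSpec.cur, hl.seq, ?_, hS', ?_, hmM, hl.toServer,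
    fun h10 => absurd idle h10, ?_⟩
  · exact hr.canXForm.loopSpec.rid.trans hl.rid
  · change ListOp.content (c.state ++ [(c.S.xForm (h.serverOp m)).2.o]) = _
    rw [ListOp.content_append_singleton, hl.content, hr.xForm_snd,
      ← (wf.of_le hmM.le).list_of_own h5 hi hvκ hown]
    exact ((wf.correct hmM.le).remote wf hmM hv (Or.inl hm)).2
  · rw [← h4, h9]
    congr 4
    omega

section Steps

variable {C : Config n U} {K : Fin n → ℕ}

theorem Inv.doe {Tg' : Fin n → ℕ} {d : DoEvent n U} (hI : Inv h M Tg K C)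
    (idle : (C.client d.rep).outbox = none)
    (adm : d.o.Admissible (ListOp.content (C.client d.rep).state))
    (horg : h.org (d.rep, Tg d.rep + 1) =
      d.o.normalize (ListOp.content (C.client d.rep).state))
    (hbase : h.base (d.rep, Tg d.rep + 1) = K d.rep)
    (hT : Tg' d.rep = Tg d.rep + 1) (hT' : ∀ j, j ≠ d.rep → Tg' j = Tg j)
    (huniq : ∀ q q' a p p', q ∈ vertexOf Tg' → q' ∈ vertexOf Tg' → h.org q = ListOp.ins a p →
      h.org q' = ListOp.ins a p' → q = q') :
    Inv h M Tg' K { C with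
      client := Function.update C.client d.rep ((C.client d.rep).doOp d.rep d.o) } := by
  have hl := hI.link d.rep
  have hcases : ∀ j s, s < Tg' j → s < Tg j ∨ (j = d.rep ∧ s = Tg d.rep) := by
    intro j s hs
    by_cases hj : j = d.rep
    · subst hj
      rw [hT] at hs
      rcases Nat.lt_succ_iff_lt_or_eq.1 hs with hs | hs
      · exact Or.inl hs
      · exact Or.inr ⟨rfl, hs⟩
    · rw [hT' j hj] at hs
      exact Or.inl hs
  refine ⟨⟨hI.wf.ser_snd, ?_, ?_, ?_, hI.wf.base_ser, ?_, huniq⟩, hI.soids, hI.server, hI.outbox,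
    ?_⟩
  · intro j
    by_cases hj : j = d.rep
    · subst hj
      rw [hT]
      exact (hI.wf.own_le _).trans (Nat.le_succ _)
    · rw [hT' j hj]
      exact hI.wf.own_le j
  · intro j s hs
    rcases hcases j _ hs with h1 | ⟨rfl, h1⟩
    · exact hI.wf.base_mono j s h1
    · change h.base (d.rep, s + 1) ≤ h.base (d.rep, s + 1 + 1)
      rw [h1, hbase, ← h1]
      exact hl.space.base_le s (by omega)
  · intro j s hs
    rcases hcases j _ hs with h1 | ⟨rfl, rfl⟩
    · exact hI.wf.own_base j s h1
    · rw [hbase]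
      exact hl.space.own_le
  · intro j s hs
    rcases hcases j _ hs with h1 | ⟨rfl, rfl⟩
    · exact hI.wf.valid j s h1
    · rw [horg, hbase, ← hl.content]
      exact ListOp.valid_normalize adm
  · intro j
    by_cases hj : j = d.rep
    · subst hj
      simp only [Function.update_self]
      rw [hT]
      exact hl.doOp idle (hI.wf.own_le _) horg hbase
    · simp only [Function.update_of_ne hj]
      rw [hT' j hj]
      exact hI.link j

theorem Inv.clientSend {i : Fin n} {op : Op n U} (hI : Inv h M Tg K C)
    (out : (C.client i).outbox = some op) :
    Inv h M Tg K { C with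
      client := Function.update C.client i { C.client i with outbox := none }
      toServer := Function.update C.toServer i (C.toServer i ++ [op]) } := by
  refine ⟨hI.wf, hI.soids, hI.server, hI.outbox, fun j => ?_⟩
  by_cases hj : j = i
  · subst hj
    have hl := hI.link j
    simp only [Function.update_self]
    refine ⟨hl.seq, hl.rid, hl.space, hl.content, hl.known_le, ?_, fun hh => absurd rfl hh,
      hl.toClient⟩
    rw [← hl.toServer, out]
    simp
  · simp only [Function.update_of_ne hj]
    exact hI.link j

theorem Inv.serverSend {i : Fin n} {op : Op n U} (hI : Inv h M Tg K C)
    (out : C.server.outbox i = some op) :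
    Inv h M Tg K { C with
      server := { C.server with outbox := Function.update C.server.outbox i none }
      toClient := Function.update C.toClient i (C.toClient i ++ [op]) } := by
  refine ⟨hI.wf, hI.soids, hI.server, fun j op' hop' => ?_, fun j => ?_⟩
  · by_cases hj : j = i
    · subst hj
      simp at hop'
    · simp only [Function.update_of_ne hj] at hop'
      exact hI.outbox j op' hop'
  · by_cases hj : j = i
    · subst hj
      have hl := hI.link j
      simp only [Function.update_self]
      refine ⟨hl.seq, hl.rid, hl.space, hl.content, hl.known_le, hl.toServer, hl.outbox_base, ?_⟩
      rw [← hl.toClient, out]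
      simp
    · simp only [Function.update_of_ne hj]
      exact hI.link j

theorem Inv.serverReceive {i : Fin n} {op : Op n U} {q : List (Op n U)} (hI : Inv h M Tg K C)
    (idle : ∀ j, C.server.outbox j = none) (queue : C.toServer i = op :: q)
    (hser : h.ser M = op.oid) :
    Inv h (M + 1) Tg K { C with
      server := C.server.receive op
      toServer := Function.update C.toServer i q } ∧ op = h.clientOp (h.ser M) ∧
      (h.ser M).1 = i := by
  have hl := hI.link i
  rw [queue, idle i] at hl
  obtain ⟨hop, hlt, hl'⟩ := hl.receive_left hser
  have hserM : h.ser M = (i, h.own M i + 1) := by rw [hser, hop]; rfl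
  have hi : (h.ser M).1 = i := by rw [hserM]
  have wf : h.WellFormed (M + 1) Tg := by
    refine ⟨?_, ?_, hI.wf.base_mono, hI.wf.own_base, ?_, hI.wf.valid, hI.wf.unique⟩
    · intro m hm
      rcases Nat.lt_succ_iff_lt_or_eq.1 hm with hm | rfl
      · exact hI.wf.ser_snd m hm
      · rw [hserM]
    · intro j
      by_cases hj : (h.ser M).1 = j
      · subst hj
        rw [h.own_succ_self, hi]
        exact hlt
      · rw [h.own_succ_of_ne hj]
        exact hI.wf.own_le j
    · intro m hm
      rcases Nat.lt_succ_iff_lt_or_eq.1 hm with hm | rfl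
      · exact hI.wf.base_ser m hm
      · rw [hserM]
        exact (hl.space.base_le _ hlt).trans hl.known_le
  have hop₁ : ({ op with sctx := C.server.soids } : Op n U) = h.serverOp M := by
    rw [hop, hI.soids, History.serverOp, History.clientOp, hserM]
  have hop' : op = h.clientOp (h.ser M) := by rw [hserM]; exact hop
  refine ⟨⟨wf, ?_, ?_, ?_, ?_⟩, hop', hi⟩
  · change insert op.oid C.server.soids = _
    rw [wf.served_succ (Nat.lt_succ_self M), hI.soids, hser]
  · intro j
    change h.IsSpace (C.server.S.xForm { op with sctx := C.server.soids }).1 _ _ _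
    rw [hop₁]
    have hr : h.Receives C.server.S M j (h.own M j) Tg :=
      ⟨hI.server j, wf, Or.inr rfl⟩
    have := hr.isSpace
    rwa [max_eq_right (History.own_mono (Nat.le_succ M) j)] at this
  · intro j op' hop'
    change (if j = op.oid.1 then none else some { op with sctx := C.server.soids }) = _ at hop'
    split_ifs at hop' with hj
    rw [hop₁] at hop'
    exact ⟨M, rfl, (Option.some.inj hop').symm⟩
  · intro j
    change LinkInv h (M + 1) j (Tg j) (K j) (C.client j) (Function.update C.toServer i q j)
      (C.toClient j) (if j = op.oid.1 then none else some { op with sctx := C.server.soids })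
    rw [hop₁, ← hser, hi]
    by_cases hj : j = i
    · subst hj
      rw [Function.update_self, if_pos rfl]
      exact hl'
    · rw [Function.update_of_ne hj, if_neg hj]
      have := hI.link j
      rw [idle j] at this
      exact this.receive_right (by rw [hi]; exact Ne.symm hj)

theorem Inv.clientReceive {i : Fin n} {op : Op n U} {q : List (Op n U)} {K' : Fin n → ℕ}
    (hI : Inv h M Tg K C) (idle : (C.client i).outbox = none) (queue : C.toClient i = op :: q)
    (hK : K' i = op.sctx.card + 1) (hK' : ∀ j, j ≠ i → K' j = K j) :
    Inv h M Tg K' { C with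
      client := Function.update C.client i ((C.client i).receive op)
      toClient := Function.update C.toClient i q } ∧
      ∃ m, K i ≤ m ∧ m < M ∧ op = h.serverOp m ∧ (h.ser m).1 ≠ i ∧ K' i = m + 1 ∧
        ((C.client i).receive op).S.cur = insert op.oid (C.client i).S.cur := by
  have hl := hI.link i
  rw [queue] at hl
  obtain ⟨m, h1, h2, h3, h4, h7, h5⟩ := hl.clientReceive idle hI.wf
  have h6 : K' i = m + 1 := by
    rw [hK, h3]
    change (h.served m).card + 1 = _
    rw [hI.wf.card_served h2.le]
  refine ⟨⟨hI.wf, hI.soids, hI.server, hI.outbox, fun j => ?_⟩, m, h1, h2, h3, h4, h6, h7⟩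
  by_cases hj : j = i
  · subst hj
    simp only [Function.update_self]
    rw [h6]
    exact h5
  · simp only [Function.update_of_ne hj]
    rw [hK' j hj]
    exact hI.link j

end Steps

end CJupiter

namespace CJupiter

/-! ### The history of an execution -/

theorem nth_spec {p : ℕ → Prop} [DecidablePred p] {s k : ℕ} (hs : s < Nat.count p k) :
    p (Nat.nth p s) ∧ Nat.count p (Nat.nth p s) = s ∧ Nat.nth p s < k := by
  have hcard : ∀ hf : (Set.ofPred p).Finite, s < hf.toFinset.card := fun hf =>
    hs.trans_le (Nat.count_le_card hf k)
  exact ⟨Nat.nth_mem s hcard, Nat.count_nth hcard, Nat.nth_lt_of_lt_count hs⟩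

variable {n : ℕ} {U : Type*}

section Inversion

variable {C C' : Config n U} {d : DoEvent n U} {i : Fin n} {op : Op n U}

theorem Step.doe_inv (h : Step C (Event.doe d) C') : (C.client d.rep).outbox = none ∧
    d.o.Admissible (ListOp.content (C.client d.rep).state) ∧
    d.val = ListOp.content ((C.client d.rep).doOp d.rep d.o).state ∧
    C' = { C with
      client := Function.update C.client d.rep ((C.client d.rep).doOp d.rep d.o) } := by
  cases h with
  | doe _ idle adm val => exact ⟨idle, adm, val, rfl⟩

theorem Step.clientSend_inv (h : Step C (Event.send (Message.toServer i op)) C') :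
    (C.client i).outbox = some op ∧ C' = { C with
      client := Function.update C.client i { C.client i with outbox := none }
      toServer := Function.update C.toServer i (C.toServer i ++ [op]) } := by
  cases h with
  | clientSend _ _ out => exact ⟨out, rfl⟩

theorem Step.serverReceive_inv (h : Step C (Event.receive (Message.toServer i op)) C') :
    ∃ q, (∀ j, C.server.outbox j = none) ∧ C.toServer i = op :: q ∧ C' = { C with
      server := C.server.receive op
      toServer := Function.update C.toServer i q } := by
  cases h with
  | serverReceive _ _ q idle queue => exact ⟨q, idle, queue, rfl⟩

theorem Step.serverSend_inv (h : Step C (Event.send (Message.toClient i op)) C') :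
    C.server.outbox i = some op ∧ C' = { C with
      server := { C.server with outbox := Function.update C.server.outbox i none }
      toClient := Function.update C.toClient i (C.toClient i ++ [op]) } := by
  cases h with
  | serverSend _ _ out => exact ⟨out, rfl⟩

theorem Step.clientReceive_inv (h : Step C (Event.receive (Message.toClient i op)) C') :
    ∃ q, (C.client i).outbox = none ∧ C.toClient i = op :: q ∧ C' = { C with
      client := Function.update C.client i ((C.client i).receive op)
      toClient := Function.update C.toClient i q } := by
  cases h with
  | clientReceive _ _ q idle queue => exact ⟨q, idle, queue, rfl⟩

end Inversion

/-- `C` is a sequence of configurations for the execution `α`, whose insertions are unique. -/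
structure IsRun (α : Stream'.Seq (Event n U)) (C : ℕ → Config n U) : Prop where
  zero : C 0 = Config.init
  step : ∀ k e, α.get? k = some e → Step (C k) e (C (k + 1))
  unique : UniqueInserts α

/-- The event number `k` is a `do` event of client `i`. -/
def IsDo (α : Stream'.Seq (Event n U)) (i : Fin n) (k : ℕ) : Prop :=
  ∃ d, α.get? k = some (Event.doe d) ∧ d.rep = i

/-- In the event number `k`, the server receives a message. -/
def IsServe (α : Stream'.Seq (Event n U)) (k : ℕ) : Prop :=
  ∃ i op, α.get? k = some (Event.receive (Message.toServer i op))

open Classical in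
/-- The number of operations generated by client `i` before the event number `k`. -/
noncomputable def generated (α : Stream'.Seq (Event n U)) (k : ℕ) (i : Fin n) : ℕ :=
  Nat.count (IsDo α i) k

open Classical in
/-- The number of operations processed by the server before the event number `k`. -/
noncomputable def processed (α : Stream'.Seq (Event n U)) (k : ℕ) : ℕ :=
  Nat.count (IsServe α) k

/-- The number, in the order of the server, of the last operation that client `i` has received
before the event number `k`. The operation number `m + 1` is recognized by the fact that its
`sctx` has `m` elements. -/
def known (α : Stream'.Seq (Event n U)) : ℕ → Fin n → ℕ
  | 0, _ => 0
  | k + 1, i =>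
    match α.get? k with
    | some (Event.receive (Message.toClient j op)) =>
      if j = i then op.sctx.card + 1 else known α k i
    | _ => known α k i

/-- The position of the `do` event that generates the operation `q`. -/
noncomputable def doIndex (α : Stream'.Seq (Event n U)) (q : Oid n) : ℕ :=
  Nat.nth (IsDo α q.1) (q.2 - 1)

/-- The history of an execution. (The identifier `q₀` is a junk value, taken for operations beyond
those processed by the server.) -/
noncomputable def historyOf (q₀ : Oid n) (α : Stream'.Seq (Event n U)) (C : ℕ → Config n U) :
    History n U where
  ser m :=
    match α.get? (Nat.nth (IsServe α) m) with
    | some (Event.receive (Message.toServer _ op)) => op.oid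
    | _ => q₀
  org q :=
    match α.get? (doIndex α q) with
    | some (Event.doe d) => d.o.normalize (ListOp.content ((C (doIndex α q)).client q.1).state)
    | _ => ListOp.nop
  base q := known α (doIndex α q) q.1

section Counts

variable {α : Stream'.Seq (Event n U)} {C : ℕ → Config n U} {k : ℕ} {e : Event n U}
  {q₀ : Oid n} {i : Fin n}

theorem generated_succ_doe {d : DoEvent n U} (h : α.get? k = some (Event.doe d)) :
    generated α (k + 1) d.rep = generated α k d.rep + 1 ∧
      ∀ j, j ≠ d.rep → generated α (k + 1) j = generated α k j := by
  constructor
  · rw [generated, Nat.count_succ, if_pos ⟨d, h, rfl⟩]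
    rfl
  · intro j hj
    rw [generated, Nat.count_succ, if_neg]
    · rfl
    · rintro ⟨d', hd', rfl⟩
      rw [h] at hd'
      obtain rfl := Event.doe.inj (Option.some.inj hd')
      exact hj rfl

theorem generated_succ (h : ∀ d, α.get? k ≠ some (Event.doe d)) :
    generated α (k + 1) = generated α k := by
  ext j
  rw [generated, Nat.count_succ, if_neg]
  · rfl
  · rintro ⟨d, hd, -⟩
    exact h d hd

theorem processed_succ_serve {op : Op n U}
    (h : α.get? k = some (Event.receive (Message.toServer i op))) :
    processed α (k + 1) = processed α k + 1 := by
  rw [processed, Nat.count_succ, if_pos ⟨i, op, h⟩]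
  rfl

theorem processed_succ
    (h : ∀ i op, α.get? k ≠ some (Event.receive (Message.toServer i op))) :
    processed α (k + 1) = processed α k := by
  rw [processed, Nat.count_succ, if_neg]
  · rfl
  · rintro ⟨i, op, hi⟩
    exact h i op hi

theorem known_succ_receive {op : Op n U}
    (h : α.get? k = some (Event.receive (Message.toClient i op))) :
    known α (k + 1) i = op.sctx.card + 1 ∧ ∀ j, j ≠ i → known α (k + 1) j = known α k j := by
  refine ⟨by simp [known, h], fun j hj => by simp [known, h, Ne.symm hj]⟩

theorem known_succ (h : ∀ i op, α.get? k ≠ some (Event.receive (Message.toClient i op))) :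
    known α (k + 1) = known α k := by
  ext j
  rw [known]
  split
  · rename_i i op hi
    exact absurd hi (h i op)
  · rfl

theorem doIndex_eq {d : DoEvent n U} (h : α.get? k = some (Event.doe d)) :
    doIndex α (d.rep, generated α k d.rep + 1) = k := by
  classical
  rw [doIndex, Nat.add_sub_cancel, generated]
  exact Nat.nth_count ⟨d, h, rfl⟩

theorem historyOf_org {d : DoEvent n U} (h : α.get? k = some (Event.doe d)) :
    (historyOf q₀ α C).org (d.rep, generated α k d.rep + 1) =
      d.o.normalize (ListOp.content ((C k).client d.rep).state) := by
  simp only [historyOf, doIndex_eq h, h]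

theorem historyOf_base {d : DoEvent n U} (h : α.get? k = some (Event.doe d)) :
    (historyOf q₀ α C).base (d.rep, generated α k d.rep + 1) = known α k d.rep := by
  simp only [historyOf, doIndex_eq h]

theorem historyOf_ser {op : Op n U}
    (h : α.get? k = some (Event.receive (Message.toServer i op))) :
    (historyOf q₀ α C).ser (processed α k) = op.oid := by
  classical
  have : Nat.nth (IsServe α) (processed α k) = k := Nat.nth_count ⟨i, op, h⟩
  simp only [historyOf, this, h]

/-- Every operation that has been generated is generated by a `do` event. -/
theorem exists_doe {q : Oid n} (hq : q ∈ vertexOf (generated α k)) :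
    ∃ d, α.get? (doIndex α q) = some (Event.doe d) ∧ doIndex α q < k ∧
      q = (d.rep, generated α (doIndex α q) d.rep + 1) := by
  classical
  rw [mem_vertexOf] at hq
  have hlt : q.2 - 1 < generated α k q.1 := by omega
  obtain ⟨⟨d, h1, h2⟩, h3, h4⟩ := nth_spec hlt
  refine ⟨d, h1, h4, Prod.ext h2.symm ?_⟩
  have h5 : generated α (doIndex α q) q.1 = q.2 - 1 := by
    exact h3
  simp only [h2, h5]
  omega

theorem ListOp.normalize_eq_ins {o : ListOp U} {w : List U} {a : U} :
    (∃ p, o.normalize w = ListOp.ins a p) ↔ ∃ p, o = ListOp.ins a p := by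
  cases o <;> simp [ListOp.normalize]

theorem ListOp.normalize_eq_del {o : ListOp U} {w : List U} {a : U} :
    (∃ p, o.normalize w = ListOp.del a p) ↔ ∃ p, o = ListOp.del a p := by
  cases o <;> simp [ListOp.normalize]

theorem IsRun.org_unique (hr : IsRun α C) {q q' : Oid n} {a : U} {p p' : ℕ}
    (hq : q ∈ vertexOf (generated α k)) (hq' : q' ∈ vertexOf (generated α k))
    (h : (historyOf q₀ α C).org q = ListOp.ins a p)
    (h' : (historyOf q₀ α C).org q' = ListOp.ins a p') : q = q' := by
  obtain ⟨d, h1, -, h2⟩ := exists_doe hq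
  obtain ⟨d', h1', -, h2'⟩ := exists_doe hq'
  rw [h2, historyOf_org h1] at h
  rw [h2', historyOf_org h1'] at h'
  obtain ⟨r, hr1⟩ := ListOp.normalize_eq_ins.1 ⟨p, h⟩
  obtain ⟨r', hr1'⟩ := ListOp.normalize_eq_ins.1 ⟨p', h'⟩
  have h3 := hr.unique _ _ d d' a r r' h1 h1' hr1 hr1'
  rw [h3, h1'] at h1
  obtain rfl := Event.doe.inj (Option.some.inj h1)
  rw [h2, h3, ← h2']

/-- The invariant of the protocol at the position `k` of an execution. -/
abbrev InvAt (q₀ : Oid n) (α : Stream'.Seq (Event n U)) (C : ℕ → Config n U) (k : ℕ) : Prop :=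
  Inv (historyOf q₀ α C) (processed α k) (generated α k) (known α k) (C k)

theorem IsRun.inv_zero (hr : IsRun α C) : InvAt q₀ α C 0 := by
  have hM : processed α 0 = 0 := by simp [processed]
  have hT : ∀ j, generated α 0 j = 0 := by simp [generated]
  have hK : ∀ j, known α 0 j = 0 := fun _ => rfl
  have ho : ∀ j, (historyOf q₀ α C).own 0 j = 0 := fun _ => rfl
  have hs : (historyOf q₀ α C).served 0 = ∅ := by
    rw [Finset.eq_empty_iff_forall_notMem]
    intro q
    rw [History.served, mem_vertexOf, ho]
    omega
  have hsp : ∀ r j, (historyOf q₀ α C).IsSpace (CStateSpace.init r) 0 j 0 := by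
    intro r j
    refine ⟨CStateSpace.isTidy_init r, le_rfl, ?_, fun h => absurd h (by simp [ho]),
      fun s hs => absurd hs (by omega), fun m _ _ hm => absurd hm (by omega),
      fun s _ hs => absurd hs (by omega)⟩
    rw [History.vertex_of_le (Nat.zero_le _), hs]
    rfl
  unfold InvAt
  rw [hM, hr.zero]
  refine ⟨⟨fun m hm => absurd hm (by omega), fun j => ?_, fun j s h => ?_, fun j s h => ?_,
    fun m hm => absurd hm (by omega), fun j s h => ?_, fun q q' a p p' => hr.org_unique⟩, hs.symm,
    fun j => ?_, fun j op h => ?_, fun j => ?_⟩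
  · rw [ho]; exact Nat.zero_le _
  · rw [hT] at h; omega
  · rw [hT] at h; omega
  · rw [hT] at h; omega
  · rw [ho]; exact hsp _ j
  · exact absurd h (by simp [Config.init, ServerState.init])
  · rw [hT, hK]
    exact ⟨rfl, rfl, hsp _ j, rfl, le_rfl, rfl, fun h => absurd rfl h, rfl⟩

theorem IsRun.inv_succ (hr : IsRun α C) (he : α.get? k = some e) (hI : InvAt q₀ α C k) :
    InvAt q₀ α C (k + 1) := by
  have hs := hr.step k e he
  unfold InvAt at hI ⊢
  match e, he, hs with
  | .doe d, he, hs =>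
    obtain ⟨idle, adm, -, hC⟩ := hs.doe_inv
    obtain ⟨hT, hT'⟩ := generated_succ_doe he
    rw [processed_succ (by simp [he]), known_succ (by simp [he]), hC]
    exact hI.doe idle adm (historyOf_org he) (historyOf_base he) hT hT'
      (fun q q' a p p' => hr.org_unique)
  | .send (.toServer i op), he, hs =>
    obtain ⟨out, hC⟩ := hs.clientSend_inv
    rw [processed_succ (by simp [he]), known_succ (by simp [he]), generated_succ (by simp [he]), hC]
    exact hI.clientSend out
  | .send (.toClient i op), he, hs =>
    obtain ⟨out, hC⟩ := hs.serverSend_inv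
    rw [processed_succ (by simp [he]), known_succ (by simp [he]), generated_succ (by simp [he]), hC]
    exact hI.serverSend out
  | .receive (.toServer i op), he, hs =>
    obtain ⟨q, idle, queue, hC⟩ := hs.serverReceive_inv
    rw [processed_succ_serve he, known_succ (by simp [he]), generated_succ (by simp [he]), hC]
    exact (hI.serverReceive idle queue (historyOf_ser he)).1
  | .receive (.toClient i op), he, hs =>
    obtain ⟨q, idle, queue, hC⟩ := hs.clientReceive_inv
    obtain ⟨hK, hK'⟩ := known_succ_receive he
    rw [processed_succ (by simp [he]), generated_succ (by simp [he]), hC]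
    exact (hI.clientReceive idle queue hK hK').1

/-- The invariant holds as long as the execution lasts. -/
theorem IsRun.inv (hr : IsRun α C) (he : α.get? k = some e) : InvAt q₀ α C k := by
  induction k generalizing e with
  | zero => exact hr.inv_zero
  | succ k ih =>
    obtain ⟨e', he'⟩ := α.ge_stable (Nat.le_succ k) he
    exact hr.inv_succ he' (ih he')

end Counts

end CJupiter

namespace CJupiter

/-! ### Causality -/

variable {n : ℕ} {U : Type*}

theorem LinkInv.outbox_eq {h : History n U} {M t κ : ℕ} {i : Fin n} {c : ClientState n U}
    {tS tC : List (Op n U)} {ob : Option (Op n U)} {op : Op n U}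
    (hl : LinkInv h M i t κ c tS tC ob) (out : c.outbox = some op) :
    h.own M i < t ∧ op = h.clientOp (i, t) := by
  have h1 := hl.toServer
  rw [out] at h1
  have h2 : h.own M i < t := by
    by_contra h3
    rw [Nat.sub_eq_zero_of_le (by omega)] at h1
    simp at h1
  obtain ⟨d, hd⟩ : ∃ d, t - h.own M i = d + 1 := ⟨t - h.own M i - 1, by omega⟩
  have h3 : h.own M i + 1 * d + 1 = t := by omega
  rw [hd, List.range'_concat, List.map_append] at h1
  have h4 := List.append_inj_right' h1 rfl
  simp only [Option.toList_some, List.map_cons, List.map_nil, List.cons.injEq, and_true] at h4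
  rw [h3] at h4
  exact ⟨h2, h4⟩

theorem LinkInv.server_outbox_eq {h : History n U} {M t κ : ℕ} {i : Fin n} {c : ClientState n U}
    {tS tC : List (Op n U)} {op : Op n U} (hl : LinkInv h M i t κ c tS tC (some op)) :
    ∃ m, κ ≤ m ∧ m < M ∧ (h.ser m).1 ≠ i ∧ op = h.serverOp m := by
  have h1 : op ∈ tC ++ (some op).toList := by simp
  have hk := hl.known_le
  rw [hl.toClient] at h1
  obtain ⟨m, hm, rfl⟩ := List.mem_map.1 h1
  rw [List.mem_filter, List.mem_range'_1] at hm
  exact ⟨m, hm.1.1, by omega, by simpa using hm.2, rfl⟩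

/-- The set of the operations that a replica has generated or received. -/
def knowledge (C : Config n U) : Replica n → Finset (Oid n)
  | Replica.server => C.server.soids
  | Replica.client i => (C.client i).S.cur

section

variable {α : Stream'.Seq (Event n U)} {C : ℕ → Config n U} {k l : ℕ} {e : Event n U}
  {q₀ : Oid n} {i : Fin n}

theorem processed_mono (h : k ≤ l) : processed α k ≤ processed α l := by
  classical
  exact Nat.count_monotone _ h

theorem generated_mono (h : k ≤ l) : generated α k i ≤ generated α l i := by
  classical
  exact Nat.count_monotone _ h

theorem IsRun.known_le_succ (hr : IsRun α C) (q₀ : Oid n) : known α k i ≤ known α (k + 1) i := by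
  by_cases h : ∃ j op, α.get? k = some (Event.receive (Message.toClient j op))
  · obtain ⟨j, op, he⟩ := h
    obtain ⟨hK, hK'⟩ := known_succ_receive he
    by_cases hj : i = j
    · subst hj
      obtain ⟨q, idle, queue, -⟩ := (hr.step k _ he).clientReceive_inv
      obtain ⟨-, m, h1, -, -, -, h2, -⟩ :=
        (hr.inv (q₀ := q₀) he).clientReceive idle queue hK hK'
      rw [h2]
      omega
    · rw [hK' i hj]
  · push Not at h
    rw [known_succ h]

theorem IsRun.known_mono (hr : IsRun α C) (q₀ : Oid n) (hkl : k ≤ l) :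
    known α k i ≤ known α l i :=
  monotone_nat_of_le_succ (f := fun k => known α k i) (fun _ => hr.known_le_succ q₀) hkl

theorem exists_of_lt (he : α.get? k = some e) : ∀ m < k + 1, ∃ e, α.get? m = some e :=
  fun _ hm => α.ge_stable (Nat.le_of_lt_succ hm) he

theorem Inv.knowledge_server {h : History n U} {M : ℕ} {T K : Fin n → ℕ} {C : Config n U}
    (hI : Inv h M T K C) : knowledge C Replica.server = h.served M := hI.soids

theorem Inv.knowledge_client {h : History n U} {M : ℕ} {T K : Fin n → ℕ} {C : Config n U}
    (hI : Inv h M T K C) : knowledge C (Replica.client i) = h.vertex (K i) i (T i) :=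
  (hI.link i).space.cur

theorem IsRun.knowledge_mono (hr : IsRun α C) (q₀ : Oid n) (hkl : k ≤ l)
    (hl : ∀ m < l, ∃ e, α.get? m = some e) (r : Replica n) :
    knowledge (C k) r ⊆ knowledge (C l) r := by
  induction hkl with
  | refl => exact Finset.Subset.refl _
  | @step l hkl ih =>
    refine (ih fun m hm => hl m (Nat.lt_succ_of_lt hm)).trans ?_
    obtain ⟨e, he⟩ := hl l (Nat.lt_succ_self l)
    have hI := hr.inv (q₀ := q₀) he
    have hI' := hr.inv_succ he hI
    cases r with
    | server =>
      rw [hI.knowledge_server, Nat.succ_eq_add_one, hI'.knowledge_server]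
      exact vertexOf_mono (History.own_mono (processed_mono (Nat.le_succ l)))
    | client i =>
      rw [hI.knowledge_client, Nat.succ_eq_add_one, hI'.knowledge_client]
      exact History.vertex_subset_vertex (hr.known_le_succ q₀) (generated_mono (Nat.le_succ l))

/-- A message is received after it has been sent, and its recipient then knows all the operations
that its sender knew. -/
theorem IsRun.message (hr : IsRun α C) (q₀ : Oid n) {m : Message n U}
    (hk : α.get? k = some (Event.send m)) (hl : α.get? l = some (Event.receive m)) :
    k < l ∧ knowledge (C (k + 1)) m.sender ⊆ knowledge (C (l + 1)) m.recipient := by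
  have hIk := hr.inv (q₀ := q₀) hk
  have hIl := hr.inv (q₀ := q₀) hl
  have hIk' := hr.inv_succ hk hIk
  have hIl' := hr.inv_succ hl hIl
  have hne : k ≠ l := by
    rintro rfl
    rw [hk] at hl
    cases hl
  cases m with
  | toServer i op =>
    obtain ⟨out, hC⟩ := (hr.step k _ hk).clientSend_inv
    obtain ⟨q, idle, queue, -⟩ := (hr.step l _ hl).serverReceive_inv
    obtain ⟨hlt, hop⟩ := (hIk.link i).outbox_eq out
    have hbase := (hIk.link i).outbox_base (by rw [out]; simp)
    have hser := historyOf_ser (q₀ := q₀) (C := C) hl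
    have hM := processed_succ_serve hl
    have hoid : op.oid = (i, generated α k i) := by rw [hop]; rfl
    rw [hoid] at hser
    have hwf := hIl'.wf
    rw [hM] at hwf
    have hsnd := hwf.ser_snd _ (Nat.lt_succ_self _)
    have hb := hwf.base_ser _ (Nat.lt_succ_self _)
    have hmem := hwf.ser_mem_served (Nat.lt_succ_self _) le_rfl
    rw [hser] at hsnd hb hmem
    rw [hbase] at hb
    have hown : (historyOf q₀ α C).own (processed α l + 1) i = generated α k i := by
      have := History.own_succ_self (h := historyOf q₀ α C) (m := processed α l)
      rw [hser] at this
      rw [this, ← hsnd]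
    constructor
    · -- otherwise the server would process `op` before it is sent
      by_contra hlk
      have h1 : l + 1 ≤ k := by omega
      have h2 := processed_mono (α := α) h1
      rw [hM] at h2
      have h3 := History.own_mono (h := historyOf q₀ α C) h2 i
      omega
    · change knowledge (C (k + 1)) (Replica.client i) ⊆ knowledge (C (l + 1)) Replica.server
      rw [hIk'.knowledge_client, hIl'.knowledge_server, known_succ (by simp [hk]),
        generated_succ (by simp [hk]), hM]
      rw [← History.vertex_of_le hown.ge]
      exact History.vertex_subset_vertex (hb.trans (Nat.le_succ _)) le_rfl
  | toClient i op =>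
    obtain ⟨out, hC⟩ := (hr.step k _ hk).serverSend_inv
    obtain ⟨q, idle, queue, -⟩ := (hr.step l _ hl).clientReceive_inv
    obtain ⟨hK, hK'⟩ := known_succ_receive hl
    obtain ⟨-, m, h1, h2, h3, h4, h5, -⟩ := hIl.clientReceive idle queue hK hK'
    obtain ⟨m₁, h6, h7⟩ := hIk.outbox i op out
    have hlink := hIk.link i
    rw [out] at hlink
    obtain ⟨m₂, h8, h9, -, h10⟩ := hlink.server_outbox_eq
    have hcard : op.sctx.card = m := by
      rw [h3]
      exact hIl.wf.card_served h2.le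
    obtain rfl : m₁ = m := by
      rw [← hcard, h7]
      exact (hIk.wf.card_served (by omega)).symm
    obtain rfl : m₂ = m₁ := by
      rw [← hcard, h10]
      exact (hIk.wf.card_served h9.le).symm
    constructor
    · -- otherwise client `i` would know `op` before it is sent
      by_contra hlk
      have h11 : l + 1 ≤ k := by omega
      have h12 := hr.known_mono (i := i) q₀ h11
      omega
    · change knowledge (C (k + 1)) Replica.server ⊆ knowledge (C (l + 1)) (Replica.client i)
      rw [hIk'.knowledge_server, hIl'.knowledge_client, processed_succ (by simp [hk]), h6, h5]
      exact History.served_subset_vertex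

/-- If `e` is causally before `e'`, then every operation known after `e` at the replica of `e` is
known after `e'` at the replica of `e'`. -/
theorem IsRun.of_causallyBefore (hr : IsRun α C) (q₀ : Oid n) (h : CausallyBefore α k l) :
    k < l ∧ ∃ e e', α.get? k = some e ∧ α.get? l = some e' ∧
      knowledge (C (k + 1)) e.replica ⊆ knowledge (C (l + 1)) e'.replica := by
  induction h with
  | thread hk hl hrep hlt =>
    refine ⟨hlt, _, _, hk, hl, ?_⟩
    rw [hrep]
    exact hr.knowledge_mono q₀ (Nat.succ_le_succ hlt.le) (exists_of_lt hl) _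
  | message hk hl =>
    obtain ⟨h1, h2⟩ := hr.message q₀ hk hl
    exact ⟨h1, _, _, hk, hl, h2⟩
  | trans _ _ ih ih' =>
    obtain ⟨h1, e, e', he, he', h2⟩ := ih
    obtain ⟨h3, e₁, e₂, he₁, he₂, h4⟩ := ih'
    obtain rfl : e' = e₁ := Option.some.inj (he'.symm.trans he₁)
    exact ⟨h1.trans h3, e, e₂, he, he₂, h2.trans h4⟩

/-- Every operation known to a replica equals or is causally before an event at this replica, and
every operation in transit is causally before the event in which it was sent. (An operation is
identified with the `do` event that generates it.) -/
structure Traced (α : Stream'.Seq (Event n U)) (C : Config n U) (k : ℕ) : Prop where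
  knowledge : ∀ r q, q ∈ knowledge C r → ∃ p < k, ∃ e, α.get? p = some e ∧ e.replica = r ∧
    (doIndex α q = p ∨ CausallyBefore α (doIndex α q) p)
  toServer : ∀ i op, op ∈ C.toServer i → ∃ p < k, α.get? p = some (.send (.toServer i op)) ∧
    CausallyBefore α (doIndex α op.oid) p
  toClient : ∀ i op, op ∈ C.toClient i → ∃ p < k, α.get? p = some (.send (.toClient i op)) ∧
    CausallyBefore α (doIndex α op.oid) p

theorem Traced.causallyBefore {c : Config n U} (ht : Traced α c k) (he : α.get? k = some e)
    {q : Oid n} (hq : q ∈ CJupiter.knowledge c e.replica) :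
    CausallyBefore α (doIndex α q) k := by
  obtain ⟨p, hp, e', he', hrep, h⟩ := ht.knowledge _ q hq
  have hpk := CausallyBefore.thread he' he hrep hp
  rcases h with rfl | h
  · exact hpk
  · exact h.trans hpk

theorem Traced.succ {c c' : Config n U} (ht : Traced α c k) (he : α.get? k = some e)
    (hknow : ∀ r q, q ∈ CJupiter.knowledge c' r → q ∈ CJupiter.knowledge c r ∨ (e.replica = r ∧
      (doIndex α q = k ∨ CausallyBefore α (doIndex α q) k)))
    (hS : ∀ i op, op ∈ c'.toServer i → op ∈ c.toServer i ∨
      (e = .send (.toServer i op) ∧ CausallyBefore α (doIndex α op.oid) k))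
    (hC : ∀ i op, op ∈ c'.toClient i → op ∈ c.toClient i ∨
      (e = .send (.toClient i op) ∧ CausallyBefore α (doIndex α op.oid) k)) :
    Traced α c' (k + 1) := by
  refine ⟨fun r q hq => ?_, fun i op hop => ?_, fun i op hop => ?_⟩
  · rcases hknow r q hq with h | ⟨h1, h2⟩
    · obtain ⟨p, hp, h⟩ := ht.knowledge r q h
      exact ⟨p, by omega, h⟩
    · exact ⟨k, Nat.lt_succ_self k, e, he, h1, h2⟩
  · rcases hS i op hop with h | ⟨h1, h2⟩
    · obtain ⟨p, hp, h⟩ := ht.toServer i op h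
      exact ⟨p, by omega, h⟩
    · exact ⟨k, Nat.lt_succ_self k, h1 ▸ he, h2⟩
  · rcases hC i op hop with h | ⟨h1, h2⟩
    · obtain ⟨p, hp, h⟩ := ht.toClient i op h
      exact ⟨p, by omega, h⟩
    · exact ⟨k, Nat.lt_succ_self k, h1 ▸ he, h2⟩

theorem IsRun.traced_succ (hr : IsRun α C) (q₀ : Oid n) (he : α.get? k = some e)
    (ht : Traced α (C k) k) : Traced α (C (k + 1)) (k + 1) := by
  have hs := hr.step k e he
  have hI := hr.inv (q₀ := q₀) he
  match e, he, hs with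
  | .doe d, he, hs =>
    obtain ⟨-, -, -, hC⟩ := hs.doe_inv
    rw [hC]
    refine ht.succ he (fun r q hq => ?_) (fun _ _ h => Or.inl h) (fun _ _ h => Or.inl h)
    cases r with
    | server => exact Or.inl hq
    | client j =>
      simp only [CJupiter.knowledge] at hq ⊢
      by_cases hj : j = d.rep
      · subst hj
        rw [Function.update_self] at hq
        rcases Finset.mem_insert.1 hq with rfl | hq
        · refine Or.inr ⟨rfl, Or.inl ?_⟩
          rw [(hI.link d.rep).seq]
          exact doIndex_eq he
        · exact Or.inl hq
      · rw [Function.update_of_ne hj] at hq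
        exact Or.inl hq
  | .send (.toServer i op), he, hs =>
    obtain ⟨out, hC⟩ := hs.clientSend_inv
    rw [hC]
    refine ht.succ he (fun r q hq => ?_) (fun j op' h => ?_) (fun _ _ h => Or.inl h)
    · cases r with
      | server => exact Or.inl hq
      | client j =>
        simp only [CJupiter.knowledge] at hq ⊢
        by_cases hj : j = i
        · subst hj
          rw [Function.update_self] at hq
          exact Or.inl hq
        · rw [Function.update_of_ne hj] at hq
          exact Or.inl hq
    · by_cases hj : j = i
      · subst hj
        simp only [Function.update_self, List.mem_append, List.mem_singleton] at h
        rcases h with h | rfl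
        · exact Or.inl h
        · refine Or.inr ⟨rfl, ht.causallyBefore he ?_⟩
          obtain ⟨h1, h2⟩ := (hI.link j).outbox_eq out
          change op'.oid ∈ CJupiter.knowledge (C k) (Replica.client j)
          rw [hI.knowledge_client, h2]
          change (j, generated α k j) ∈ _
          rw [History.mem_vertex_self (hI.link j).space.own_le (by omega)]
      · simp only [Function.update_of_ne hj] at h
        exact Or.inl h
  | .send (.toClient i op), he, hs =>
    obtain ⟨out, hC⟩ := hs.serverSend_inv
    rw [hC]
    refine ht.succ he (fun r q hq => ?_) (fun _ _ h => Or.inl h) (fun j op' h => ?_)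
    · cases r with
      | server => exact Or.inl hq
      | client j => exact Or.inl hq
    · by_cases hj : j = i
      · subst hj
        simp only [Function.update_self, List.mem_append, List.mem_singleton] at h
        rcases h with h | rfl
        · exact Or.inl h
        · refine Or.inr ⟨rfl, ht.causallyBefore he ?_⟩
          obtain ⟨m, h1, h2⟩ := hI.outbox j op' out
          change op'.oid ∈ CJupiter.knowledge (C k) Replica.server
          rw [hI.knowledge_server, h2]
          exact hI.wf.ser_mem_served (by omega) le_rfl
      · simp only [Function.update_of_ne hj] at h
        exact Or.inl h
  | .receive (.toServer i op), he, hs =>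
    obtain ⟨q, idle, queue, hC⟩ := hs.serverReceive_inv
    rw [hC]
    refine ht.succ he (fun r q' hq => ?_) (fun j op' h => ?_) (fun _ _ h => Or.inl h)
    · cases r with
      | server =>
        rcases Finset.mem_insert.1 hq with rfl | hq
        · obtain ⟨p, -, h1, h2⟩ := ht.toServer i op (by rw [queue]; simp)
          exact Or.inr ⟨rfl, Or.inr (h2.trans (CausallyBefore.message h1 he))⟩
        · exact Or.inl hq
      | client j => exact Or.inl hq
    · left
      by_cases hj : j = i
      · subst hj
        simp only [Function.update_self] at h
        rw [queue]
        exact List.mem_cons_of_mem _ h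
      · simpa only [Function.update_of_ne hj] using h
  | .receive (.toClient i op), he, hs =>
    obtain ⟨q, idle, queue, hC⟩ := hs.clientReceive_inv
    rw [hC]
    obtain ⟨hK, hK'⟩ := known_succ_receive he
    obtain ⟨-, m, -, -, -, -, -, hcur⟩ := hI.clientReceive idle queue hK hK'
    refine ht.succ he (fun r q' hq => ?_) (fun _ _ h => Or.inl h) (fun j op' h => ?_)
    · cases r with
      | server => exact Or.inl hq
      | client j =>
        simp only [CJupiter.knowledge] at hq ⊢
        by_cases hj : j = i
        · subst hj
          rw [Function.update_self, hcur] at hq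
          rcases Finset.mem_insert.1 hq with rfl | hq
          · obtain ⟨p, -, h1, h2⟩ := ht.toClient j op (by rw [queue]; simp)
            exact Or.inr ⟨rfl, Or.inr (h2.trans (CausallyBefore.message h1 he))⟩
          · exact Or.inl hq
        · rw [Function.update_of_ne hj] at hq
          exact Or.inl hq
    · left
      by_cases hj : j = i
      · subst hj
        simp only [Function.update_self] at h
        rw [queue]
        exact List.mem_cons_of_mem _ h
      · simpa only [Function.update_of_ne hj] using h

theorem IsRun.traced (hr : IsRun α C) (q₀ : Oid n) (hl : ∀ m < l, ∃ e, α.get? m = some e) :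
    Traced α (C l) l := by
  induction l with
  | zero =>
    rw [hr.zero]
    refine ⟨fun r q hq => ?_, fun i op hop => ?_, fun i op hop => ?_⟩
    · cases r <;> simp [knowledge, Config.init, ServerState.init, ClientState.init,
        CStateSpace.init] at hq
    · simp [Config.init] at hop
    · simp [Config.init] at hop
  | succ l ih =>
    obtain ⟨e, he⟩ := hl l (Nat.lt_succ_self l)
    exact hr.traced_succ q₀ he (ih fun m hm => hl m (Nat.lt_succ_of_lt hm))

/-- The operations known after a `do` event are its own operation and those generated causally
before it. -/
theorem IsRun.mem_knowledge_iff (hr : IsRun α C) {d d' : DoEvent n U}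
    (hk : α.get? k = some (Event.doe d)) (hl : α.get? l = some (Event.doe d')) :
    (d'.rep, generated α l d'.rep + 1) ∈ knowledge (C (k + 1)) (Replica.client d.rep) ↔
      l = k ∨ CausallyBefore α l k := by
  have q₀ : Oid n := (d.rep, 0)
  have hmem : (d'.rep, generated α l d'.rep + 1) ∈
      knowledge (C (l + 1)) (Replica.client d'.rep) := by
    have hI := hr.inv_succ (q₀ := q₀) hl (hr.inv hl)
    rw [hI.knowledge_client, History.mem_vertex_self (hI.link d'.rep).space.own_le (by omega),
      (generated_succ_doe hl).1]
  constructor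
  · intro h
    obtain ⟨p, hp, e, he, hrep, h1⟩ := (hr.traced q₀ (exists_of_lt hk)).knowledge _ _ h
    rw [doIndex_eq hl] at h1
    rcases (Nat.le_of_lt_succ hp).eq_or_lt with rfl | hp
    · exact h1
    · have hpk := CausallyBefore.thread he hk hrep hp
      rcases h1 with rfl | h1
      · exact Or.inr hpk
      · exact Or.inr (h1.trans hpk)
  · rintro (rfl | h)
    · obtain rfl := Event.doe.inj (Option.some.inj (hk.symm.trans hl))
      exact hmem
    · obtain ⟨-, e, e', he, he', h1⟩ := hr.of_causallyBefore q₀ h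
      obtain rfl := Option.some.inj (he.symm.trans hl)
      obtain rfl := Option.some.inj (he'.symm.trans hk)
      exact h1 hmem

end

end CJupiter

namespace CJupiter

/-! ### The abstract execution -/

variable {n : ℕ} {U : Type*}

section

variable {α : Stream'.Seq (Event n U)} {C : ℕ → Config n U} {k l : ℕ} {d d' : DoEvent n U}
  {q₀ : Oid n}

theorem IsRun.val_eq (hr : IsRun α C) (hk : α.get? k = some (Event.doe d)) :
    d.val = (historyOf q₀ α C).list (known α (k + 1) d.rep) d.rep (generated α (k + 1) d.rep) := by
  have hI := hr.inv_succ (q₀ := q₀) hk (hr.inv hk)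
  obtain ⟨-, -, hval, hC⟩ := (hr.step k _ hk).doe_inv
  rw [← (hI.link d.rep).content, hval, hC]
  simp

theorem IsRun.isVertex (hr : IsRun α C) (hk : α.get? k = some (Event.doe d)) (hkl : k + 1 ≤ l) :
    (historyOf q₀ α C).IsVertex (generated α l) (known α (k + 1) d.rep) d.rep
      (generated α (k + 1) d.rep) := by
  have hS := ((hr.inv_succ (q₀ := q₀) hk (hr.inv hk)).link d.rep).space
  refine ⟨hS.own_le, generated_mono hkl, fun h => ?_⟩
  have := hS.base_le (generated α (k + 1) d.rep - 1) (by omega)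
  rwa [Nat.sub_add_cancel (by omega)] at this

theorem IsRun.explainsAt_val (hr : IsRun α C) (hk : α.get? k = some (Event.doe d)) :
    (historyOf q₀ α C).ExplainsAt (knowledge (C (k + 1)) (Replica.client d.rep)) d.val := by
  have hI := hr.inv_succ (q₀ := q₀) hk (hr.inv hk)
  rw [hI.knowledge_client, hr.val_eq (q₀ := q₀) hk]
  exact hI.wf.explains_vertex (hI.link d.rep).known_le (hr.isVertex hk le_rfl)

/-- The responses of any two `do` events are compatible. -/
theorem IsRun.compatible (hr : IsRun α C) (hk : α.get? k = some (Event.doe d))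
    (hl : α.get? l = some (Event.doe d')) {a b : U} (hab : [a, b].Sublist d.val)
    (ha : a ∈ d'.val) (hb : b ∈ d'.val) : [a, b].Sublist d'.val := by
  have q₀ : Oid n := (d.rep, 0)
  have hI : InvAt q₀ α C (max k l + 1) := by
    rcases le_total k l with h | h
    · rw [max_eq_right h]
      exact hr.inv_succ hl (hr.inv hl)
    · rw [max_eq_left h]
      exact hr.inv_succ hk (hr.inv hk)
  have hle : ∀ {j : ℕ} {d : DoEvent n U}, α.get? j = some (Event.doe d) → j ≤ max k l →
      known α (j + 1) d.rep ≤ processed α (max k l + 1) := fun {j d} hj hle =>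
    ((hr.inv_succ (q₀ := q₀) hj (hr.inv hj)).link d.rep).known_le.trans
      (processed_mono (Nat.succ_le_succ hle))
  rw [hr.val_eq (q₀ := q₀) hk] at hab
  rw [hr.val_eq (q₀ := q₀) hl] at ha hb ⊢
  exact hI.wf.compatible (hle hk (le_max_left _ _)) (hle hl (le_max_right _ _))
    (hr.isVertex hk (by omega)) (hr.isVertex hl (by omega)) hab ha hb

/-- The elements inserted by the known operations are those inserted by the visible events. -/
theorem IsRun.inserted_iff (hr : IsRun α C) (hk : α.get? k = some (Event.doe d)) {a : U} :
    (historyOf q₀ α C).Inserted (knowledge (C (k + 1)) (Replica.client d.rep)) a ↔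
      ∃ l d' p, α.get? l = some (Event.doe d') ∧ d'.o = ListOp.ins a p ∧
        (l = k ∨ CausallyBefore α l k) := by
  have hI := hr.inv_succ (q₀ := q₀) hk (hr.inv hk)
  constructor
  · rintro ⟨q, hq, p, hp⟩
    have hq' := hq
    rw [hI.knowledge_client] at hq'
    obtain ⟨d', h1, -, h2⟩ := exists_doe
      (hI.wf.vertex_subset (hI.link d.rep).known_le le_rfl hq')
    rw [h2, historyOf_org h1] at hp
    obtain ⟨p', hp'⟩ := ListOp.normalize_eq_ins.1 ⟨p, hp⟩
    rw [h2] at hq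
    exact ⟨_, d', p', h1, hp', (hr.mem_knowledge_iff hk h1).1 hq⟩
  · rintro ⟨l, d', p, h1, h2, h3⟩
    refine ⟨_, (hr.mem_knowledge_iff hk h1).2 h3, ?_⟩
    rw [historyOf_org h1]
    exact ListOp.normalize_eq_ins.2 ⟨p, h2⟩

/-- The elements deleted by the known operations are those deleted by the visible events. -/
theorem IsRun.deleted_iff (hr : IsRun α C) (hk : α.get? k = some (Event.doe d)) {a : U} :
    (historyOf q₀ α C).Deleted (knowledge (C (k + 1)) (Replica.client d.rep)) a ↔
      ∃ l d' p, α.get? l = some (Event.doe d') ∧ d'.o = ListOp.del a p ∧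
        (l = k ∨ CausallyBefore α l k) := by
  have hI := hr.inv_succ (q₀ := q₀) hk (hr.inv hk)
  constructor
  · rintro ⟨q, hq, p, hp⟩
    have hq' := hq
    rw [hI.knowledge_client] at hq'
    obtain ⟨d', h1, -, h2⟩ := exists_doe
      (hI.wf.vertex_subset (hI.link d.rep).known_le le_rfl hq')
    rw [h2, historyOf_org h1] at hp
    obtain ⟨p', hp'⟩ := ListOp.normalize_eq_del.1 ⟨p, hp⟩
    rw [h2] at hq
    exact ⟨_, d', p', h1, hp', (hr.mem_knowledge_iff hk h1).1 hq⟩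
  · rintro ⟨l, d', p, h1, h2, h3⟩
    refine ⟨_, (hr.mem_knowledge_iff hk h1).2 h3, ?_⟩
    rw [historyOf_org h1]
    exact ListOp.normalize_eq_del.2 ⟨p, h2⟩

theorem IsRun.getElem?_val_of_ins (hr : IsRun α C) (hk : α.get? k = some (Event.doe d)) {a : U}
    {p : ℕ} (ho : d.o = ListOp.ins a p) : d.val[min p (d.val.length - 1)]? = some a := by
  obtain ⟨-, -, hval, -⟩ := (hr.step k _ hk).doe_inv
  rw [ClientState.doOp, ListOp.content_append_singleton, ho] at hval
  set w := ListOp.content ((C k).client d.rep).state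
  have hv : d.val = w.insertIdx (min p w.length) a := by
    rw [hval]
    simp [ListOp.normalize, ListOp.apply]
  have hlen : d.val.length = w.length + 1 := by
    rw [hv, List.length_insertIdx_of_le_length (min_le_right _ _)]
  rw [hlen, Nat.add_sub_cancel, hv, List.getElem?_insertIdx_self, if_pos (min_le_right _ _)]

end

section DoEvents

variable (α : Stream'.Seq (Event n U))

/-- The event number `k` is a `do` event. -/
def IsDoe (k : ℕ) : Prop := ∃ d, α.get? k = some (Event.doe d)

open Classical in
/-- The number of `do` events before the event number `k`. -/
noncomputable def doCount (k : ℕ) : ℕ := Nat.count (IsDoe α) k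

/-- The position in `α` of its `do` event number `i`. -/
noncomputable def doPos (i : ℕ) : ℕ := Nat.nth (IsDoe α) i

/-- The `do` event number `i` of `α`, if it exists. -/
noncomputable def doEvent (i : ℕ) : Option (DoEvent n U) :=
  -- `Nat.nth` has the junk value `0` beyond the last `do` event
  if doCount α (doPos α i) = i then
    match α.get? (doPos α i) with
    | some (Event.doe d) => some d
    | _ => none
  else none

variable {α}

theorem doPos_doCount {k : ℕ} {d : DoEvent n U} (h : α.get? k = some (Event.doe d)) :
    doPos α (doCount α k) = k := by
  classical
  exact Nat.nth_count ⟨d, h⟩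

theorem doEvent_eq_some {i : ℕ} {d : DoEvent n U} :
    doEvent α i = some d ↔ ∃ k, α.get? k = some (Event.doe d) ∧ doCount α k = i := by
  constructor
  · intro h
    unfold doEvent at h
    split_ifs at h with hi
    refine ⟨doPos α i, ?_, hi⟩
    split at h
    · rename_i d' hd
      rwa [← Option.some.inj h]
    · cases h
  · rintro ⟨k, hk, rfl⟩
    rw [doEvent, doPos_doCount hk, if_pos rfl]
    simp [hk]

/-- The sequence of all `do` events of `α`. -/
noncomputable def doEvents (α : Stream'.Seq (Event n U)) : Stream'.Seq (DoEvent n U) :=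
  ⟨doEvent α, by
    intro i hi
    by_contra h
    obtain ⟨d, hd⟩ := Option.ne_none_iff_exists'.1 h
    obtain ⟨k, hk, hki⟩ := doEvent_eq_some.1 hd
    have hlt : i < doCount α k := by omega
    classical
    unfold doCount at hlt
    obtain ⟨⟨d', h1⟩, h2, -⟩ := nth_spec hlt
    have h3 : doEvent α i = some d' := doEvent_eq_some.2 ⟨_, h1, h2⟩
    rw [h3] at hi
    cases hi⟩

theorem get?_doEvents {i : ℕ} {d : DoEvent n U} :
    (doEvents α).get? i = some d ↔ ∃ k, α.get? k = some (Event.doe d) ∧ doCount α k = i :=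
  doEvent_eq_some

theorem get?_doPos {i : ℕ} {d : DoEvent n U} (h : (doEvents α).get? i = some d) :
    α.get? (doPos α i) = some (Event.doe d) ∧ doCount α (doPos α i) = i := by
  obtain ⟨k, hk, rfl⟩ := get?_doEvents.1 h
  rw [doPos_doCount hk]
  exact ⟨hk, rfl⟩

theorem doPos_lt_doPos {i j : ℕ} {d d' : DoEvent n U} (hi : (doEvents α).get? i = some d)
    (hj : (doEvents α).get? j = some d') : doPos α i < doPos α j ↔ i < j := by
  classical
  obtain ⟨h1, h2⟩ := get?_doPos hi
  obtain ⟨h3, h4⟩ := get?_doPos hj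
  constructor
  · intro h
    have : doCount α (doPos α i) < doCount α (doPos α j) := Nat.count_strict_mono ⟨d, h1⟩ h
    rwa [h2, h4] at this
  · intro h
    by_contra hle
    have : doCount α (doPos α j) ≤ doCount α (doPos α i) := Nat.count_monotone _ (not_lt.1 hle)
    omega

/-- The abstract execution of an execution: its `do` events, with the causally-before relation. -/
noncomputable def IsRun.abstractExecution {C : ℕ → Config n U} (hr : IsRun α C) :
    AbstractExecution n U :=
  have lt : ∀ i j, ((∃ d, (doEvents α).get? i = some d) ∧ (∃ d, (doEvents α).get? j = some d) ∧
      CausallyBefore α (doPos α i) (doPos α j)) → i < j := by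
    rintro i j ⟨⟨d, hi⟩, ⟨d', hj⟩, h⟩
    exact (doPos_lt_doPos hi hj).1 (hr.of_causallyBefore (d.rep, 0) h).1
  { H := doEvents α
    vis := fun i j => (∃ d, (doEvents α).get? i = some d) ∧ (∃ d, (doEvents α).get? j = some d) ∧
      CausallyBefore α (doPos α i) (doPos α j)
    vis_mem := fun _ _ h => ⟨h.1, h.2.1⟩
    acyclic := fun i h => by
      exact lt_irrefl i (Relation.TransGen.trans_induction_on (motive := fun {i j} _ => i < j) h
        (fun h => lt _ _ h) (fun _ _ => lt_trans))
    vis_of_thread := fun i j d d' hi hj hij hrep =>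
      ⟨⟨d, hi⟩, ⟨d', hj⟩, CausallyBefore.thread (get?_doPos hi).1 (get?_doPos hj).1
        (congrArg Replica.client hrep) ((doPos_lt_doPos hi hj).2 hij)⟩
    lt_of_vis := lt
    vis_trans := fun _ _ _ h h' => ⟨h.1, h'.2.1, h.2.2.trans h'.2.2⟩ }

variable {C : ℕ → Config n U} {k l j : ℕ} {d : DoEvent n U} {a : U}

theorem IsRun.exists_visible_iff (hr : IsRun α C) (hj : (doEvents α).get? j = some d)
    (P : DoEvent n U → ℕ → Prop) :
    (∃ i d' p, hr.abstractExecution.H.get? i = some d' ∧ P d' p ∧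
      (i = j ∨ hr.abstractExecution.vis i j)) ↔
    ∃ l d' p, α.get? l = some (Event.doe d') ∧ P d' p ∧
      (l = doPos α j ∨ CausallyBefore α l (doPos α j)) := by
  constructor
  · rintro ⟨i, d', p, hi, hp, h⟩
    refine ⟨doPos α i, d', p, (get?_doPos hi).1, hp, ?_⟩
    rcases h with rfl | h
    · exact Or.inl rfl
    · exact Or.inr h.2.2
  · rintro ⟨l, d', p, hl, hp, h⟩
    have hi : (doEvents α).get? (doCount α l) = some d' := get?_doEvents.2 ⟨l, hl, rfl⟩
    refine ⟨doCount α l, d', p, hi, hp, ?_⟩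
    rcases h with rfl | h
    · exact Or.inl (get?_doPos hj).2
    · refine Or.inr ⟨⟨d', hi⟩, ⟨d, hj⟩, ?_⟩
      rwa [doPos_doCount hl]

theorem IsRun.compliesVia (hr : IsRun α C) :
    AbstractExecution.CompliesVia α hr.abstractExecution (doPos α) where
  map _ _ hi := (get?_doPos hi).1
  surj k _ hk := ⟨doCount α k, get?_doEvents.2 ⟨k, hk, rfl⟩, doPos_doCount hk⟩
  mono _ _ _ _ hi hj _ hij := (doPos_lt_doPos hi hj).2 hij

theorem IsRun.weakListSpec (hr : IsRun α C) : hr.abstractExecution.WeakListSpec := by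
  have mem_iff : ∀ {j d}, hr.abstractExecution.H.get? j = some d → ∀ a, a ∈ d.val ↔
      hr.abstractExecution.InsVisible a j ∧ ¬ hr.abstractExecution.DelVisible a j := by
    intro j d hj a
    have hk := (get?_doPos hj).1
    rw [(hr.explainsAt_val (q₀ := (d.rep, 0)) hk).mem_iff, hr.inserted_iff hk, hr.deleted_iff hk]
    unfold AbstractExecution.InsVisible AbstractExecution.DelVisible
    rw [hr.exists_visible_iff hj fun d' p => d'.o = ListOp.ins a p,
      hr.exists_visible_iff hj fun d' p => d'.o = ListOp.del a p]
  have mem_elems : ∀ {j d}, hr.abstractExecution.H.get? j = some d → ∀ a ∈ d.val,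
      a ∈ hr.abstractExecution.elems := by
    intro j d hj a ha
    obtain ⟨⟨i, d', p, hi, hp, -⟩, -⟩ := (mem_iff hj a).1 ha
    exact ⟨i, d', p, hi, hp⟩
  have nodup : ∀ {j d}, hr.abstractExecution.H.get? j = some d → d.val.Nodup := by
    intro j d hj
    exact (hr.explainsAt_val (q₀ := (d.rep, 0)) (get?_doPos hj).1).nodup
  -- the list order relates two elements in the order in which they occur together in a response
  refine ⟨fun a b => ∃ j d, hr.abstractExecution.H.get? j = some d ∧ [a, b].Sublist d.val,
    ?_, ?_, ?_, ?_⟩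
  · rintro a b ⟨j, d, hj, hab⟩
    exact ⟨mem_elems hj a (hab.subset (by simp)), mem_elems hj b (hab.subset (by simp))⟩
  · intro j d hj
    refine ⟨mem_elems hj, mem_iff hj, ?_, fun a p ho => hr.getElem?_val_of_ins (get?_doPos hj).1 ho⟩
    intro i i' hi hi' hlt
    exact ⟨j, d, hj, pair_sublist_of_lt hi hi' hlt⟩
  · rintro a ⟨j, d, hj, haa⟩
    have := haa.nodup (nodup hj)
    simp at this
  · intro j d hj
    have hk := (get?_doPos hj).1
    refine ⟨?_, ?_⟩
    · rintro a ha b hb c hc ⟨j₁, d₁, hj₁, hab⟩ ⟨j₂, d₂, hj₂, hbc⟩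
      have hab := hr.compatible (get?_doPos hj₁).1 hk hab ha hb
      have hbc := hr.compatible (get?_doPos hj₂).1 hk hbc hb hc
      exact ⟨j, d, hj, pair_sublist_trans (nodup hj) hab hbc⟩
    · intro a ha b hb hab
      exact (pair_sublist_or ha hb hab).imp (fun h => ⟨j, d, hj, h⟩) (fun h => ⟨j, d, hj, h⟩)

end DoEvents

end CJupiter

theorem mainTheorem1 {U : Type*} {n : ℕ} (α : Stream'.Seq (CJupiter.Event n U))
    (hα : CJupiter.IsExecution α) (hu : CJupiter.UniqueInserts α) :
    ∃ (A : CJupiter.AbstractExecution n U) (f : ℕ → ℕ),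
      CJupiter.AbstractExecution.CompliesVia α A f ∧
      (∀ i j, A.vis i j ↔ (∃ d, A.H.get? i = some d) ∧ (∃ d, A.H.get? j = some d) ∧
        CJupiter.CausallyBefore α (f i) (f j)) ∧
      A.WeakListSpec := by
  obtain ⟨C, h₀, hstep⟩ := hα
  have hr : CJupiter.IsRun α C := ⟨h₀, hstep, hu⟩
  exact ⟨hr.abstractExecution, CJupiter.doPos α, hr.compliesVia, fun _ _ => Iff.rfl,
    hr.weakListSpec⟩
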